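/- All graphs are finite, simple and undirected, with nonnegative real edge weights. The weight of a path is the sum of its edge weights, and the distance $d_H(a,b)$ in a graph $H$ is the minimum weight of a path of $H$ from $a$ to $b$, with $d_H(a,b)=\infty$ if there is none. For an edge $e$, $H-e$ is $H$ with $e$ deleted; for a node $v$, $H-v$ is $H$ with $v$ and its incident edges deleted. The model of computation is the random access machine with zero-initialised memory: its integer words (used for data and for addresses) are less than a constant times $n+m$, i.e. have $\log_2(n+m)+O(1)$ bits, with unit-cost addition, subtraction, multiplication, division and comparison of words; its weights are elements of $[0,\infty]$, which can only be copied, added and compared, at unit cost (the constants $0$ and $\infty$ are available). A graph is given by the numbers of its nodes and edges and a list of its edges with their weights, in arbitrary order. Theorem. Let $G$ be an undirected graph with $n$ nodes and $m$ edges, let $r\neq s$ be two nodes of $G$, and let $P$ be a given shortest path of $G$ from $r$ to $s$, i.e. a path of weight $d_G(r,s)$, given as the sequence of its nodes. Suppose that the distances $d_G(r,v)$ and $d_G(v,s)$ are given for all nodes $v$ of $G$. Then: (1) The distances $d_{G-e}(r,s)$ for all edges $e$ of $P$ can be computed in $O(n+m)$ time. (2) The problem of computing $d_{G-v}(r,s)$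 for all nodes $v$ of $P$ other than $r$ and $s$ can be reduced in $O(n+m)$ time to one single-source shortest-paths problem on an undirected graph $G_0$ with $O(n)$ nodes and $O(m)$ edges: there is an algorithm that first constructs such a graph $G_0$ and a node $r_0$ of $G_0$, then is supplied with the distances $d_{G_0}(r_0,v)$ for all nodes $v$ of $G_0$, and then outputs all the required $d_{G-v}(r,s)$, its total running time, not counting the computation of the distances in $G_0$, being $O(n+m)$. In both parts there is one algorithm, and one set of constants in the $O(\cdot)$-bounds and in the bound on the words, for all inputs. -/

import Mathlib

open scoped NNReal ENNReal

namespace ReplacementPaths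

/-! ### Weighted undirected graphs and distances -/

/-- The total edge weight `w(P)` of a walk (for a path no edge is repeated). -/
noncomputable def walkWeight {V : Type*} {G : SimpleGraph V} {a b : V}
    (w : Sym2 V → ℝ≥0) (p : G.Walk a b) : ℝ≥0 :=
  (p.edges.map w).sum

/-- The distance `d_G(a,b)`: the minimum weight of a path from `a` to `b`, and `∞` if there is
no such path. -/
noncomputable def wdist {V : Type*} (G : SimpleGraph V) (w : Sym2 V → ℝ≥0) (a b : V) : ℝ≥0∞ :=
  ⨅ p : G.Path a b, (walkWeight w p.1 : ℝ≥0∞)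

/-- `G - e`. -/
def deleteEdge {V : Type*} (G : SimpleGraph V) (e : Sym2 V) : SimpleGraph V :=
  G.deleteEdges {e}

/-- `G - v`: the node `v` is removed together with its incident edges. -/
def deleteNode {V : Type*} (G : SimpleGraph V) (v : V) : SimpleGraph {x : V // x ≠ v} :=
  G.comap Subtype.val

/-- The edge weights of `G - v`, inherited from `G`. -/
def deleteNodeWeight {V : Type*} (w : Sym2 V → ℝ≥0) (v : V) : Sym2 {x : V // x ≠ v} → ℝ≥0 :=
  fun e => w (e.map Subtype.val)

/-- An undirected graph on the nodes `0, …, n-1` with `m` edges of nonnegative real weights, and a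
list of its edges (each edge exactly once, in arbitrary order and orientation). -/
structure ListedGraph (n m : ℕ) where
  graph : SimpleGraph (Fin n)
  weight : Sym2 (Fin n) → ℝ≥0
  fst : Fin m → Fin n
  snd : Fin m → Fin n
  edge_injective : Function.Injective fun j => s(fst j, snd j)
  edge_range : Set.range (fun j => s(fst j, snd j)) = graph.edgeSet

/-- An instance of the replacement-paths problem: an undirected graph with `n` nodes and `m` edges,
two distinct nodes `r` and `s`, and a shortest path `P` from `r` to `s`. -/
structure RPInstance (n m : ℕ) extends ListedGraph n m where
  r : Fin n
  s : Fin n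
  r_ne_s : r ≠ s
  P : graph.Walk r s
  P_isPath : P.IsPath
  P_shortest : (walkWeight weight P : ℝ≥0∞) = wdist graph weight r s

/-! ### The machine

A random access machine whose integer cells are words and whose weight cells hold elements of
`[0, ∞]`.  Weights can only be copied, added and compared, and integers cannot be turned into
weights or conversely.  The memory consists of arrays; a program is a fixed finite text, so it
names only finitely many arrays, and the machine is an ordinary RAM with a fixed number of memory
banks.  All cells that do not belong to the input initially hold `0`. -/

/-- The memory contents: `int a i` and `wt a i` are the `i`-th cells of the `a`-th integer array
and of the `a`-th weight array. -/
@[ext]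
structure State where
  int : ℕ → ℕ → ℕ
  wt : ℕ → ℕ → ℝ≥0∞

/-- Write the word `x` to a cell. -/
def State.setInt (σ : State) (a i x : ℕ) : State where
  int := Function.update σ.int a (Function.update (σ.int a) i x)
  wt := σ.wt

/-- Write the weight `x` to a cell. -/
noncomputable def State.setWt (σ : State) (a i : ℕ) (x : ℝ≥0∞) : State where
  int := σ.int
  wt := Function.update σ.wt a (Function.update (σ.wt a) i x)

/-- Integer expressions; subtraction is truncated at `0`, division is rounded down (and division
by `0` gives `0`). -/
inductive IExp where
  | const (k : ℕ)
  | cell (a : ℕ) (i : IExp)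
  | add (x y : IExp)
  | sub (x y : IExp)
  | mul (x y : IExp)
  | div (x y : IExp)

/-- The value of an integer expression. -/
def IExp.val (σ : State) : IExp → ℕ
  | .const k => k
  | .cell a i => σ.int a (i.val σ)
  | .add x y => x.val σ + y.val σ
  | .sub x y => x.val σ - y.val σ
  | .mul x y => x.val σ * y.val σ
  | .div x y => x.val σ / y.val σ

/-- All values (in particular all addresses) that arise when the expression is evaluated are words,
that is, they are less than `W`. -/
def IExp.Fits (W : ℕ) (σ : State) : IExp → Prop
  | .const k => k < W
  | .cell a i => i.Fits W σ ∧ σ.int a (i.val σ) < W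
  | .add x y => x.Fits W σ ∧ y.Fits W σ ∧ x.val σ + y.val σ < W
  | .sub x y => x.Fits W σ ∧ y.Fits W σ
  | .mul x y => x.Fits W σ ∧ y.Fits W σ ∧ x.val σ * y.val σ < W
  | .div x y => x.Fits W σ ∧ y.Fits W σ

/-- The number of constants, memory accesses and operations in an expression. -/
def IExp.size : IExp → ℕ
  | .const _ => 1
  | .cell _ i => i.size + 1
  | .add x y => x.size + y.size + 1
  | .sub x y => x.size + y.size + 1
  | .mul x y => x.size + y.size + 1
  | .div x y => x.size + y.size + 1

/-- Weight expressions. -/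
inductive WExp where
  | zero
  | top
  | cell (a : ℕ) (i : IExp)
  | add (x y : WExp)

/-- The value of a weight expression. -/
noncomputable def WExp.val (σ : State) : WExp → ℝ≥0∞
  | .zero => 0
  | .top => ⊤
  | .cell a i => σ.wt a (i.val σ)
  | .add x y => x.val σ + y.val σ

/-- All addresses that arise are words. -/
def WExp.Fits (W : ℕ) (σ : State) : WExp → Prop
  | .zero => True
  | .top => True
  | .cell _ i => i.Fits W σ
  | .add x y => x.Fits W σ ∧ y.Fits W σ

/-- The number of constants, memory accesses and operations in an expression. -/
def WExp.size : WExp → ℕ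
  | .zero => 1
  | .top => 1
  | .cell _ i => i.size + 1
  | .add x y => x.size + y.size + 1

/-- Tests. -/
inductive Test where
  | ile (x y : IExp)
  | wle (x y : WExp)
  | not (b : Test)
  | and (b b' : Test)

/-- The test succeeds. -/
def Test.Holds (σ : State) : Test → Prop
  | .ile x y => x.val σ ≤ y.val σ
  | .wle x y => x.val σ ≤ y.val σ
  | .not b => ¬ b.Holds σ
  | .and b b' => b.Holds σ ∧ b'.Holds σ

/-- All integers that arise in the test are words. -/
def Test.Fits (W : ℕ) (σ : State) : Test → Prop
  | .ile x y => x.Fits W σ ∧ y.Fits W σ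
  | .wle x y => x.Fits W σ ∧ y.Fits W σ
  | .not b => b.Fits W σ
  | .and b b' => b.Fits W σ ∧ b'.Fits W σ

/-- The number of constants, memory accesses and operations in a test. -/
def Test.size : Test → ℕ
  | .ile x y => x.size + y.size + 1
  | .wle x y => x.size + y.size + 1
  | .not b => b.size + 1
  | .and b b' => b.size + b'.size + 1

/-- Programs. -/
inductive Prog where
  | skip
  | setInt (a : ℕ) (i x : IExp)
  | setWt (a : ℕ) (i : IExp) (x : WExp)
  | seq (p q : Prog)
  | cond (b : Test) (p q : Prog)
  | loop (b : Test) (p : Prog)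

/-- `Exec W p σ t τ`: on the machine with words `0, …, W-1` the program `p`, started in the memory
state `σ`, halts after exactly `t` elementary steps in the state `τ`, and no integer ever
overflows.  (If an integer overflows, there is no run.) -/
inductive Exec (W : ℕ) : Prog → State → ℕ → State → Prop
  | skip (σ : State) : Exec W .skip σ 1 σ
  | setInt (a : ℕ) (i x : IExp) (σ : State) (hi : i.Fits W σ) (hx : x.Fits W σ) :
      Exec W (.setInt a i x) σ (i.size + x.size + 1) (σ.setInt a (i.val σ) (x.val σ))
  | setWt (a : ℕ) (i : IExp) (x : WExp) (σ : State) (hi : i.Fits W σ) (hx : x.Fits W σ) :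
      Exec W (.setWt a i x) σ (i.size + x.size + 1) (σ.setWt a (i.val σ) (x.val σ))
  | seq {p q : Prog} {σ τ ρ : State} {t u : ℕ} (hp : Exec W p σ t τ) (hq : Exec W q τ u ρ) :
      Exec W (.seq p q) σ (t + u) ρ
  | condTrue {b : Test} {p q : Prog} {σ τ : State} {t : ℕ} (hf : b.Fits W σ) (hb : b.Holds σ)
      (hp : Exec W p σ t τ) : Exec W (.cond b p q) σ (b.size + 1 + t) τ
  | condFalse {b : Test} {p q : Prog} {σ τ : State} {t : ℕ} (hf : b.Fits W σ) (hb : ¬ b.Holds σ)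
      (hq : Exec W q σ t τ) : Exec W (.cond b p q) σ (b.size + 1 + t) τ
  | loopTrue {b : Test} {p : Prog} {σ τ ρ : State} {t u : ℕ} (hf : b.Fits W σ) (hb : b.Holds σ)
      (hp : Exec W p σ t τ) (hl : Exec W (.loop b p) τ u ρ) :
      Exec W (.loop b p) σ (b.size + 1 + t + u) ρ
  | loopFalse {b : Test} {p : Prog} {σ : State} (hf : b.Fits W σ) (hb : ¬ b.Holds σ) :
      Exec W (.loop b p) σ (b.size + 1) σ

/-! ### Input and output formats -/

/-- The array with the entries of `f`, continued by `0`. -/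
def toArray {α : Type*} [Zero α] {k : ℕ} (f : Fin k → α) : ℕ → α :=
  fun i => if h : i < k then f ⟨i, h⟩ else 0

/-- The initial memory state for an instance with nodes `v₀ = r, v₁, …, v_p = s` of `P`.
Integer array 0 holds `n, m, p`; integer arrays 1 and 2 hold the endpoints of the listed edges;
integer array 3 holds `v₀, …, v_p`.  Weight array 0 holds the weights of the listed edges, and
weight arrays 1 and 2 hold the given distances `d_G(r,v)` and `d_G(v,s)` of all nodes `v`. -/
noncomputable def RPInstance.input {n m : ℕ} (I : RPInstance n m) : State where
  int
    | 0 => toArray ![n, m, I.P.length]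
    | 1 => toArray fun j => (I.fst j : ℕ)
    | 2 => toArray fun j => (I.snd j : ℕ)
    | 3 => toArray fun i : Fin (I.P.length + 1) => (I.P.getVert i : ℕ)
    | _ => 0
  wt
    | 0 => toArray fun j => (I.weight s(I.fst j, I.snd j) : ℝ≥0∞)
    | 1 => toArray fun v => wdist I.graph I.weight I.r v
    | 2 => toArray fun v => wdist I.graph I.weight v I.s
    | _ => 0

/-- The solution of the edge-avoiding version is stored in weight array 3: for the `i`-th edge
`e` of `P` (counted from `0`), the cell `i` holds `d_{G-e}(r,s)`. -/
def RPInstance.EdgeSolved {n m : ℕ} (I : RPInstance n m) (σ : State) : Prop :=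
  ∀ i < I.P.length, σ.wt 3 i =
    wdist (deleteEdge I.graph s(I.P.getVert i, I.P.getVert (i + 1))) I.weight I.r I.s

/-- The solution of the node-avoiding version is stored in weight array 3: for each node `v = vᵢ`
of `P` other than `r` and `s`, the cell `i` holds `d_{G-v}(r,s)`. -/
def RPInstance.NodeSolved {n m : ℕ} (I : RPInstance n m) (σ : State) : Prop :=
  ∀ i ≤ I.P.length, ∀ (hr : I.r ≠ I.P.getVert i) (hs : I.s ≠ I.P.getVert i), σ.wt 3 i =
    wdist (deleteNode I.graph (I.P.getVert i)) (deleteNodeWeight I.weight (I.P.getVert i))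
      ⟨I.r, hr⟩ ⟨I.s, hs⟩

/-- The state `σ` stores the graph `D` and the source `r₀`, as an instance of the single-source
shortest-paths problem: integer array 4 holds the number of nodes, the number of edges, and `r₀`;
integer arrays 5 and 6 hold the endpoints of the listed edges, and weight array 4 their weights. -/
def StoresQuery (σ : State) {k l : ℕ} (D : ListedGraph k l) (r₀ : Fin k) : Prop :=
  σ.int 4 0 = k ∧ σ.int 4 1 = l ∧ σ.int 4 2 = r₀ ∧
    ∀ j : Fin l, σ.int 5 j = D.fst j ∧ σ.int 6 j = D.snd j ∧
      σ.wt 4 j = D.weight s(D.fst j, D.snd j)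

/-- The state after the distances `d_D(r₀,v)` of all nodes `v` of `D` have been written to weight
array 5. -/
noncomputable def State.answer (σ : State) {k l : ℕ} (D : ListedGraph k l) (r₀ : Fin k) :
    State where
  int := σ.int
  wt := Function.update σ.wt 5 (toArray fun v => wdist D.graph D.weight r₀ v)

/-- The program `A` solves the edge-avoiding replacement-paths problem in at most `c * (n + m)`
steps, with words less than `c * (n + m)`. -/
def SolvesEdgeAvoiding (A : Prog) (c : ℕ) : Prop :=
  ∀ (n m : ℕ) (I : RPInstance n m), ∃ (t : ℕ) (σ : State),
    Exec (c * (n + m)) A I.input t σ ∧ t ≤ c * (n + m) ∧ I.EdgeSolved σ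

/-- The programs `A` and `B` reduce the node-avoiding replacement-paths problem to single-source
shortest paths: `A` writes an undirected graph `D` with at most `c * n` nodes and at most `c * m`
edges and a node `r₀` of `D`; once the distances from `r₀` in `D` are supplied, `B` continues and
writes the solution.  Together `A` and `B` take at most `c * (n + m)` steps, with words less than
`c * (n + m)`. -/
def ReducesNodeAvoiding (A B : Prog) (c : ℕ) : Prop :=
  ∀ (n m : ℕ) (I : RPInstance n m),
    ∃ (t : ℕ) (σ : State) (k l : ℕ) (D : ListedGraph k l) (r₀ : Fin k) (u : ℕ) (τ : State),
      Exec (c * (n + m)) A I.input t σ ∧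
      StoresQuery σ D r₀ ∧ k ≤ c * n ∧ l ≤ c * m ∧
      Exec (c * (n + m)) B (σ.answer D r₀) u τ ∧
      t + u ≤ c * (n + m) ∧ I.NodeSolved τ

end ReplacementPaths

/-!
# Replacement paths in linear time

Each node `x` reachable from `r` is given a level: the position of a node of `P` at which some
shortest path from `r` to `x` leaves `P` for good (`RPInstance.IsLevel`).  Levels are found by a
search that starts from all nodes of `P` at once and follows the edges `uv` with
`d(r,u) + w(uv) ≤ d(r,v)` (`WP_computeLevels`).  The shortest path to `x` that defines the level
avoids the part of `P` after the level of `x`; and for each `i < lev y` any walk from `y` to `s` can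
be replaced by one that is not heavier and avoids the `i`-th node of `P`
(`RPInstance.IsLevel.exists_walk_avoiding_node`), since a walk from `y` through that node to `s`
is at least as heavy as the walk that follows the shortest path to `y` backwards to `P` and then the
rest of `P`.

Deleting the `i`-th edge of `P` therefore leaves the distance
`min (d(r,x) + w(xy) + d(y,s))` over all other edges `xy` with `lev x ≤ i < lev y`
(`RPInstance.IsLevel.eq_wdist_deleteEdge`).  When the `i`-th node is deleted, a replacement path
passes to the levels `> i` either by an edge `xy` with `lev x < i < lev y`, with the same value as
before, or by an edge `xy` from a node `x` off `P` of level `i`.  In the latter case `d(r,x)` has to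
be replaced by the weight of a walk that enters the level `i` from below and stays in it off `P`
(`RPInstance.IsLevel.eq_wdist_deleteNode`).  These weights, for all levels together, are the
distances from `r` in one graph on the nodes of `G`: it keeps the edges within levels and off `P`,
and it joins `r` to each node `z` off `P` that has an edge from a lower level, with the weight
`min (d(r,x) + w(xz))` over these edges (`RPInstance.IsLevel.isQueryDist`,
`QueryList.exists_graph`).

What remains is a problem on intervals: given `m` intervals of `{0, …, p-1}` with values, find for
each point the least value of the intervals that contain it, in time `O(p + m)` (`WP_rowMinima`).
Each interval is the union of a suffix of one dyadic block and a prefix of another, both of the same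
level (`mem_interval_iff`); by reflection it suffices to treat the suffixes.  In a sweep from left
to right (`WP_sweep`) the values of the suffixes that contain the current point are represented by
the records, that is, by the best value for each level at which it beats all higher levels.  There
are at most `log p + 1` levels, so that the set of the record levels is a single word, and tables of
powers, logarithms and lowest bits, of linear size, give access to its bits: levels whose block has
ended are removed by one division and one multiplication, the minimum is found at the lowest bit,
and an insertion pops records from the mask, which is paid for by the number of its bits.

The programs are verified with weakest preconditions `WP` for runs with an exact step count.

The memory is used as follows.  Integer arrays: 0 to 3 input, 4 to 6 query graph, 7 levels, 8 marks
and 9 queue of the search, 10 heads of the arcs, 12 positions of the edges at `r` in the query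
graph, 20 keys, 21 and 22 linked lists, 25 dyadic levels, 26 and 27 end points of the intervals, 40
to 42 tables of powers, logarithms and lowest bits; the other arrays hold scalars in their cells 0.
Weight arrays: 0 to 2 input, 3 output, 4 weights of the query graph, 5 its distances, 6 values of
the intervals, 7 result of a sweep, 10 values of the records, 11 weights of the arcs.
-/

namespace ReplacementPaths

/-! ### A program logic for the machine -/

section

/-- The integer arrays that a program may write to. -/
def Prog.intWrites : Prog → List ℕ
  | .skip => []
  | .setInt a _ _ => [a]
  | .setWt _ _ _ => []
  | .seq p q => p.intWrites ++ q.intWrites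
  | .cond _ p q => p.intWrites ++ q.intWrites
  | .loop _ p => p.intWrites

/-- The weight arrays that a program may write to. -/
def Prog.wtWrites : Prog → List ℕ
  | .skip => []
  | .setInt _ _ _ => []
  | .setWt a _ _ => [a]
  | .seq p q => p.wtWrites ++ q.wtWrites
  | .cond _ p q => p.wtWrites ++ q.wtWrites
  | .loop _ p => p.wtWrites

/-- The states `σ` and `τ` agree on all arrays that `p` does not write to. -/
def Frame (p : Prog) (σ τ : State) : Prop :=
  (∀ a, a ∉ p.intWrites → τ.int a = σ.int a) ∧ ∀ a, a ∉ p.wtWrites → τ.wt a = σ.wt a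

theorem Frame.refl (p : Prog) (σ : State) : Frame p σ σ := ⟨fun _ _ => rfl, fun _ _ => rfl⟩

theorem Frame.trans {p : Prog} {σ τ ρ : State} (h : Frame p σ τ) (h' : Frame p τ ρ) :
    Frame p σ ρ :=
  ⟨fun a ha => (h'.1 a ha).trans (h.1 a ha), fun a ha => (h'.2 a ha).trans (h.2 a ha)⟩

theorem Frame.mono {p q : Prog} {σ τ : State} (h : Frame p σ τ)
    (hi : ∀ a ∈ p.intWrites, a ∈ q.intWrites) (hw : ∀ a ∈ p.wtWrites, a ∈ q.wtWrites) :
    Frame q σ τ :=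
  ⟨fun a ha => h.1 a fun h' => ha (hi a h'), fun a ha => h.2 a fun h' => ha (hw a h')⟩

theorem State.setInt_int (σ : State) (a i x b : ℕ) :
    (σ.setInt a i x).int b = if b = a then Function.update (σ.int a) i x else σ.int b := by
  simp [State.setInt, Function.update_apply]

theorem State.setInt_wt (σ : State) (a i x : ℕ) : (σ.setInt a i x).wt = σ.wt := rfl

theorem State.setWt_wt (σ : State) (a i : ℕ) (x : ℝ≥0∞) (b : ℕ) :
    (σ.setWt a i x).wt b = if b = a then Function.update (σ.wt a) i x else σ.wt b := by
  simp [State.setWt, Function.update_apply]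

theorem State.setWt_int (σ : State) (a i : ℕ) (x : ℝ≥0∞) : (σ.setWt a i x).int = σ.int := rfl

attribute [simp] IExp.val IExp.Fits IExp.size WExp.val WExp.Fits WExp.size Test.Holds Test.Fits
  Test.size State.setInt_int State.setInt_wt State.setWt_wt State.setWt_int

theorem Exec.frame {W : ℕ} {p : Prog} {σ τ : State} {t : ℕ} (h : Exec W p σ t τ) :
    Frame p σ τ := by
  induction h with
  | skip σ => exact .refl _ _
  | setInt a i x σ hi hx =>
    refine ⟨fun b hb => ?_, fun b hb => rfl⟩
    simp only [Prog.intWrites, List.mem_singleton] at hb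
    simp [State.setInt_int, hb]
  | setWt a i x σ hi hx =>
    refine ⟨fun b hb => rfl, fun b hb => ?_⟩
    simp only [Prog.wtWrites, List.mem_singleton] at hb
    simp [State.setWt_wt, hb]
  | seq _ _ hp hq =>
    exact (hp.mono (q := .seq _ _) (by simp +contextual [Prog.intWrites])
      (by simp +contextual [Prog.wtWrites])).trans
      (hq.mono (by simp +contextual [Prog.intWrites]) (by simp +contextual [Prog.wtWrites]))
  | condTrue _ _ _ hp =>
    exact hp.mono (by simp +contextual [Prog.intWrites]) (by simp +contextual [Prog.wtWrites])
  | condFalse _ _ _ hp =>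
    exact hp.mono (by simp +contextual [Prog.intWrites]) (by simp +contextual [Prog.wtWrites])
  | loopTrue _ _ _ _ hp hl => exact Frame.trans (hp.mono (fun _ h => h) (fun _ h => h)) hl
  | loopFalse _ _ => exact .refl _ _

/-- The program `p` has a run from `σ` whose duration and final state satisfy `Q`. -/
def WP (W : ℕ) (p : Prog) (Q : ℕ → State → Prop) (σ : State) : Prop :=
  ∃ t τ, Exec W p σ t τ ∧ Q t τ

variable {W : ℕ} {Q Q' : ℕ → State → Prop} {σ : State}

theorem WP.mono {p : Prog} (h : WP W p Q σ) (hQ : ∀ t τ, Frame p σ τ → Q t τ → Q' t τ) :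
    WP W p Q' σ := by
  obtain ⟨t, τ, he, hq⟩ := h
  exact ⟨t, τ, he, hQ t τ he.frame hq⟩

theorem WP_skip (h : Q 1 σ) : WP W .skip Q σ := ⟨_, _, .skip σ, h⟩

theorem WP_setInt {a : ℕ} {i x : IExp} (hi : i.Fits W σ) (hx : x.Fits W σ)
    (h : Q (i.size + x.size + 1) (σ.setInt a (i.val σ) (x.val σ))) :
    WP W (.setInt a i x) Q σ := ⟨_, _, .setInt a i x σ hi hx, h⟩

theorem WP_setWt {a : ℕ} {i : IExp} {x : WExp} (hi : i.Fits W σ) (hx : x.Fits W σ)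
    (h : Q (i.size + x.size + 1) (σ.setWt a (i.val σ) (x.val σ))) :
    WP W (.setWt a i x) Q σ := ⟨_, _, .setWt a i x σ hi hx, h⟩

theorem WP_seq {p q : Prog} (h : WP W p (fun t τ => WP W q (fun u ρ => Q (t + u) ρ) τ) σ) :
    WP W (.seq p q) Q σ := by
  obtain ⟨t, τ, he, u, ρ, he', hq⟩ := h
  exact ⟨_, _, .seq he he', hq⟩

theorem WP_cond {b : Test} {p q : Prog} (hf : b.Fits W σ)
    (h : b.Holds σ → WP W p (fun t τ => Q (b.size + 1 + t) τ) σ)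
    (h' : ¬ b.Holds σ → WP W q (fun t τ => Q (b.size + 1 + t) τ) σ) :
    WP W (.cond b p q) Q σ := by
  by_cases hb : b.Holds σ
  · obtain ⟨t, τ, he, hq⟩ := h hb
    exact ⟨_, _, .condTrue hf hb he, hq⟩
  · obtain ⟨t, τ, he, hq⟩ := h' hb
    exact ⟨_, _, .condFalse hf hb he, hq⟩

/-- The rule for loops: `Inv t τ` is an invariant of the state `τ` after `t` steps, and the
measure `μ` decreases with every iteration. -/
theorem WP_loop {b : Test} {p : Prog} (Inv : ℕ → State → Prop) (μ : State → ℕ)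
    (h0 : Inv 0 σ)
    (hf : ∀ t τ, Frame p σ τ → Inv t τ → b.Fits W τ)
    (hb : ∀ t τ, Frame p σ τ → Inv t τ → b.Holds τ →
      WP W p (fun u ρ => Inv (t + (b.size + 1 + u)) ρ ∧ μ ρ < μ τ) τ)
    (hQ : ∀ t τ, Frame p σ τ → Inv t τ → ¬ b.Holds τ → Q (t + (b.size + 1)) τ) :
    WP W (.loop b p) Q σ := by
  suffices H : ∀ N t τ, μ τ < N → Frame p σ τ → Inv t τ →
      WP W (.loop b p) (fun u ρ => Q (t + u) ρ) τ by
    simpa using H _ 0 σ (Nat.lt_succ_self _) (.refl _ _) h0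
  intro N
  induction N with
  | zero => intro t τ h; omega
  | succ N ih =>
    intro t τ hμ hfr hi
    by_cases hbτ : b.Holds τ
    · obtain ⟨u, ρ, he, hi', hμ'⟩ := hb t τ hfr hi hbτ
      obtain ⟨u', ρ', he', hq⟩ := ih _ ρ (by omega) (hfr.trans he.frame) hi'
      exact ⟨_, _, .loopTrue (hf _ _ hfr hi) hbτ he he', by simpa [add_assoc] using hq⟩
    · exact ⟨_, _, .loopFalse (hf _ _ hfr hi) hbτ, hQ _ _ hfr hi hbτ⟩

/-- The scalar variable `a`: the cell `0` of the integer array `a`. -/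
abbrev scal (a : ℕ) : IExp := .cell a (.const 0)

/-- Assignment to the scalar variable `a`. -/
abbrev assign (a : ℕ) (x : IExp) : Prog := .setInt a (.const 0) x

/-- `for x = 0, …, l - 1 do body`, where the bound `l` is the cell `k` of the integer array `a`. -/
def forLoop (x a k : ℕ) (body : Prog) : Prog :=
  .seq (assign x (.const 0))
    (.loop (.not (.ile (.cell a (.const k)) (scal x)))
      (.seq body (assign x (.add (scal x) (.const 1)))))

/-- The rule for counting loops: `Inv k t τ` holds before the `k`-th iteration, `t` being the
time spent in the iterations so far. -/
theorem WP_for {x a k N : ℕ} {body : Prog} (Inv : ℕ → ℕ → State → Prop)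
    (hax : a ≠ x) (ha : a ∉ body.intWrites) (hx : x ∉ body.intWrites)
    (hN : σ.int a k = N) (hW : N + 1 < W) (hk : k < W)
    (h0 : Inv 0 0 (σ.setInt x 0 0))
    (hb : ∀ i t τ, i < N → Frame (forLoop x a k body) σ τ → τ.int x 0 = i → Inv i t τ →
      WP W body (fun u ρ => Inv (i + 1) (t + (u + 13)) (ρ.setInt x 0 (i + 1))) τ)
    (hQ : ∀ t τ, Frame (forLoop x a k body) σ τ → Inv N t τ → Q (t + 10) τ) :
    WP W (forLoop x a k body) Q σ := by
  have hfr0 : Frame (forLoop x a k body) σ (σ.setInt x 0 0) := by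
    refine ⟨fun b hb => ?_, fun b _ => rfl⟩
    have : b ≠ x := by rintro rfl; exact hb (by simp [forLoop, Prog.intWrites])
    simp [State.setInt_int, this]
  have hfr1 : ∀ τ, Frame (.seq body (assign x (.add (scal x) (.const 1)))) (σ.setInt x 0 0) τ →
      Frame (forLoop x a k body) σ τ := fun τ h => hfr0.trans
    (h.mono (fun b hb => by simp [forLoop, Prog.intWrites] at hb ⊢; tauto)
      (fun b hb => by simp [forLoop, Prog.wtWrites] at hb ⊢; tauto))
  have haN : ∀ τ, Frame (.seq body (assign x (.add (scal x) (.const 1)))) (σ.setInt x 0 0) τ →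
      τ.int a k = N := fun τ h => by
    rw [h.1 a (by simp [Prog.intWrites, ha, hax]), State.setInt_int, if_neg hax, hN]
  apply WP_seq
  refine WP_setInt (by simp [IExp.Fits]; omega) (by simp [IExp.Fits]; omega) ?_
  refine WP_loop (fun t τ => τ.int x 0 ≤ N ∧ Inv (τ.int x 0) t τ) (fun τ => N - τ.int x 0) ?_ ?_ ?_
    ?_
  · simp only [IExp.val, State.setInt_int, if_true, Function.update_self, zero_le, true_and]
    exact h0
  · intro t τ hfr hi
    simp only [Test.Fits, IExp.Fits, IExp.val, haN τ hfr]
    omega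
  · intro t τ hfr hi hh
    simp only [Test.Holds, IExp.val, haN τ hfr] at hh
    apply WP_seq
    refine WP.mono (hb _ t τ (by omega) (hfr1 τ hfr) rfl hi.2) fun u ρ hfrρ h => ?_
    have hxρ : ρ.int x 0 = τ.int x 0 := by rw [hfrρ.1 x hx]
    refine WP_setInt (by simp [IExp.Fits]; omega) ?_ ?_
    · simp only [IExp.Fits, IExp.val, hxρ]; omega
    · simp only [IExp.size, IExp.val, hxρ, State.setInt_int, Test.size, if_true,
        Function.update_self]
      have e : t + (1 + 1 + (1 + 1) + 1 + 1 + 1 + (u + (1 + (1 + 1 + 1 + 1) + 1))) =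
        t + (u + 13) := by ring
      rw [e]
      exact ⟨⟨by omega, h⟩, by omega⟩
  · intro t τ hfr hi hh
    simp only [Test.Holds, IExp.val, haN τ hfr, not_not] at hh
    have := hQ t τ (hfr1 τ hfr) (by rw [show N = τ.int x 0 by omega]; exact hi.2)
    simp only [IExp.size, Test.size]
    convert this using 1
    ring

/-- Counting loops whose body takes constant time. -/
theorem WP_for_const {x a k N C : ℕ} {body : Prog} (Inv : ℕ → State → Prop)
    (hax : a ≠ x) (ha : a ∉ body.intWrites) (hx : x ∉ body.intWrites)
    (hN : σ.int a k = N) (hW : N + 1 < W) (hk : k < W)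
    (h0 : Inv 0 (σ.setInt x 0 0))
    (hb : ∀ i τ, i < N → Frame (forLoop x a k body) σ τ → τ.int x 0 = i → Inv i τ →
      WP W body (fun u ρ => u + 13 ≤ C ∧ Inv (i + 1) (ρ.setInt x 0 (i + 1))) τ)
    (hQ : ∀ t τ, t ≤ C * N + 10 → Frame (forLoop x a k body) σ τ → Inv N τ → Q t τ) :
    WP W (forLoop x a k body) Q σ := by
  refine WP_for (fun i t τ => t ≤ C * i ∧ Inv i τ) hax ha hx hN hW hk ⟨by simp, h0⟩ ?_ ?_
  · intro i t τ hi hfr hx hI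
    refine (hb i τ hi hfr hx hI.2).mono fun u ρ _ h => ⟨?_, h.2⟩
    rw [mul_add]; omega
  · intro t τ hfr hI
    exact hQ _ _ (by omega) hfr hI.2

end

/-! ### Linked lists -/

/-- The largest `j < c` with `key j = v`, increased by `1`; it is `0` if there is no such `j`. -/
def prevKey (key : ℕ → ℕ) (v : ℕ) : ℕ → ℕ
  | 0 => 0
  | c + 1 => if key c = v then c + 1 else prevKey key v c

theorem prevKey_le (key : ℕ → ℕ) (v c : ℕ) : prevKey key v c ≤ c := by
  induction c with
  | zero => simp [prevKey]
  | succ c ih => simp only [prevKey]; split_ifs <;> omega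

theorem prevKey_spec (key : ℕ → ℕ) (v c : ℕ) :
    prevKey key v c = 0 ∨ key (prevKey key v c - 1) = v := by
  induction c with
  | zero => simp [prevKey]
  | succ c ih => simp only [prevKey]; split_ifs with h <;> simp [h, ih]

/-- Sorts the items `j < M` into linked lists according to their keys `< N`.  The scalars 23 and
24 hold `M` and `N`, array 20 holds the keys, array 21 receives the heads of the lists and array 22
the links; the item `j` is represented by `j + 1`, and `0` ends a list. -/
def buildLists : Prog :=
  .seq (forLoop 30 24 0 (.setInt 21 (scal 30) (.const 0)))
    (forLoop 30 23 0
      (.seq (.setInt 22 (scal 30) (.cell 21 (.cell 20 (scal 30))))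
        (.setInt 21 (.cell 20 (scal 30)) (.add (scal 30) (.const 1)))))

theorem WP_buildLists {W : ℕ} {Q : ℕ → State → Prop} {σ : State} {M N : ℕ}
    (hM : σ.int 23 0 = M) (hN : σ.int 24 0 = N) (hMW : M + 2 < W) (hNW : N + 2 < W)
    (hkey : ∀ j < M, σ.int 20 j < N)
    (hQ : ∀ t τ, t ≤ 40 * (M + N) + 20 → Frame buildLists σ τ →
      (∀ v < N, τ.int 21 v = prevKey (σ.int 20) v M) →
      (∀ j < M, τ.int 22 j = prevKey (σ.int 20) (σ.int 20 j) j) → Q t τ) :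
    WP W buildLists Q σ := by
  suffices H : WP W buildLists (fun t τ => t ≤ 40 * (M + N) + 20 ∧
      (∀ v < N, τ.int 21 v = prevKey (σ.int 20) v M) ∧
      (∀ j < M, τ.int 22 j = prevKey (σ.int 20) (σ.int 20 j) j)) σ from
    H.mono fun t τ hf h => hQ t τ h.1 hf h.2.1 h.2.2
  apply WP_seq
  refine WP_for_const (C := 20) (fun k τ => ∀ v < k, τ.int 21 v = 0) (by decide) (by decide)
    (by decide) hN (by omega) (by omega) (by simp) ?_ ?_
  · intro i τ hi hf hx hI
    refine WP_setInt (by simp; omega) (by simp; omega) ?_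
    refine ⟨by simp, fun v hv => ?_⟩
    by_cases h : v = i
    · simp [hx, h]
    · simp [hx, h, hI v (by omega)]
  · intro t τ ht hf hI
    have h20 := hf.1 20 (by decide)
    have h23 := hf.1 23 (by decide)
    refine WP_for_const (C := 40) (fun k τ => (∀ v < N, τ.int 21 v = prevKey (σ.int 20) v k) ∧
      (∀ j < k, τ.int 22 j = prevKey (σ.int 20) (σ.int 20 j) j)) (by decide) (by decide)
      (by decide) (h23 ▸ hM) (by omega) (by omega) ⟨?_, by simp⟩ ?_ ?_
    · intro v hv; simpa [prevKey] using hI v hv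
    · intro i ρ hi hf' hx hI'
      have h20' := (hf'.1 20 (by decide)).trans h20
      have hk := hkey i hi
      have hp := prevKey_le (σ.int 20) (σ.int 20 i) i
      have hh := hI'.1 _ hk
      apply WP_seq
      refine WP_setInt (by simp; omega) (by simp [hx, h20', hh]; omega) ?_
      refine WP_setInt (by simp [hx, h20']; omega) (by simp [hx]; omega) ?_
      refine ⟨by simp, fun v hv => ?_, fun j hj => ?_⟩
      · by_cases hv' : v = σ.int 20 i
        · simp [hv', prevKey, hx, h20']
        · simp [hv', prevKey, hx, h20', Ne.symm hv', hI'.1 v hv]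
      · by_cases hj' : j = i
        · simp [hj', hh, hx, h20']
        · simp [hj', hI'.2 j (by omega), hx, h20']
    · intro u ρ hu hf' hI'
      exact ⟨by omega, hI'⟩

/-- Runs through the linked list that starts at the scalar `c`. -/
def listLoop (c : ℕ) (body : Prog) : Prog :=
  .loop (.not (.ile (scal c) (.const 0)))
    (.seq body (assign c (.cell 22 (.sub (scal c) (.const 1)))))

/-- The rule for running through the list of the items `j < M` with key `v`, in decreasing order.
`Inv c t τ` says that the items `j ≥ c` have been dealt with, in time `t`. -/
theorem WP_list {W : ℕ} {Q : ℕ → State → Prop} {σ : State} {c v M : ℕ} {key : ℕ → ℕ} {body : Prog}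
    (Inv : ℕ → ℕ → State → Prop) (h22 : 22 ∉ body.intWrites) (hc : c ∉ body.intWrites)
    (hc22 : c ≠ 22) (hcv : σ.int c 0 = prevKey key v M)
    (hnext : ∀ j < M, σ.int 22 j = prevKey key (key j) j) (hMW : M + 1 < W)
    (h0 : Inv M 0 σ)
    (hskip : ∀ j t τ, j < M → key j ≠ v → Inv (j + 1) t τ → Inv j t τ)
    (hb : ∀ j t τ, j < M → key j = v → Frame (listLoop c body) σ τ → τ.int c 0 = j + 1 →
      Inv (j + 1) t τ →
      WP W body (fun u ρ => Inv j (t + (u + 13)) (ρ.setInt c 0 (prevKey key v j))) τ)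
    (hQ : ∀ t τ, Frame (listLoop c body) σ τ → Inv 0 t τ → Q (t + 6) τ) :
    WP W (listLoop c body) Q σ := by
  have hdown : ∀ e t τ, e ≤ M → Inv e t τ → Inv (prevKey key v e) t τ := by
    intro e t τ
    induction e with
    | zero => intro _ h; exact h
    | succ e ih =>
      intro he h
      simp only [prevKey]
      split_ifs with hk
      · exact h
      · exact ih (by omega) (hskip e t τ (by omega) hk h)
  have hn : ∀ τ, Frame (.seq body (assign c (.cell 22 (.sub (scal c) (.const 1))))) σ τ →
      τ.int 22 = σ.int 22 := fun τ h => h.1 22 (by simp [Prog.intWrites, h22, hc22.symm])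
  refine WP_loop (fun t τ => τ.int c 0 ≤ M ∧ (τ.int c 0 = 0 ∨ key (τ.int c 0 - 1) = v) ∧
    Inv (τ.int c 0) t τ) (fun τ => τ.int c 0) ?_ ?_ ?_ ?_
  · rw [hcv]
    exact ⟨prevKey_le _ _ _, prevKey_spec _ _ _, hdown _ _ _ le_rfl h0⟩
  · intro t τ hf hI
    simp only [Test.Fits, IExp.Fits, IExp.val]
    omega
  · intro t τ hf hI hh
    simp only [Test.Holds, IExp.val] at hh
    obtain ⟨j, hj⟩ : ∃ j, τ.int c 0 = j + 1 := ⟨τ.int c 0 - 1, by omega⟩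
    rw [hj] at hI
    have hkj : key j = v := by simpa using hI.2.1
    apply WP_seq
    refine (hb j t τ (by omega) hkj hf hj hI.2.2).mono fun u ρ hfρ h => ?_
    have hcρ : ρ.int c 0 = j + 1 := by rw [hfρ.1 c hc, hj]
    have hnρ : ρ.int 22 j = prevKey key v j := by
      rw [hfρ.1 22 h22, hn τ hf, hnext j (by omega), hkj]
    have hp := prevKey_le key v j
    refine WP_setInt (by simp; omega) (by simp [hcρ, hnρ]; omega) ?_
    simp only [IExp.size, IExp.val, hcρ, State.setInt_int, Test.size, if_true,
      Function.update_self, Nat.add_sub_cancel, hnρ]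
    have e : t + (1 + 1 + 1 + 1 + 1 + 1 + (u + (1 + (1 + 1 + 1 + 1 + 1) + 1))) =
      t + (u + 13) := by ring
    rw [e, hj]
    exact ⟨⟨by omega, hkj ▸ prevKey_spec _ _ _, hdown _ _ _ (by omega) h⟩, by omega⟩
  · intro t τ hf hI hh
    simp only [Test.Holds, IExp.val, not_not] at hh
    have := hQ t τ hf (by rw [show 0 = τ.int c 0 by omega]; exact hI.2.2)
    simp only [IExp.size, Test.size]
    convert this using 1

/-! ### Words as sets of bits -/

/-- The position of the lowest bit of `x` (`0` for `x = 0`). -/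
def lowBit (x : ℕ) : ℕ :=
  if x = 0 then 0 else if x % 2 = 1 then 0 else lowBit (x / 2) + 1
termination_by x
decreasing_by omega

theorem lowBit_def (x : ℕ) :
    lowBit x = if x = 0 then 0 else if x % 2 = 1 then 0 else lowBit (x / 2) + 1 := by
  rw [lowBit]

theorem testBit_lowBit {x : ℕ} (hx : x ≠ 0) : x.testBit (lowBit x) = true := by
  induction x using Nat.strong_induction_on with
  | _ x ih =>
    rw [lowBit_def, if_neg hx]
    split_ifs with h
    · simp [Nat.testBit_zero, h]
    · rw [Nat.testBit_add_one]
      exact ih _ (by omega) (by omega)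

theorem lowBit_le {x k : ℕ} (h : x.testBit k = true) : lowBit x ≤ k := by
  induction x using Nat.strong_induction_on generalizing k with
  | _ x ih =>
    rw [lowBit_def]
    split_ifs with h0 h1
    · omega
    · omega
    · cases k with
      | zero => simp [Nat.testBit_zero] at h; omega
      | succ k =>
        rw [Nat.testBit_add_one] at h
        have := ih (x / 2) (by omega) h
        omega

/-- The position of the lowest bit is the exponent of `2` in `x`. -/
theorem two_pow_lowBit_dvd {x : ℕ} (hx : x ≠ 0) (k : ℕ) : 2 ^ k ∣ x ↔ k ≤ lowBit x := by
  induction x using Nat.strong_induction_on generalizing k with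
  | _ x ih =>
    rw [lowBit_def, if_neg hx]
    cases k with
    | zero => simp
    | succ k =>
      split_ifs with h
      · simp only [nonpos_iff_eq_zero, Nat.add_eq_zero_iff, one_ne_zero, and_false, iff_false]
        intro hd
        have : 2 ∣ x := dvd_trans (dvd_pow_self 2 (by omega)) hd
        omega
      · have := ih (x / 2) (by omega) (by omega) k
        rw [Nat.add_le_add_iff_right, ← this]
        obtain ⟨y, rfl⟩ : 2 ∣ x := by omega
        rw [pow_succ', Nat.mul_dvd_mul_iff_left (by omega)]
        simp

theorem le_log2_of_testBit {x k : ℕ} (h : x.testBit k = true) : k ≤ x.log2 := by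
  have h0 : x ≠ 0 := by rintro rfl; simp at h
  rw [Nat.le_log2 h0]
  exact Nat.ge_two_pow_of_testBit h

/-- Adding an absent bit. -/
theorem testBit_add_two_pow {x i : ℕ} (h : x.testBit i = false) (j : ℕ) :
    (x + 2 ^ i).testBit j = (decide (j = i) || x.testBit j) := by
  have e : x + 2 ^ i = 2 ^ i * (x / 2 ^ i + 1) + x % 2 ^ i := by
    have := Nat.div_add_mod x (2 ^ i)
    rw [mul_add]; omega
  have hev : (x / 2 ^ i) % 2 = 0 := by
    have : (x / 2 ^ i).testBit 0 = false := by rw [Nat.testBit_div_two_pow]; simpa using h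
    simpa [Nat.testBit_zero] using this
  rw [e, Nat.testBit_two_pow_mul_add _ (Nat.mod_lt _ (by positivity))]
  split_ifs with hj
  · simp [Nat.testBit_mod_two_pow, hj, hj.ne]
  · obtain ⟨d, rfl⟩ := Nat.exists_eq_add_of_le (not_lt.mp hj)
    rw [Nat.add_sub_cancel_left]
    cases d with
    | zero => simp [Nat.testBit_zero]; omega
    | succ d =>
      rw [Nat.testBit_add_one, show (x / 2 ^ i + 1) / 2 = x / 2 ^ i / 2 by omega,
        ← Nat.testBit_add_one, Nat.testBit_div_two_pow, add_comm (d + 1)]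
      simp

/-- Removing a bit. -/
theorem exists_add_two_pow {x i : ℕ} (h : x.testBit i = true) :
    ∃ y, x = y + 2 ^ i ∧ y.testBit i = false := by
  have h1 := Nat.ge_two_pow_of_testBit h
  refine ⟨x - 2 ^ i, by omega, ?_⟩
  have := Nat.testBit_two_pow_add_eq (x - 2 ^ i) i
  rw [show 2 ^ i + (x - 2 ^ i) = x by omega, h] at this
  simpa using this.symm

theorem testBit_sub_two_pow {x i : ℕ} (h : x.testBit i = true) (j : ℕ) :
    (x - 2 ^ i).testBit j = (decide (j ≠ i) && x.testBit j) := by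
  obtain ⟨y, rfl, hy⟩ := exists_add_two_pow h
  rw [Nat.add_sub_cancel, testBit_add_two_pow hy]
  by_cases hj : j = i <;> simp [hj, hy]

/-- The number of bits of `x`. -/
def bitCount (x : ℕ) : ℕ := x.bitIndices.length

theorem bitCount_eq (x : ℕ) : bitCount x = x.bitIndices.toFinset.card :=
  (List.toFinset_card_of_nodup Nat.bitIndices_nodup).symm

theorem bitCount_add_two_pow {x i : ℕ} (h : x.testBit i = false) :
    bitCount (x + 2 ^ i) = bitCount x + 1 := by
  rw [bitCount_eq, bitCount_eq, ← Finset.card_insert_of_notMem (a := i)]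
  · congr 1
    ext j
    simp [testBit_add_two_pow h]
  · simp [h]

theorem bitCount_sub_two_pow {x i : ℕ} (h : x.testBit i = true) :
    bitCount (x - 2 ^ i) + 1 = bitCount x := by
  obtain ⟨y, rfl, hy⟩ := exists_add_two_pow h
  rw [Nat.add_sub_cancel, bitCount_add_two_pow hy]

theorem bitCount_le_of_imp {x y : ℕ} (h : ∀ j, x.testBit j = true → y.testBit j = true) :
    bitCount x ≤ bitCount y := by
  rw [bitCount_eq, bitCount_eq]
  apply Finset.card_le_card
  intro j
  simpa using h j

theorem lt_two_pow_of_bits {x n : ℕ} (h : ∀ j, x.testBit j = true → j < n) : x < 2 ^ n := by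
  apply Nat.lt_pow_two_of_testBit
  intro i hi
  by_contra hc
  have := h i (by simpa using hc)
  omega

/-! ### Tables of powers, logarithms and lowest bits -/

/-- Computes the least power of two `2 ^ K ≥ p` in the scalar 43, and the powers `2 ^ k`, `k ≤ K`,
in array 40. -/
def powTable : Prog :=
  .seq (assign 43 (.const 1)) (.seq (assign 44 (.const 0)) (.seq (.setInt 40 (.const 0) (.const 1))
    (.loop (.not (.ile (.cell 0 (.const 2)) (scal 43)))
      (.seq (assign 43 (.add (scal 43) (scal 43)))
        (.seq (assign 44 (.add (scal 44) (.const 1)))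
          (.setInt 40 (scal 44) (scal 43)))))))

theorem WP_powTable {W : ℕ} {Q : ℕ → State → Prop} {σ : State} {p : ℕ}
    (hp : σ.int 0 2 = p) (hp1 : 1 ≤ p) (hW : 4 * p + 4 < W)
    (hQ : ∀ K t τ, t ≤ 80 * p + 20 → Frame powTable σ τ → p ≤ 2 ^ K → 2 ^ K < 2 * p →
      τ.int 43 0 = 2 ^ K → (∀ k ≤ K, τ.int 40 k = 2 ^ k) → Q t τ) :
    WP W powTable Q σ := by
  suffices H : WP W powTable (fun t τ => ∃ K, t ≤ 80 * p + 20 ∧ p ≤ 2 ^ K ∧ 2 ^ K < 2 * p ∧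
      τ.int 43 0 = 2 ^ K ∧ (∀ k ≤ K, τ.int 40 k = 2 ^ k)) σ from
    H.mono fun t τ hf ⟨K, h1, h2, h3, h4, h5⟩ => hQ K t τ h1 hf h2 h3 h4 h5
  refine WP_seq (WP_setInt (by simp; omega) (by simp; omega) ?_)
  refine WP_seq (WP_setInt (by simp; omega) (by simp; omega) ?_)
  refine WP_seq (WP_setInt (by simp; omega) (by simp; omega) ?_)
  refine WP_loop (fun t τ => ∃ K, t ≤ 40 * K ∧ 2 ^ K < 2 * p ∧ τ.int 44 0 = K ∧
      τ.int 43 0 = 2 ^ K ∧ (∀ k ≤ K, τ.int 40 k = 2 ^ k)) (fun τ => p - τ.int 43 0) ?_ ?_ ?_ ?_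
  · exact ⟨0, by simp, by simp; omega, by simp, by simp, by simp⟩
  · rintro t τ hf ⟨K, h1, h2, h3, h4, h5⟩
    have h0 := hf.1 0 (by decide)
    simp only [State.setInt_int] at h0
    norm_num at h0
    simp [h0, hp, h4]; omega
  · rintro t τ hf ⟨K, h1, h2, h3, h4, h5⟩ hh
    have h0 := hf.1 0 (by decide)
    simp only [State.setInt_int] at h0
    norm_num at h0
    simp [h0, hp, h4] at hh
    have hK := Nat.lt_two_pow_self (n := K)
    refine WP_seq (WP_setInt (by simp; omega) (by simp [h4]; omega) ?_)
    refine WP_seq (WP_setInt (by simp; omega) (by simp [h3]; omega) ?_)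
    refine WP_setInt (by simp [h3]; omega) (by simp [h4]; omega) ?_
    refine ⟨⟨K + 1, by simp; omega, by rw [pow_succ]; omega, by simp [h3],
      by simp [h4, pow_succ]; omega, fun k hk => ?_⟩, by simp [h4]; omega⟩
    by_cases hk' : k = K + 1
    · simp [hk', h3, h4, pow_succ]; omega
    · simp [hk', h3, h5 k (by omega)]
  · rintro t τ hf ⟨K, h1, h2, h3, h4, h5⟩ hh
    have h0 := hf.1 0 (by decide)
    simp only [State.setInt_int] at h0
    norm_num at h0
    simp [h0, hp, h4] at hh
    have hK := Nat.lt_two_pow_self (n := K)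
    exact ⟨K, by simp; omega, hh, h2, h4, h5⟩

/-- Computes the logarithms and the lowest bits of all `x < 2 ^ (K + 1)` in arrays 41 and 42. -/
def logTable : Prog :=
  .seq (assign 45 (.add (scal 43) (scal 43)))
    (forLoop 31 45 0
      (.seq
        (.cond (.ile (scal 31) (.const 1)) (.setInt 41 (scal 31) (.const 0))
          (.setInt 41 (scal 31) (.add (.cell 41 (.div (scal 31) (.const 2))) (.const 1))))
        (.cond (.ile (.add (.mul (.div (scal 31) (.const 2)) (.const 2)) (.const 1)) (scal 31))
          (.setInt 42 (scal 31) (.const 0))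
          (.cond (.ile (scal 31) (.const 0)) (.setInt 42 (scal 31) (.const 0))
            (.setInt 42 (scal 31) (.add (.cell 42 (.div (scal 31) (.const 2))) (.const 1)))))))

theorem lowBit_le_self (x : ℕ) : lowBit x ≤ x := by
  induction x using Nat.strong_induction_on with
  | _ x ih =>
    rw [lowBit_def]
    split_ifs
    · omega
    · omega
    · have := ih (x / 2) (by omega)
      omega

theorem WP_logTable {W : ℕ} {Q : ℕ → State → Prop} {σ : State} {N : ℕ}
    (hN : σ.int 43 0 = N) (hW : 2 * N + 4 < W)
    (hQ : ∀ t τ, t ≤ 200 * N + 20 → Frame logTable σ τ →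
      (∀ x < 2 * N, τ.int 41 x = x.log2 ∧ τ.int 42 x = lowBit x) → Q t τ) :
    WP W logTable Q σ := by
  suffices H : WP W logTable (fun t τ => t ≤ 200 * N + 20 ∧
      (∀ x < 2 * N, τ.int 41 x = x.log2 ∧ τ.int 42 x = lowBit x)) σ from
    H.mono fun t τ hf h => hQ t τ h.1 hf h.2
  refine WP_seq (WP_setInt (by simp; omega) (by simp [hN]; omega) ?_)
  refine WP_for_const (C := 100) (N := 2 * N)
    (fun k τ => ∀ x < k, τ.int 41 x = x.log2 ∧ τ.int 42 x = lowBit x) (by decide) (by decide)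
    (by decide) (by simp [hN]; omega) (by omega) (by omega) (by simp) ?_ ?_
  · intro i τ hi hf hx hI
    have hlow := lowBit_le_self (i / 2)
    have hlog := Nat.log2_le_self (i / 2)
    refine WP_seq (WP.mono (Q := fun u ρ => u ≤ 20 ∧ (∀ x < i + 1, ρ.int 41 x = x.log2) ∧
      ∀ x < i, ρ.int 42 x = lowBit x) ?_ ?_)
    · refine WP_cond (by simp [hx]; omega) (fun h => ?_) (fun h => ?_)
      · simp [hx] at h
        refine WP_setInt (by simp [hx]; omega) (by simp; omega) ⟨by simp, fun x hxi => ?_,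
          fun x hxi => by simp [(hI x hxi).2]⟩
        by_cases hxi' : x = i
        · simp [hx, hxi']; rw [Nat.log2_def, if_neg (by omega)]
        · simp [hx, hxi', hI x (by omega)]
      · simp [hx] at h
        have h2 := hI (i / 2) (by omega)
        refine WP_setInt (by simp [hx]; omega) (by simp [hx, h2]; omega) ⟨by simp, fun x hxi => ?_,
          fun x hxi => by simp [(hI x hxi).2]⟩
        by_cases hxi' : x = i
        · simp [hx, hxi', h2]; rw [Nat.log2_def i, if_pos (by omega)]
        · simp [hx, hxi', hI x (by omega)]
    · intro u ρ hfρ ⟨hu, h41, h42⟩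
      have hx' : ρ.int 31 0 = i := by rw [hfρ.1 31 (by decide), hx]
      have key : ∀ (w c : ℕ), c = lowBit i → w ≤ 50 → u + w + 13 ≤ 100 ∧ ∀ x < i + 1,
          ((ρ.setInt 42 i c).setInt 31 0 (i + 1)).int 41 x = x.log2 ∧
          ((ρ.setInt 42 i c).setInt 31 0 (i + 1)).int 42 x = lowBit x := by
        intro w c hc hw
        refine ⟨by omega, fun x hxi => ⟨by simp [h41 x hxi], ?_⟩⟩
        by_cases hxi' : x = i
        · simp [hxi', hc]
        · simp [hxi', h42 x (by omega)]
      refine WP_cond (by simp [hx']; omega) (fun h => ?_) (fun h => ?_)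
      · simp [hx'] at h
        refine WP_setInt (by simp [hx']; omega) (by simp; omega) ?_
        simp only [IExp.val, hx']
        exact key _ 0 (by rw [lowBit_def, if_neg (by omega), if_pos (by omega)]) (by simp)
      · simp [hx'] at h
        refine WP_cond (by simp [hx']; omega) (fun h' => ?_) (fun h' => ?_)
        · simp [hx'] at h'
          refine WP_setInt (by simp [hx']; omega) (by simp; omega) ?_
          simp only [IExp.val, hx']
          exact key _ 0 (by rw [lowBit_def, if_pos (by omega)]) (by simp)
        · simp [hx'] at h'
          have h2 := h42 (i / 2) (by omega)
          refine WP_setInt (by simp [hx']; omega) (by simp [hx', h2]; omega) ?_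
          simp only [IExp.val, hx', h2]
          exact key _ _ (by rw [lowBit_def i, if_neg (by omega), if_neg (by omega)]) (by simp)
  · intro t τ ht hf hI
    refine ⟨by simp; omega, hI⟩

/-- The tables are in place; the scalar 43 holds `2 ^ K`. -/
def HasTables (K : ℕ) (σ : State) : Prop :=
  σ.int 43 0 = 2 ^ K ∧ (∀ k ≤ K, σ.int 40 k = 2 ^ k) ∧
    ∀ x < 2 ^ (K + 1), σ.int 41 x = x.log2 ∧ σ.int 42 x = lowBit x

theorem HasTables.congr {K : ℕ} {σ τ : State} (h : HasTables K σ) (h40 : τ.int 40 = σ.int 40)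
    (h41 : τ.int 41 = σ.int 41) (h42 : τ.int 42 = σ.int 42) (h43 : τ.int 43 = σ.int 43) :
    HasTables K τ := by
  simpa only [HasTables, h40, h41, h42, h43] using h

/-! ### The stack of records -/

/-- `mask` and `best` represent the set `A` of pairs of a level `≤ K` and a value: the bits of
`mask` are the record levels `k`, those at which some value `best k` is smaller than all values at
higher levels. -/
structure Records (K : ℕ) (A : ℕ → ℝ≥0∞ → Prop) (mask : ℕ) (best : ℕ → ℝ≥0∞) : Prop where
  sound : ∀ k, mask.testBit k = true → k ≤ K ∧ A k (best k)
  complete : ∀ k v, A k v → ∃ k', k ≤ k' ∧ mask.testBit k' = true ∧ best k' ≤ v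
  strictMono : ∀ k k', mask.testBit k = true → mask.testBit k' = true → k < k' → best k < best k'

namespace Records

variable {K mask : ℕ} {A : ℕ → ℝ≥0∞ → Prop} {best : ℕ → ℝ≥0∞}

theorem mask_lt (h : Records K A mask best) : mask < 2 ^ (K + 1) :=
  lt_two_pow_of_bits fun j hj => Nat.lt_succ_of_le (h.sound j hj).1

theorem congr {A' : ℕ → ℝ≥0∞ → Prop} (h : Records K A mask best) (hA : ∀ k v, A k v ↔ A' k v) :
    Records K A' mask best := by
  have : A = A' := by funext k v; exact propext (hA k v)
  exact this ▸ h

/-- An item whose value is not smaller than that of some record at its level or above does not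
change the records. -/
theorem of_le (h : Records K A mask best) {A' : ℕ → ℝ≥0∞ → Prop} {k k' : ℕ} {v : ℝ≥0∞}
    (hA : ∀ l x, A' l x ↔ A l x ∨ (l = k ∧ x = v)) (hk : k ≤ k') (hb : mask.testBit k' = true)
    (hv : best k' ≤ v) : Records K A' mask best where
  sound l hl := ⟨(h.sound l hl).1, (hA _ _).2 (.inl (h.sound l hl).2)⟩
  complete l x hx := by
    rcases (hA l x).1 hx with hx | ⟨rfl, rfl⟩
    · exact h.complete l x hx
    · exact ⟨k', hk, hb, hv⟩
  strictMono := h.strictMono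

/-- The effect of inserting a new record `v` at the level `k`: the records below `k` that are not
smaller than `v` disappear. -/
theorem insert (h : Records K A mask best) {A' : ℕ → ℝ≥0∞ → Prop} {k mask' : ℕ} {v : ℝ≥0∞}
    (hkK : k ≤ K) (hA : ∀ l x, A' l x ↔ A l x ∨ (l = k ∧ x = v))
    (hgt : ∀ l, k ≤ l → mask.testBit l = true → v < best l)
    (hm : ∀ l, mask'.testBit l = true ↔ l = k ∨ (mask.testBit l = true ∧ (k < l ∨ best l < v)))
    : Records K A' mask' (Function.update best k v) where
  sound l hl := by
    rcases (hm l).1 hl with rfl | ⟨hl, -⟩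
    · exact ⟨hkK, (hA _ _).2 (.inr ⟨rfl, by simp⟩)⟩
    · refine ⟨(h.sound l hl).1, (hA _ _).2 ?_⟩
      by_cases hlk : l = k
      · exact .inr ⟨hlk, by simp [hlk]⟩
      · exact .inl (by simpa [hlk] using (h.sound l hl).2)
  complete l x hx := by
    rcases (hA l x).1 hx with hx | ⟨rfl, rfl⟩
    · obtain ⟨l', h1, h2, h3⟩ := h.complete l x hx
      by_cases hr : l' ≠ k ∧ (k < l' ∨ best l' < v)
      · exact ⟨l', h1, (hm l').2 (.inr ⟨h2, hr.2⟩), by simpa [hr.1] using h3⟩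
      · refine ⟨k, ?_, (hm k).2 (.inl rfl), ?_⟩
        · by_contra hlt
          exact hr ⟨by omega, .inl (by omega)⟩
        · rw [Function.update_self]
          by_cases hl' : l' = k
          · subst hl'
            exact (hgt _ le_rfl h2).le.trans h3
          · have : ¬ (k < l' ∨ best l' < v) := fun hc => hr ⟨hl', hc⟩
            push Not at this
            exact this.2.trans h3
    · exact ⟨l, le_rfl, (hm l).2 (.inl rfl), by simp⟩
  strictMono l l' hl hl' hll := by
    rcases (hm l).1 hl with rfl | ⟨h1, h1'⟩
    · rcases (hm l').1 hl' with rfl | ⟨h2, h2'⟩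
      · omega
      · simpa [hll.ne'] using hgt l' hll.le h2
    · rcases (hm l').1 hl' with rfl | ⟨h2, h2'⟩
      · have : best l < v := by
          rcases h1' with h1' | h1'
          · omega
          · exact h1'
        simpa [hll.ne] using this
      · by_cases e : l = k
        · subst e; simpa [hll.ne'] using hgt l' hll.le h2
        · by_cases e' : l' = k
          · subst e'
            rcases h1' with h1' | h1'
            · omega
            · simpa [e] using h1'
          · simpa [e, e'] using h.strictMono l l' h1 h2 hll

/-- The smallest value is found at the lowest bit. -/
theorem best_lowBit_le (h : Records K A mask best) {k : ℕ} {v : ℝ≥0∞} (hv : A k v) :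
    mask ≠ 0 ∧ best (lowBit mask) ≤ v := by
  obtain ⟨l, -, hl, hlv⟩ := h.complete k v hv
  have h0 : mask ≠ 0 := by rintro rfl; simp at hl
  refine ⟨h0, le_trans ?_ hlv⟩
  rcases (lowBit_le hl).eq_or_lt with e | hlt
  · rw [e]
  · exact (h.strictMono _ _ (testBit_lowBit h0) hl hlt).le

end Records

/-! ### Minima over dyadic suffixes -/

/-- Removes those levels below the record level 55 from the mask 50 (and from its part 53 below the
level 55) whose values are at least the value of the item `j`, where the scalar 51 holds `j + 1`. -/
def popLoop : Prog :=
  .loop (.and (.not (.ile (scal 53) (.const 0)))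
      (.wle (.cell 6 (.sub (scal 51) (.const 1))) (.cell 10 (.cell 41 (scal 53)))))
    (.seq (assign 50 (.sub (scal 50) (.cell 40 (.cell 41 (scal 53)))))
      (assign 53 (.sub (scal 53) (.cell 40 (.cell 41 (scal 53))))))

/-- Every iteration removes a bit from the mask, so that the number of bits of the mask serves as a
potential that pays for the loop. -/
theorem WP_popLoop {W : ℕ} {Q : ℕ → State → Prop} {σ : State} {K k j mask : ℕ}
    (hW : 2 ^ (K + 1) + 4 < W) (hjW : j + 1 < W) (hT : HasTables K σ)
    (hmask : mask < 2 ^ (K + 1))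
    (hj : σ.int 51 0 = j + 1) (h50 : σ.int 50 0 = mask) (h53 : σ.int 53 0 = mask % 2 ^ k)
    (hmono : ∀ k k', mask.testBit k = true → mask.testBit k' = true → k < k' →
      σ.wt 10 k < σ.wt 10 k')
    (hQ : ∀ t τ mask', Frame popLoop σ τ → τ.int 50 0 = mask' →
      t + 50 * bitCount mask' ≤ 50 * bitCount mask + 50 →
      (∀ l, mask'.testBit l = true ↔ mask.testBit l = true ∧ (k ≤ l ∨ σ.wt 10 l < σ.wt 6 j)) →
      Q t τ) :
    WP W popLoop Q σ := by
  refine WP_loop (fun t τ => ∃ m, τ.int 50 0 = m ∧ τ.int 53 0 = m % 2 ^ k ∧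
      t + 50 * bitCount m ≤ 50 * bitCount mask ∧
      (∀ l, m.testBit l = true → mask.testBit l = true) ∧
      ∀ l, mask.testBit l = true → m.testBit l = false → l < k ∧ σ.wt 6 j ≤ σ.wt 10 l)
    (fun τ => τ.int 53 0) ?_ ?_ ?_ ?_
  · exact ⟨mask, h50, h53, by omega, fun l hl => hl, fun l hl hl' => by simp [hl] at hl'⟩
  · rintro t τ hf ⟨m, h1, h2, h3, h4, h5⟩
    have hm : m < 2 ^ (K + 1) := lt_two_pow_of_bits fun l hl => by
      by_contra hc
      exact absurd (Nat.ge_two_pow_of_testBit (h4 l hl))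
        (not_le.2 (hmask.trans_le (Nat.pow_le_pow_right (by norm_num) (not_lt.1 hc))))
    have hm2 : m % 2 ^ k ≤ m := Nat.mod_le _ _
    have hlog := Nat.log2_le_self (m % 2 ^ k)
    have h41 := (hT.2.2 (m % 2 ^ k) (by omega)).1
    have e41 := hf.1 41 (by decide)
    have e51 := hf.1 51 (by decide)
    simp [h2, e41, e51, h41, hj]; omega
  · rintro t τ hf ⟨m, h1, h2, h3, h4, h5⟩ hh
    have hm : m < 2 ^ (K + 1) := lt_two_pow_of_bits fun l hl => by
      by_contra hc
      exact absurd (Nat.ge_two_pow_of_testBit (h4 l hl))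
        (not_le.2 (hmask.trans_le (Nat.pow_le_pow_right (by norm_num) (not_lt.1 hc))))
    have hm2 : m % 2 ^ k ≤ m := Nat.mod_le _ _
    have hlog := Nat.log2_le_self (m % 2 ^ k)
    have h41 := (hT.2.2 (m % 2 ^ k) (by omega)).1
    have e41 := hf.1 41 (by decide)
    have e40 := hf.1 40 (by decide)
    have e51 := hf.1 51 (by decide)
    have e6 := hf.2 6 (by decide)
    have e10 := hf.2 10 (by decide)
    simp [h2, e41, e51, h41, hj, e6, e10] at hh
    obtain ⟨hne, hle⟩ := hh
    set c := (m % 2 ^ k).log2 with hc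
    have hbit : (m % 2 ^ k).testBit c = true := Nat.testBit_log2 hne
    have hbit' : c < k ∧ m.testBit c = true := by simpa [Nat.testBit_mod_two_pow] using hbit
    have h2c := Nat.ge_two_pow_of_testBit hbit
    have hcK : c ≤ K := by
      by_contra hcon
      have := Nat.pow_le_pow_right (n := 2) (by norm_num) (show K + 1 ≤ c by omega)
      omega
    have h40 := hT.2.1 c hcK
    refine WP_seq (WP_setInt (by simp; omega)
      (by simp [h1, h2, e41, e40, h41, h40]; omega) ?_)
    refine WP_setInt (by simp; omega) (by simp [h2, e41, e40, h41, h40]; omega) ?_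
    refine ⟨⟨m - 2 ^ c, by simp [h1, h2, e41, e40, h41, h40], ?_, ?_, ?_, ?_⟩, ?_⟩
    · simp only [IExp.val, State.setInt_int]
      norm_num [h2, e41, e40, h41, h40]
      apply Nat.eq_of_testBit_eq
      intro l
      rw [testBit_sub_two_pow hbit, Nat.testBit_mod_two_pow, Nat.testBit_mod_two_pow,
        testBit_sub_two_pow hbit'.2]
      by_cases l < k <;> by_cases l = c <;> simp [*]
    · have := bitCount_sub_two_pow hbit'.2
      simp; omega
    · intro l hl
      rw [testBit_sub_two_pow hbit'.2] at hl
      exact h4 l (by simpa using (Bool.and_eq_true _ _ ▸ hl).2)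
    · intro l hl hl'
      rw [testBit_sub_two_pow hbit'.2] at hl'
      by_cases e : l = c
      · subst e; exact ⟨hbit'.1, hle⟩
      · exact h5 l hl (by simpa [e] using hl')
    · simp [h2, e41, e40, h41, h40]
      have := Nat.one_le_two_pow (n := c)
      omega
  · rintro t τ hf ⟨m, h1, h2, h3, h4, h5⟩ hh
    refine hQ _ τ m hf h1 (by simp; omega) fun l => ⟨fun hl => ⟨h4 l hl, ?_⟩, fun ⟨hl, hl'⟩ => ?_⟩
    · by_contra hcon
      push Not at hcon
      have hm : m < 2 ^ (K + 1) := lt_two_pow_of_bits fun l hl => by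
        by_contra hc
        exact absurd (Nat.ge_two_pow_of_testBit (h4 l hl))
          (not_le.2 (hmask.trans_le (Nat.pow_le_pow_right (by norm_num) (not_lt.1 hc))))
      have hm2 : m % 2 ^ k ≤ m := Nat.mod_le _ _
      have h41 := (hT.2.2 (m % 2 ^ k) (by omega)).1
      have hbl : (m % 2 ^ k).testBit l = true := by simp [Nat.testBit_mod_two_pow, hcon.1, hl]
      have hne : m % 2 ^ k ≠ 0 := by intro e; simp [e] at hbl
      have e41 := hf.1 41 (by decide)
      have e51 := hf.1 51 (by decide)
      have e6 := hf.2 6 (by decide)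
      have e10 := hf.2 10 (by decide)
      simp [h2, e41, e51, h41, hj, e6, e10, hne] at hh
      have hle := le_log2_of_testBit hbl
      have hb2 : m.testBit (m % 2 ^ k).log2 = true := by
        have := Nat.testBit_log2 hne
        rw [Nat.testBit_mod_two_pow] at this
        exact (Bool.and_eq_true _ _ ▸ this).2
      rcases hle.eq_or_lt with e | hlt
      · rw [← e] at hh; exact absurd hcon.2 (not_le.2 hh)
      · exact absurd hcon.2 (not_le.2 ((hmono _ _ (h4 _ hl) (h4 _ hb2) hlt).trans hh))
    · by_contra hcon
      have := h5 l hl (by simpa using hcon)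
      rcases hl' with hl' | hl'
      · omega
      · exact absurd this.2 (not_le.2 hl')

/-- Inserts the item `j`, where the scalar 51 holds `j + 1`, into the stack of records. -/
def insertItem : Prog :=
  .seq (assign 55 (.cell 25 (.sub (scal 51) (.const 1))))
    (.seq (assign 52 (.div (scal 50) (.cell 40 (scal 55))))
      (.cond (.and (.not (.ile (scal 52) (.const 0)))
          (.wle (.cell 10 (.add (scal 55) (.cell 42 (scal 52))))
            (.cell 6 (.sub (scal 51) (.const 1)))))
        .skip
        (.seq (assign 53 (.sub (scal 50) (.mul (scal 52) (.cell 40 (scal 55)))))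
          (.seq popLoop
            (.seq
              (.cond (.ile (.add (.mul (.div (scal 52) (.const 2)) (.const 2)) (.const 1))
                  (scal 52))
                .skip
                (assign 50 (.add (scal 50) (.cell 40 (scal 55)))))
              (.setWt 10 (scal 55) (.cell 6 (.sub (scal 51) (.const 1)))))))))

/-- An insertion takes constant amortized time with respect to the potential `50 * bitCount mask`. -/
theorem WP_insertItem {W : ℕ} {Q : ℕ → State → Prop} {σ : State} {K k j mask : ℕ}
    {A A' : ℕ → ℝ≥0∞ → Prop}
    (hW : 2 ^ (K + 1) + 2 ^ (K + 1) + 4 < W) (hjW : j + 1 < W) (hT : HasTables K σ)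
    (hj : σ.int 51 0 = j + 1) (h50 : σ.int 50 0 = mask) (h25 : σ.int 25 j = k) (hkK : k ≤ K)
    (hR : Records K A mask (σ.wt 10))
    (hA : ∀ l x, A' l x ↔ A l x ∨ (l = k ∧ x = σ.wt 6 j))
    (hQ : ∀ t τ mask', Frame insertItem σ τ → τ.int 50 0 = mask' →
      t + 50 * bitCount mask' ≤ 50 * bitCount mask + 300 →
      Records K A' mask' (τ.wt 10) → Q t τ) :
    WP W insertItem Q σ := by
  suffices H : WP W insertItem (fun t τ =>
      t + 50 * bitCount (τ.int 50 0) ≤ 50 * bitCount mask + 300 ∧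
        Records K A' (τ.int 50 0) (τ.wt 10)) σ from
    H.mono fun t τ hf h => hQ t τ _ hf rfl h.1 h.2
  have hmask := hR.mask_lt
  have h2k := Nat.lt_two_pow_self (n := k)
  have h2K : 2 ^ k ≤ 2 ^ (K + 1) := Nat.pow_le_pow_right (by norm_num) (by omega)
  have h40 := hT.2.1 k hkK
  refine WP_seq (WP_setInt (by simp; omega) (by simp [hj, h25]; omega) ?_)
  refine WP_seq (WP_setInt (by simp; omega) (by simp [hj, h25, h50, h40]; omega) ?_)
  -- The bits of `q` are the record levels `≥ k`; the lowest of them has the smallest value.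
  set q := mask / 2 ^ k with hq
  have hqm : q ≤ mask := Nat.div_le_self _ _
  have h42 := (hT.2.2 q (by omega)).2
  have hlq := lowBit_le_self q
  have hdm := Nat.div_add_mod mask (2 ^ k)
  rw [← hq, mul_comm] at hdm
  have hqbit : ∀ l, q.testBit l = mask.testBit (l + k) := fun l => Nat.testBit_div_two_pow ..
  simp only [IExp.val, hj, State.setInt_int, IExp.size]
  norm_num [h25, h50, h40, ← hq]
  refine WP_cond (by simp [hj, h42]; omega) (fun h => ?_) (fun h => ?_)
  · simp [hj, h42] at h
    refine WP_skip ⟨by simp [h50]; omega, ?_⟩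
    simp only [State.setInt_int, State.setInt_wt]
    norm_num [h50]
    refine hR.of_le hA (k' := k + lowBit q) (by omega) ?_ h.2
    rw [add_comm, ← hqbit]
    exact testBit_lowBit h.1
  · simp [hj, h42] at h
    have hgt : ∀ l, k ≤ l → mask.testBit l = true → σ.wt 6 j < σ.wt 10 l := by
      intro l hl hb
      obtain ⟨d, rfl⟩ := Nat.exists_eq_add_of_le hl
      have hqd : q.testBit d = true := by rw [hqbit, add_comm]; exact hb
      have hq0 : q ≠ 0 := by intro e; simp [e] at hqd
      refine (h hq0).trans_le ?_
      rcases (lowBit_le hqd).eq_or_lt with e | hlt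
      · rw [e]
      · refine (hR.strictMono _ _ ?_ hb (by omega)).le
        rw [add_comm, ← hqbit]; exact testBit_lowBit hq0
    refine WP_seq (WP_setInt (by simp; omega) (by simp [h40, h50]; omega) ?_)
    refine WP_seq (WP_popLoop (K := K) (k := k) (j := j) (mask := mask) (by omega) hjW
      (hT.congr (by simp) (by simp) (by simp) (by simp)) hmask (by simp [hj]) (by simp [h50])
      (by simp [h40, h50]; omega) (by simpa using hR.strictMono) ?_)
    intro t τ m' hf hm' ht hbits
    have e52 := hf.1 52 (by decide)
    have e55 := hf.1 55 (by decide)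
    have e51 := hf.1 51 (by decide)
    have e40 := hf.1 40 (by decide)
    have e6 := hf.2 6 (by decide)
    have e10 := hf.2 10 (by decide)
    have hm'lt : m' < 2 ^ (K + 1) := lt_two_pow_of_bits fun l hl =>
      Nat.lt_succ_of_le (hR.sound l ((hbits l).1 hl).1).1
    have fin : ∀ (u : ℕ) (ρ : State) (m'' : ℕ), Frame popLoop τ ρ → ρ.wt = τ.wt →
        ρ.int 50 0 = m'' → u ≤ 40 → bitCount m'' ≤ bitCount m' + 1 →
        (∀ l, m''.testBit l = true ↔ l = k ∨ m'.testBit l = true) →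
        WP W (Prog.setWt 10 (scal 55) (.cell 6 (.sub (scal 51) (.const 1)))) (fun u' ρ' =>
          100 + t + u + u' + 50 * bitCount (ρ'.int 50 0) ≤ 50 * bitCount mask + 300 ∧
            Records K A' (ρ'.int 50 0) (ρ'.wt 10)) ρ := by
      intro u ρ m'' hfρ hwρ h50ρ hu hbc hb
      have e51' := (hfρ.1 51 (by decide)).trans e51
      have e55' := (hfρ.1 55 (by decide)).trans e55
      refine WP_setWt (by simp [e55']; omega) (by simp [e51', hj]; omega)
        ⟨by simp [h50ρ]; omega, ?_⟩
      simp [e55', e51', hj, hwρ, e10, e6, h50ρ]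
      refine hR.insert hkK hA hgt fun l => ?_
      rw [hb, hbits]
      simp
      constructor
      · rintro (h | ⟨h, h' | h'⟩)
        · exact .inl h
        · rcases h'.eq_or_lt with e | h'
          · exact .inl e.symm
          · exact .inr ⟨h, .inl h'⟩
        · exact .inr ⟨h, .inr h'⟩
      · rintro (h | ⟨h, h' | h'⟩)
        · exact .inl h
        · exact .inr ⟨h, .inl h'.le⟩
        · exact .inr ⟨h, .inr h'⟩
    -- The bit `k` is added only if it is absent, which the parity of `q` tells.
    have hkbit : m'.testBit k = true ↔ q % 2 = 1 := by
      rw [hbits, show mask.testBit k = q.testBit 0 by rw [hqbit, zero_add]]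
      simp [Nat.testBit_zero]
    apply WP_seq
    refine WP_cond (by simp [e52]; omega) (fun h' => ?_) (fun h' => ?_)
    · simp [e52] at h'
      refine WP_skip (WP.mono (fin 20 τ m' (.refl _ _) rfl hm' (by omega) (by omega) fun l => ?_)
        fun u' ρ' _ h => ?_)
      · constructor
        · exact .inr
        · rintro (rfl | h)
          · exact hkbit.2 (by omega)
          · exact h
      · refine ⟨le_trans ?_ h.1, h.2⟩
        simp
        omega
    · simp [e52] at h'
      have hkb : m'.testBit k = false := by
        by_contra hc
        have := hkbit.1 (by simpa using hc)
        omega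
      refine WP_setInt (by simp; omega) (by simp [hm', e55, e40, h40]; omega) ?_
      refine WP.mono (fin 30 _ (m' + 2 ^ k) ⟨fun b hb => ?_, fun b hb => rfl⟩ rfl
        (by simp [hm', e55, e40, h40]) (by omega)
        (by rw [bitCount_add_two_pow hkb]) fun l => ?_) fun u' ρ' _ h => ?_
      · have : b ≠ 50 := by rintro rfl; exact hb (by decide)
        simp [this]
      · rw [testBit_add_two_pow hkb]; simp
      · refine ⟨le_trans ?_ h.1, h.2⟩
        simp
        omega

/-- The number of the items `j`, `c ≤ j < M`, with key `v`: the number of the steps made in the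
list of the key `v`, which is in decreasing order, once the items `j ≥ c` have been dealt with. -/
def countKey (key : ℕ → ℕ) (M v c : ℕ) : ℕ :=
  ((Finset.range M).filter fun j => c ≤ j ∧ key j = v).card

theorem countKey_eq {key : ℕ → ℕ} {M v j : ℕ} (hj : j < M) (h : key j = v) :
    countKey key M v j = countKey key M v (j + 1) + 1 := by
  rw [countKey, countKey, ← Finset.card_insert_of_notMem (a := j) (by simp)]
  congr 1
  ext l
  simp only [Finset.mem_filter, Finset.mem_range, Finset.mem_insert]
  constructor
  · rintro ⟨h1, h2, h3⟩
    by_cases e : l = j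
    · exact .inl e
    · exact .inr ⟨h1, by omega, h3⟩
  · rintro (rfl | ⟨h1, h2, h3⟩)
    · exact ⟨hj, le_rfl, h⟩
    · exact ⟨h1, by omega, h3⟩

theorem countKey_ne {key : ℕ → ℕ} {M v j : ℕ} (h : key j ≠ v) :
    countKey key M v j = countKey key M v (j + 1) := by
  rw [countKey, countKey]
  congr 1
  ext l
  simp only [Finset.mem_filter, Finset.mem_range]
  constructor
  · rintro ⟨h1, h2, h3⟩
    refine ⟨h1, ?_, h3⟩
    rcases h2.eq_or_lt with rfl | h2
    · exact absurd h3 h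
    · exact h2
  · rintro ⟨h1, h2, h3⟩
    exact ⟨h1, by omega, h3⟩

theorem sum_countKey_le (key : ℕ → ℕ) (M : ℕ) (s : Finset ℕ) :
    ∑ v ∈ s, countKey key M v 0 ≤ M := by
  have := Finset.card_biUnion (s := s)
    (t := fun v => (Finset.range M).filter fun j => 0 ≤ j ∧ key j = v) (by
      intro v _ v' _ hne
      rw [Function.onFun, Finset.disjoint_left]
      intro j hj hj'
      simp at hj hj'
      exact hne (hj.2.symm.trans hj'.2))
  simp only [countKey]
  rw [← this]
  calc _ ≤ (Finset.range M).card := Finset.card_le_card (by intro j; simp)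
    _ = M := by simp

/-- `x` is the minimum of the values `f j` of the items `j < M` with `S j`, and `∞` if there is no
such item. -/
def IsMinOver (M : ℕ) (S : ℕ → Prop) (f : ℕ → ℝ≥0∞) (x : ℝ≥0∞) : Prop :=
  (∀ j < M, S j → x ≤ f j) ∧ (x = ⊤ ∨ ∃ j < M, S j ∧ x = f j)

theorem IsMinOver.congr {M : ℕ} {S S' : ℕ → Prop} {f f' : ℕ → ℝ≥0∞} {x : ℝ≥0∞}
    (h : IsMinOver M S f x) (hS : ∀ j < M, S j ↔ S' j) (hf : ∀ j < M, f j = f' j) :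
    IsMinOver M S' f' x := by
  refine ⟨fun j hj hs => hf j hj ▸ h.1 j hj ((hS j hj).2 hs), h.2.imp id ?_⟩
  rintro ⟨j, hj, hs, e⟩
  exact ⟨j, hj, (hS j hj).1 hs, hf j hj ▸ e⟩

/-- The pairs of the level and the value of the items from `S` whose dyadic block contains `i`. -/
def Alive (M : ℕ) (key lv : ℕ → ℕ) (f : ℕ → ℝ≥0∞) (i : ℕ) (S : ℕ → Prop) (k : ℕ) (v : ℝ≥0∞) :
    Prop :=
  ∃ j < M, S j ∧ lv j = k ∧ f j = v ∧ i / 2 ^ k = key j / 2 ^ k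

/-- The dyadic blocks of level `k` that contain `i - 1` and `i` differ if and only if
`k ≤ lowBit i`. -/
theorem div_two_pow_eq_iff {i c k : ℕ} (hi : i ≠ 0) (hc : c < i) :
    i / 2 ^ k = c / 2 ^ k ↔ lowBit i < k ∧ (i - 1) / 2 ^ k = c / 2 ^ k := by
  obtain ⟨i, rfl⟩ := Nat.exists_eq_succ_of_ne_zero hi
  simp only [Nat.succ_eq_add_one, Nat.add_sub_cancel] at *
  have h1 : c / 2 ^ k ≤ i / 2 ^ k := Nat.div_le_div_right (by omega)
  have h2 := two_pow_lowBit_dvd hi k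
  rw [Nat.succ_div]
  split_ifs with h
  · have := h2.1 h; omega
  · have : ¬ k ≤ lowBit (i + 1) := fun hc => h (h2.2 hc)
    omega

/-- Dividing and multiplying by `2 ^ (c + 1)` removes the bits `≤ c`. -/
theorem testBit_clear (mask c k : ℕ) :
    (mask / 2 ^ (c + 1) * 2 ^ (c + 1)).testBit k = true ↔ c < k ∧ mask.testBit k = true := by
  rw [Nat.testBit_mul_two_pow, Nat.testBit_div_two_pow]
  simp only [Bool.and_eq_true, decide_eq_true_eq]
  constructor
  · rintro ⟨h1, h2⟩
    rw [Nat.sub_add_cancel (by omega)] at h2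
    exact ⟨by omega, h2⟩
  · rintro ⟨h1, h2⟩
    rw [Nat.sub_add_cancel (by omega)]
    exact ⟨by omega, h2⟩

/-- Advancing from `i - 1` to `i`: the levels `≤ lowBit i`, whose dyadic blocks end at `i - 1`, are
removed. -/
theorem Records.advance {K M i mask : ℕ} {key lv : ℕ → ℕ} {f best : ℕ → ℝ≥0∞}
    (h : Records K (Alive M key lv f (i - 1) fun j => key j < i) mask best) :
    Records K (Alive M key lv f i fun j => key j < i)
      (mask / 2 ^ (lowBit i + 1) * 2 ^ (lowBit i + 1)) best where
  sound k hk := by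
    rw [testBit_clear] at hk
    obtain ⟨h1, j, hj, hs, hl, hf, hd⟩ := h.sound k hk.2
    exact ⟨h1, j, hj, hs, hl, hf, (div_two_pow_eq_iff (by omega) hs).2 ⟨hk.1, hd⟩⟩
  complete k v hv := by
    obtain ⟨j, hj, hs, hl, hf, hd⟩ := hv
    obtain ⟨hlow, hd⟩ := (div_two_pow_eq_iff (by omega) hs).1 hd
    obtain ⟨k', h1, h2, h3⟩ := h.complete k v ⟨j, hj, hs, hl, hf, hd⟩
    exact ⟨k', h1, (testBit_clear ..).2 ⟨by omega, h2⟩, h3⟩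
  strictMono k k' hk hk' := h.strictMono k k' ((testBit_clear ..).1 hk).2
    ((testBit_clear ..).1 hk').2

/-- For all points `i < 2 ^ K`, computes in the cell `i` of weight array 7 the minimum of the
values (weight array 6) of the items whose key (array 20) is at most `i` and lies in the same dyadic
block of the level (array 25) of the item as `i`. -/
def sweep : Prog :=
  .seq (assign 50 (.const 0))
    (forLoop 32 43 0
      (.seq (assign 50 (.mul (.div (scal 50) (.mul (.cell 40 (.cell 42 (scal 32))) (.const 2)))
          (.mul (.cell 40 (.cell 42 (scal 32))) (.const 2))))
        (.seq (assign 51 (.cell 21 (scal 32)))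
          (.seq (listLoop 51 insertItem)
            (.cond (.ile (scal 50) (.const 0)) (.setWt 7 (scal 32) .top)
              (.setWt 7 (scal 32) (.cell 10 (.cell 42 (scal 50)))))))))

/-- The time for the points `< i` is paid for by constants for the points and for the items with
keys `< i`, up to the potential `50 * bitCount mask`. -/
theorem WP_sweep {W : ℕ} {Q : ℕ → State → Prop} {σ : State} {K M : ℕ}
    (hW : 2 ^ (K + 1) + 2 ^ (K + 1) + 4 < W) (hMW : M + 2 < W) (hT : HasTables K σ)
    (hhead : ∀ v < 2 ^ K, σ.int 21 v = prevKey (σ.int 20) v M)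
    (hnext : ∀ j < M, σ.int 22 j = prevKey (σ.int 20) (σ.int 20 j) j)
    (hlv : ∀ j < M, σ.int 20 j < 2 ^ K → σ.int 25 j ≤ K)
    (hQ : ∀ t τ, t ≤ 200 * 2 ^ K + 400 * M + 20 → Frame sweep σ τ →
      (∀ i < 2 ^ K, IsMinOver M (fun j => σ.int 20 j ≤ i ∧
        i / 2 ^ σ.int 25 j = σ.int 20 j / 2 ^ σ.int 25 j) (σ.wt 6) (τ.wt 7 i)) → Q t τ) :
    WP W sweep Q σ := by
  suffices H : WP W sweep (fun t τ => t ≤ 200 * 2 ^ K + 400 * M + 20 ∧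
      (∀ i < 2 ^ K, IsMinOver M (fun j => σ.int 20 j ≤ i ∧
        i / 2 ^ σ.int 25 j = σ.int 20 j / 2 ^ σ.int 25 j) (σ.wt 6) (τ.wt 7 i))) σ from
    H.mono fun t τ hf h => hQ t τ h.1 hf h.2
  have hKK : 2 ^ (K + 1) = 2 * 2 ^ K := by rw [pow_succ]; omega
  have h2K := Nat.one_le_two_pow (n := K)
  refine WP_seq (WP_setInt (by simp; omega) (by simp; omega) ?_)
  refine WP_for (N := 2 ^ K) (fun i t τ =>
    Records K (Alive M (σ.int 20) (σ.int 25) (σ.wt 6) (i - 1) fun j => σ.int 20 j < i)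
      (τ.int 50 0) (τ.wt 10) ∧
    t + 50 * bitCount (τ.int 50 0) ≤
      200 * i + 400 * ∑ v ∈ Finset.range i, countKey (σ.int 20) M v 0 ∧
    ∀ l < i, IsMinOver M (fun j => σ.int 20 j ≤ l ∧
        l / 2 ^ σ.int 25 j = σ.int 20 j / 2 ^ σ.int 25 j) (σ.wt 6) (τ.wt 7 l))
    (by decide) (by decide) (by decide) (by simpa using hT.1) (by omega) (by omega) ?_ ?_ ?_
  · refine ⟨⟨?_, ?_, ?_⟩, by simp [bitCount], by simp⟩
    · simp
    · rintro k v ⟨j, _, h, _⟩; simp at h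
    · simp
  · intro i t τ hi hf hx ⟨hR, ht, hout⟩
    have e20 : τ.int 20 = σ.int 20 := by simpa using hf.1 20 (by decide)
    have e21 : τ.int 21 = σ.int 21 := by simpa using hf.1 21 (by decide)
    have e22 : τ.int 22 = σ.int 22 := by simpa using hf.1 22 (by decide)
    have e25 : τ.int 25 = σ.int 25 := by simpa using hf.1 25 (by decide)
    have e40 : τ.int 40 = σ.int 40 := by simpa using hf.1 40 (by decide)
    have e41 : τ.int 41 = σ.int 41 := by simpa using hf.1 41 (by decide)
    have e42 : τ.int 42 = σ.int 42 := by simpa using hf.1 42 (by decide)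
    have e43 : τ.int 43 = σ.int 43 := by simpa using hf.1 43 (by decide)
    have e6 : τ.wt 6 = σ.wt 6 := by simpa using hf.2 6 (by decide)
    have hlow : 2 ^ lowBit i ≤ 2 ^ K ∧ lowBit i ≤ K := by
      by_cases hi0 : i = 0
      · subst hi0; rw [lowBit_def]; simp; omega
      · have h1 := Nat.le_of_dvd (by omega) ((two_pow_lowBit_dvd hi0 _).2 le_rfl)
        have h2 : 2 ^ lowBit i < 2 ^ K := by omega
        exact ⟨h2.le, ((Nat.pow_lt_pow_iff_right (by norm_num)).1 h2).le⟩
    have h42 := (hT.2.2 i (by omega)).2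
    have h40 := hT.2.1 _ hlow.2
    have hmask := hR.mask_lt
    have hlb := lowBit_le_self i
    have hR' := hR.advance
    have hc := hR'.mask_lt
    have hD : 2 ^ lowBit i * 2 = 2 ^ (lowBit i + 1) := (pow_succ _ _).symm
    have hprev := prevKey_le (σ.int 20) i M
    refine WP_seq (WP_setInt (by simp; omega) ?_ ?_)
    · simp [hx, e42, e40, h42, h40, hD]
      have := hD
      omega
    refine WP_seq (WP_setInt (by simp; omega) (by simp [hx, e21, hhead i hi]; omega) ?_)
    have hbc : bitCount (τ.int 50 0 / 2 ^ (lowBit i + 1) * 2 ^ (lowBit i + 1)) ≤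
        bitCount (τ.int 50 0) := bitCount_le_of_imp fun j hj => ((testBit_clear ..).1 hj).2
    apply WP_seq
    refine WP_list (v := i) (M := M) (key := σ.int 20) (fun c u ρ =>
      Records K (Alive M (σ.int 20) (σ.int 25) (σ.wt 6) i
        fun j => σ.int 20 j < i ∨ (σ.int 20 j = i ∧ c ≤ j)) (ρ.int 50 0) (ρ.wt 10) ∧
      u + 50 * bitCount (ρ.int 50 0) ≤ 50 * bitCount (τ.int 50 0) +
        400 * countKey (σ.int 20) M i c) (by decide) (by decide) (by decide)
      (by simp [hx, e21, hhead i hi]) (by simpa [e22] using hnext) (by omega) ?_ ?_ ?_ ?_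
    · constructor
      · simp only [IExp.val, State.setInt_int]
        norm_num [hx, e42, e40, h42, h40, hD]
        refine hR'.congr fun k v => ?_
        refine exists_congr fun j => and_congr_right fun hj => ?_
        have : ¬ M ≤ j := by omega
        simp [this]
      · simp [hx, e42, e40, h42, h40, hD]
        omega
    · rintro j u ρ hj hne ⟨h1, h2⟩
      refine ⟨h1.congr fun k v => ?_, by rw [countKey_ne hne]; exact h2⟩
      refine exists_congr fun j' => and_congr_right fun hj => ?_
      refine and_congr_left fun _ => or_congr_right (and_congr_right fun he => ?_)
      have : j' ≠ j := by rintro rfl; exact hne he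
      omega
    · intro j u ρ hj hk hfρ hcur ⟨h1, h2⟩
      have E20 : ρ.int 20 = σ.int 20 := by simpa [e20] using hfρ.1 20 (by decide)
      have E25 : ρ.int 25 = σ.int 25 := by simpa [e25] using hfρ.1 25 (by decide)
      have E40 : ρ.int 40 = σ.int 40 := by simpa [e40] using hfρ.1 40 (by decide)
      have E41 : ρ.int 41 = σ.int 41 := by simpa [e41] using hfρ.1 41 (by decide)
      have E42 : ρ.int 42 = σ.int 42 := by simpa [e42] using hfρ.1 42 (by decide)
      have E43 : ρ.int 43 = σ.int 43 := by simpa [e43] using hfρ.1 43 (by decide)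
      have E6 : ρ.wt 6 = σ.wt 6 := by simpa [e6] using hfρ.2 6 (by decide)
      refine WP_insertItem (K := K) (k := σ.int 25 j) (j := j)
        (A' := Alive M (σ.int 20) (σ.int 25) (σ.wt 6) i
          fun j' => σ.int 20 j' < i ∨ (σ.int 20 j' = i ∧ j ≤ j')) hW (by omega)
        (hT.congr E40 E41 E42 E43) hcur rfl (by rw [E25]) (hlv j hj (by omega)) h1 ?_ ?_
      · intro l x
        rw [E6]
        constructor
        · rintro ⟨j', hj', hs, hl, hv, hd⟩
          by_cases e : j' = j
          · subst e; exact .inr ⟨hl.symm, hv.symm⟩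
          · exact .inl ⟨j', hj', by omega, hl, hv, hd⟩
        · rintro (⟨j', hj', hs, hl, hv, hd⟩ | ⟨rfl, rfl⟩)
          · exact ⟨j', hj', by omega, hl, hv, hd⟩
          · exact ⟨j, hj, .inr ⟨hk, le_rfl⟩, rfl, rfl, by rw [hk]⟩
      · intro u' ρ' m' hfρ' hm' hu' hR''
        subst hm'
        refine ⟨by simpa using hR'', ?_⟩
        rw [countKey_eq hj hk]
        simp
        omega
    · intro u ρ hfρ ⟨h1, h2⟩
      have hx' : ρ.int 32 0 = i := by rw [hfρ.1 32 (by decide)]; simpa using hx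
      have E42 : ρ.int 42 = σ.int 42 := by simpa [e42] using hfρ.1 42 (by decide)
      have E7 : ρ.wt 7 = τ.wt 7 := by simpa using hfρ.2 7 (by decide)
      have hm := h1.mask_lt
      have h42m := (hT.2.2 _ hm).2
      have hlm := lowBit_le_self (ρ.int 50 0)
      have hres : ∀ (x : ℝ≥0∞) (u' : ℕ), IsMinOver M (fun j => σ.int 20 j ≤ i ∧
          i / 2 ^ σ.int 25 j = σ.int 20 j / 2 ^ σ.int 25 j) (σ.wt 6) x → u' ≤ 60 →
          Records K (Alive M (σ.int 20) (σ.int 25) (σ.wt 6) (i + 1 - 1)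
            fun j => σ.int 20 j < i + 1)
            (((ρ.setWt 7 i x).setInt 32 0 (i + 1)).int 50 0)
            (((ρ.setWt 7 i x).setInt 32 0 (i + 1)).wt 10) ∧
          t + (u + u' + 50) + 50 * bitCount (((ρ.setWt 7 i x).setInt 32 0 (i + 1)).int 50 0) ≤
            200 * (i + 1) + 400 * ∑ v ∈ Finset.range (i + 1), countKey (σ.int 20) M v 0 ∧
          ∀ l < i + 1, IsMinOver M (fun j => σ.int 20 j ≤ l ∧
            l / 2 ^ σ.int 25 j = σ.int 20 j / 2 ^ σ.int 25 j) (σ.wt 6)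
            (((ρ.setWt 7 i x).setInt 32 0 (i + 1)).wt 7 l) := by
        intro x u' hmin hu'
        refine ⟨?_, ?_, fun l hl => ?_⟩
        · simp
          refine h1.congr fun k v => ?_
          refine exists_congr fun j' => and_congr_right fun hj => and_congr_left fun _ => ?_
          simp; omega
        · rw [Finset.sum_range_succ]
          simp
          omega
        · by_cases e : l = i
          · simpa [e] using hmin
          · simpa [e, E7] using hout l (by omega)
      refine WP_cond (by simp; omega) (fun h => ?_) (fun h => ?_)
      · simp at h
        refine WP_setWt (by simp [hx']; omega) (by simp) ?_
        simp only [IExp.val, hx', WExp.val]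
        have := hres ⊤ 20 ⟨fun j hj hs => ?_, .inl rfl⟩ (by omega)
        · refine ⟨this.1, le_trans ?_ this.2.1, this.2.2⟩
          simp
          omega
        · exact absurd h (h1.best_lowBit_le ⟨j, hj, by omega, rfl, rfl, hs.2⟩).1
      · simp at h
        refine WP_setWt (by simp [hx']; omega) (by simp [E42, h42m]; omega) ?_
        simp only [IExp.val, hx', WExp.val, E42, h42m]
        have := hres (ρ.wt 10 (lowBit (ρ.int 50 0))) 30 ⟨fun j hj hs => ?_, .inr ?_⟩ (by omega)
        · refine ⟨this.1, le_trans ?_ this.2.1, this.2.2⟩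
          simp
          omega
        · exact (h1.best_lowBit_le ⟨j, hj, by omega, rfl, rfl, hs.2⟩).2
        · obtain ⟨-, j, hj, hs, hl, hv, hd⟩ := h1.sound _ (testBit_lowBit h)
          exact ⟨j, hj, ⟨by omega, by rw [hl]; exact hd⟩, hv.symm⟩
  · intro t τ hf ⟨hR, ht, hout⟩
    have := sum_countKey_le (σ.int 20) M (Finset.range (2 ^ K))
    exact ⟨by simp; omega, hout⟩

/-! ### Row minima: the minimum over the intervals that contain a point -/

/-- The level at which the interval `[lo, hi)` is split: the interval is the union of a suffix of
the dyadic block of this level that contains `lo` and of a prefix of the block of this level that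
contains `hi - 1`. -/
def blockLevel (lo hi : ℕ) : ℕ :=
  if (hi - 1) / (2 ^ (hi - lo).log2 * 2) ≤ lo / (2 ^ (hi - lo).log2 * 2) then (hi - lo).log2
  else (hi - lo).log2 + 1

theorem log2_sub_le {lo hi K : ℕ} (h : lo < hi) (hK : hi ≤ 2 ^ K) : (hi - lo).log2 ≤ K := by
  have h1 := Nat.log2_self_le (n := hi - lo) (by omega)
  exact (Nat.pow_le_pow_iff_right (a := 2) (by norm_num)).1 (by omega)

theorem blockLevel_le {lo hi K : ℕ} (h : lo < hi) (hK : hi ≤ 2 ^ K) : blockLevel lo hi ≤ K := by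
  have h1 := log2_sub_le h hK
  unfold blockLevel
  split_ifs with hc
  · exact h1
  · rcases h1.eq_or_lt with e | h1
    · rw [e] at hc
      rw [Nat.div_eq_of_lt (by omega)] at hc
      exact absurd (Nat.zero_le _) hc
    · exact h1

/-- The end points of `[lo, hi)` lie in adjacent blocks of the level `blockLevel lo hi`, or the
interval is one such block: a block of the level `k = (hi - lo).log2` is at most as long as the
interval, which meets at most three blocks of the level `k` and at most two of the level `k + 1`. -/
theorem div_blockLevel {lo hi : ℕ} (h : lo < hi) :
    (hi - 1) / 2 ^ blockLevel lo hi = lo / 2 ^ blockLevel lo hi + 1 ∨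
      (lo / 2 ^ blockLevel lo hi * 2 ^ blockLevel lo hi = lo ∧
        hi = (lo / 2 ^ blockLevel lo hi + 1) * 2 ^ blockLevel lo hi) := by
  have h1 := Nat.log2_self_le (n := hi - lo) (by omega)
  have h2 := Nat.lt_log2_self (n := hi - lo)
  unfold blockLevel
  set k := (hi - lo).log2
  rw [pow_succ] at h2
  set D := 2 ^ k with hD
  have hD0 : 0 < D := by positivity
  split_ifs with hc
  · rw [← hD]
    rw [← Nat.div_div_eq_div_mul, ← Nat.div_div_eq_div_mul] at hc
    have e1 := Nat.div_add_mod lo D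
    have e2 := Nat.div_add_mod (hi - 1) D
    have l1 := Nat.mod_lt lo hD0
    have l2 := Nat.mod_lt (hi - 1) hD0
    have h3 : lo / D ≤ (hi - 1) / D := Nat.div_le_div_right (by omega)
    by_cases e : (hi - 1) / D = lo / D
    · right
      rw [e] at e2
      rw [add_mul, mul_comm (lo / D)]
      omega
    · left; omega
  · left
    rw [pow_succ, ← hD]
    have e1 := Nat.div_add_mod lo (D * 2)
    have e2 := Nat.div_add_mod (hi - 1) (D * 2)
    have l1 := Nat.mod_lt lo (show 0 < D * 2 by omega)
    have l2 := Nat.mod_lt (hi - 1) (show 0 < D * 2 by omega)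
    by_contra hne
    have h4 : lo / (D * 2) + 2 ≤ (hi - 1) / (D * 2) := by omega
    have := Nat.mul_le_mul_left (D * 2) h4
    rw [mul_add] at this
    omega

/-- Membership in an interval, in the terms of the two sweeps. -/
theorem mem_interval_iff {lo hi : ℕ} (h : lo < hi) (i : ℕ) :
    (lo ≤ i ∧ i < hi) ↔
      (lo ≤ i ∧ i / 2 ^ blockLevel lo hi = lo / 2 ^ blockLevel lo hi) ∨
      (i < hi ∧ i / 2 ^ blockLevel lo hi = (hi - 1) / 2 ^ blockLevel lo hi) := by
  have key := div_blockLevel h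
  set L := blockLevel lo hi
  have hD0 : 0 < 2 ^ L := by positivity
  set D := 2 ^ L
  have hup : hi - 1 < i → (hi - 1) / D ≤ i / D := fun h => Nat.div_le_div_right h.le
  have hdn : i < lo → i / D ≤ lo / D := fun h => Nat.div_le_div_right h.le
  constructor
  · rintro ⟨h1, h2⟩
    have h3 : lo / D ≤ i / D := Nat.div_le_div_right h1
    have h4 : i / D ≤ (hi - 1) / D := Nat.div_le_div_right (by omega)
    rcases key with key | ⟨k1, k2⟩
    · by_cases e : i / D = lo / D
      · exact .inl ⟨h1, e⟩
      · exact .inr ⟨h2, by omega⟩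
    · left
      refine ⟨h1, ?_⟩
      have : i / D < lo / D + 1 := (Nat.div_lt_iff_lt_mul hD0).2 (by omega)
      omega
  · rintro (⟨h1, h2⟩ | ⟨h1, h2⟩)
    · refine ⟨h1, ?_⟩
      rcases key with key | ⟨k1, k2⟩
      · by_contra hc
        have := hup (by omega)
        omega
      · have := Nat.lt_mul_div_succ i hD0
        rw [h2, mul_comm] at this
        omega
    · refine ⟨?_, h1⟩
      rcases key with key | ⟨k1, k2⟩
      · by_contra hc
        have := hdn (by omega)
        omega
      · have : (hi - 1) / D = lo / D := by
          have h5 : (hi - 1) / D < lo / D + 1 := (Nat.div_lt_iff_lt_mul hD0).2 (by omega)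
          have h6 : lo / D ≤ (hi - 1) / D := Nat.div_le_div_right (by omega)
          omega
        rw [this] at h2
        have := Nat.div_mul_le_self i D
        rw [h2] at this
        omega

/-- Reflection maps dyadic blocks to dyadic blocks. -/
theorem reflect_div {K L x : ℕ} (hL : L ≤ K) (hx : x < 2 ^ K) :
    (2 ^ K - 1 - x) / 2 ^ L + x / 2 ^ L + 1 = 2 ^ (K - L) := by
  have hD0 : 0 < 2 ^ L := by positivity
  have e : 2 ^ K = 2 ^ (K - L) * 2 ^ L := by rw [← pow_add]; congr 1; omega
  have hq : x / 2 ^ L < 2 ^ (K - L) := (Nat.div_lt_iff_lt_mul hD0).2 (by omega)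
  obtain ⟨c, hc⟩ := Nat.exists_eq_add_of_lt hq
  have e1 := Nat.div_add_mod x (2 ^ L)
  have l1 := Nat.mod_lt x hD0
  suffices (2 ^ K - 1 - x) / 2 ^ L = c by omega
  rw [e, hc]
  rw [Nat.div_eq_iff hD0]
  have : (x / 2 ^ L + c + 1) * 2 ^ L = 2 ^ L * (x / 2 ^ L) + c * 2 ^ L + 2 ^ L := by ring
  omega

theorem reflect_div_eq_iff {K L x y : ℕ} (hL : L ≤ K) (hx : x < 2 ^ K) (hy : y < 2 ^ K) :
    (2 ^ K - 1 - x) / 2 ^ L = (2 ^ K - 1 - y) / 2 ^ L ↔ x / 2 ^ L = y / 2 ^ L := by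
  have := reflect_div hL hx
  have := reflect_div hL hy
  omega

/-- Prepares the items `j < m` for the sweep from left to right: the key is the left endpoint of the
interval `[lo, hi)` (arrays 26 and 27); empty intervals receive a key that is not a point. -/
def leftKeys : Prog :=
  forLoop 33 0 1
    (.cond (.ile (.cell 27 (scal 33)) (.cell 26 (scal 33)))
      (.setInt 20 (scal 33) (scal 43))
      (.seq (.setInt 20 (scal 33) (.cell 26 (scal 33)))
        (.seq (assign 56 (.cell 41 (.sub (.cell 27 (scal 33)) (.cell 26 (scal 33)))))
          (.seq (assign 57 (.mul (.cell 40 (scal 56)) (.const 2)))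
            (.cond (.ile (.div (.sub (.cell 27 (scal 33)) (.const 1)) (scal 57))
                (.div (.cell 26 (scal 33)) (scal 57)))
              (.setInt 25 (scal 33) (scal 56))
              (.setInt 25 (scal 33) (.add (scal 56) (.const 1))))))))

theorem WP_leftKeys {W : ℕ} {Q : ℕ → State → Prop} {σ : State} {K m : ℕ} {lo hi : ℕ → ℕ}
    (hm : σ.int 0 1 = m) (hlo : σ.int 26 = lo) (hhi : σ.int 27 = hi)
    (hW : 2 ^ (K + 1) + 2 ^ (K + 1) + 4 < W) (hmW : m + 4 < W) (hT : HasTables K σ)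
    (hloW : ∀ j < m, lo j < W) (hhiN : ∀ j < m, hi j ≤ 2 ^ K)
    (hQ : ∀ t τ, t ≤ 100 * m + 10 → Frame leftKeys σ τ →
      (∀ j < m, τ.int 20 j = if lo j < hi j then lo j else 2 ^ K) →
      (∀ j < m, lo j < hi j → τ.int 25 j = blockLevel (lo j) (hi j)) → Q t τ) :
    WP W leftKeys Q σ := by
  have hKK : 2 ^ (K + 1) = 2 * 2 ^ K := by rw [pow_succ]; omega
  suffices H : WP W leftKeys (fun t τ => t ≤ 100 * m + 10 ∧
      (∀ j < m, τ.int 20 j = if lo j < hi j then lo j else 2 ^ K) ∧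
      (∀ j < m, lo j < hi j → τ.int 25 j = blockLevel (lo j) (hi j))) σ from
    H.mono fun t τ hf h => hQ t τ h.1 hf h.2.1 h.2.2
  refine WP_for_const (C := 100) (fun k τ =>
    (∀ j < k, τ.int 20 j = if lo j < hi j then lo j else 2 ^ K) ∧
      (∀ j < k, lo j < hi j → τ.int 25 j = blockLevel (lo j) (hi j))) (by decide) (by decide)
    (by decide) hm (by omega) (by omega) (by simp) ?_ (fun t τ ht hf hI => ⟨ht, hI⟩)
  intro i τ hi' hf hx ⟨hI1, hI2⟩
  have e26 : τ.int 26 = lo := by simpa [hlo] using hf.1 26 (by decide)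
  have e27 : τ.int 27 = hi := by simpa [hhi] using hf.1 27 (by decide)
  have e40 : τ.int 40 = σ.int 40 := hf.1 40 (by decide)
  have e41 : τ.int 41 = σ.int 41 := hf.1 41 (by decide)
  have e43 : τ.int 43 0 = 2 ^ K := by rw [hf.1 43 (by decide)]; exact hT.1
  have b1 := hloW i hi'
  have b2 := hhiN i hi'
  refine WP_cond (by simp [hx, e26, e27]; omega) (fun h => ?_) (fun h => ?_)
  · simp [hx, e26, e27] at h
    refine WP_setInt (by simp [hx]; omega) (by simp [e43]; omega) ⟨by simp, fun j hj => ?_,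
      fun j hj hlt => ?_⟩
    · by_cases e : j = i
      · subst e; simp [hx, e43]; omega
      · simpa [hx, e] using hI1 j (by omega)
    · by_cases e : j = i
      · subst e; omega
      · simpa [hx, e] using hI2 j (by omega) hlt
  · simp [hx, e26, e27] at h
    have hk := log2_sub_le h b2
    have h41 := (hT.2.2 (hi i - lo i) (by omega)).1
    have h40 := hT.2.1 _ hk
    have hpk : 2 ^ (hi i - lo i).log2 ≤ 2 ^ K := Nat.pow_le_pow_right (by norm_num) hk
    have hlt := Nat.lt_two_pow_self (n := (hi i - lo i).log2)
    refine WP_seq (WP_setInt (by simp [hx]; omega) (by simp [hx, e26]; omega) ?_)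
    refine WP_seq (WP_setInt (by simp; omega) (by simp [hx, e26, e27, e41, h41]; omega) ?_)
    refine WP_seq (WP_setInt (by simp; omega) (by simp [hx, e26, e27, e41, e40, h41, h40]; omega) ?_)
    have fin : ∀ (u : ℕ) (ρ : State), u ≤ 80 → (∀ j, ρ.int 20 j = if j = i then lo i else τ.int 20 j)
        → (∀ j, ρ.int 25 j = if j = i then blockLevel (lo i) (hi i) else τ.int 25 j) →
        u + 13 ≤ 100 ∧ (∀ j < i + 1, (ρ.setInt 33 0 (i + 1)).int 20 j =
          if lo j < hi j then lo j else 2 ^ K) ∧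
        (∀ j < i + 1, lo j < hi j → (ρ.setInt 33 0 (i + 1)).int 25 j =
          blockLevel (lo j) (hi j)) := by
      intro u ρ hu h20 h25
      refine ⟨by omega, fun j hj => ?_, fun j hj hlt => ?_⟩
      · by_cases e : j = i
        · subst e; simp [h20, h]
        · simpa [h20, e] using hI1 j (by omega)
      · by_cases e : j = i
        · subst e; simp [h25]
        · simpa [h25, e] using hI2 j (by omega) hlt
    refine WP_cond (by simp [hx, e26, e27, e41, e40, h41, h40]; omega) (fun h' => ?_) (fun h' => ?_)
    · simp [hx, e26, e27, e41, e40, h41, h40] at h'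
      refine WP_setInt (by simp [hx]; omega) (by simp [hx, e26, e27, e41, h41]; omega)
        (fin _ _ (by simp) (fun j => ?_) (fun j => ?_))
      · simp [hx, Function.update_apply, e26]
      · simp [hx, Function.update_apply, e26, e27, e41, h41, blockLevel, h']
    · simp [hx, e26, e27, e41, e40, h41, h40] at h'
      refine WP_setInt (by simp [hx]; omega) (by simp [hx, e26, e27, e41, h41]; omega)
        (fin _ _ (by simp) (fun j => ?_) (fun j => ?_))
      · simp [hx, Function.update_apply, e26]
      · simp [hx, Function.update_apply, e26, e27, e41, h41, blockLevel, not_le.2 h']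

/-- Prepares the items for the sweep from right to left, which is carried out as a sweep from left
to right over the reflected intervals. -/
def rightKeys : Prog :=
  forLoop 33 0 1
    (.cond (.ile (.cell 27 (scal 33)) (.cell 26 (scal 33))) .skip
      (.setInt 20 (scal 33) (.sub (scal 43) (.cell 27 (scal 33)))))

theorem WP_rightKeys {W : ℕ} {Q : ℕ → State → Prop} {σ : State} {N m : ℕ} {lo hi : ℕ → ℕ}
    (hm : σ.int 0 1 = m) (hlo : σ.int 26 = lo) (hhi : σ.int 27 = hi)
    (hN : σ.int 43 0 = N) (hNW : N + 4 < W) (hmW : m + 4 < W)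
    (hloW : ∀ j < m, lo j < W) (hhiN : ∀ j < m, hi j ≤ N)
    (h20 : ∀ j < m, ¬ lo j < hi j → σ.int 20 j = N)
    (hQ : ∀ t τ, t ≤ 100 * m + 10 → Frame rightKeys σ τ →
      (∀ j < m, τ.int 20 j = if lo j < hi j then N - hi j else N) → Q t τ) :
    WP W rightKeys Q σ := by
  suffices H : WP W rightKeys (fun t τ => t ≤ 100 * m + 10 ∧
      (∀ j < m, τ.int 20 j = if lo j < hi j then N - hi j else N)) σ from
    H.mono fun t τ hf h => hQ t τ h.1 hf h.2
  refine WP_for_const (C := 100) (fun k τ =>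
    (∀ j < k, τ.int 20 j = if lo j < hi j then N - hi j else N) ∧
      ∀ j < m, ¬ lo j < hi j → τ.int 20 j = N) (by decide) (by decide)
    (by decide) hm (by omega) (by omega) (by simpa using h20) ?_ (fun t τ ht hf hI => ⟨ht, hI.1⟩)
  intro i τ hi' hf hx ⟨hI, hI'⟩
  have e26 : τ.int 26 = lo := by simpa [hlo] using hf.1 26 (by decide)
  have e27 : τ.int 27 = hi := by simpa [hhi] using hf.1 27 (by decide)
  have e43 : τ.int 43 0 = N := by rw [hf.1 43 (by decide)]; exact hN
  have b1 := hloW i hi'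
  have b2 := hhiN i hi'
  refine WP_cond (by simp [hx, e26, e27]; omega) (fun h => ?_) (fun h => ?_)
  · simp [hx, e26, e27] at h
    refine WP_skip ⟨by simp, fun j hj => ?_, by simpa using hI'⟩
    by_cases e : j = i
    · subst e; simp; rw [if_neg (by omega)]; exact hI' j hi' (by omega)
    · simpa using hI j (by omega)
  · simp [hx, e26, e27] at h
    refine WP_setInt (by simp [hx]; omega) (by simp [hx, e43, e27]; omega) ⟨by simp,
      fun j hj => ?_, fun j hj hlt => ?_⟩
    · by_cases e : j = i
      · subst e; simp [hx, e43, e27, h]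
      · simpa [hx, e] using hI j (by omega)
    · have e : j ≠ i := by rintro rfl; exact hlt h
      simpa [hx, e] using hI' j hj hlt

/-- Copies the result of the first sweep to weight array 3. -/
def copyLeft : Prog := forLoop 33 0 2 (.setWt 3 (scal 33) (.cell 7 (scal 33)))

theorem WP_copyLeft {W : ℕ} {Q : ℕ → State → Prop} {σ : State} {p : ℕ}
    (hp : σ.int 0 2 = p) (hpW : p + 4 < W)
    (hQ : ∀ t τ, t ≤ 50 * p + 10 → Frame copyLeft σ τ →
      (∀ j < p, τ.wt 3 j = σ.wt 7 j) → Q t τ) :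
    WP W copyLeft Q σ := by
  suffices H : WP W copyLeft (fun t τ => t ≤ 50 * p + 10 ∧ (∀ j < p, τ.wt 3 j = σ.wt 7 j)) σ from
    H.mono fun t τ hf h => hQ t τ h.1 hf h.2
  refine WP_for_const (C := 50) (fun k τ => (∀ j < k, τ.wt 3 j = σ.wt 7 j)) (by decide) (by decide)
    (by decide) hp (by omega) (by omega) (by simp) ?_ (fun t τ ht hf hI => ⟨ht, hI⟩)
  intro i τ hi' hf hx hI
  have e7 : τ.wt 7 = σ.wt 7 := hf.2 7 (by decide)
  refine WP_setWt (by simp [hx]; omega) (by simp [hx]; omega) ⟨by simp, fun j hj => ?_⟩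
  by_cases e : j = i
  · simp [hx, e, e7]
  · simpa [hx, e] using hI j (by omega)

/-- Combines the results of the two sweeps. -/
def mergeRight : Prog :=
  forLoop 33 0 2
    (.cond (.wle (.cell 3 (scal 33)) (.cell 7 (.sub (.sub (scal 43) (.const 1)) (scal 33)))) .skip
      (.setWt 3 (scal 33) (.cell 7 (.sub (.sub (scal 43) (.const 1)) (scal 33)))))

theorem WP_mergeRight {W : ℕ} {Q : ℕ → State → Prop} {σ : State} {p N : ℕ}
    (hp : σ.int 0 2 = p) (hpW : p + 4 < W) (hN : σ.int 43 0 = N) (hNW : N + 4 < W)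
    (hQ : ∀ t τ, t ≤ 50 * p + 10 → Frame mergeRight σ τ →
      (∀ j < p, τ.wt 3 j = min (σ.wt 3 j) (σ.wt 7 (N - 1 - j))) → Q t τ) :
    WP W mergeRight Q σ := by
  suffices H : WP W mergeRight (fun t τ => t ≤ 50 * p + 10 ∧
      (∀ j < p, τ.wt 3 j = min (σ.wt 3 j) (σ.wt 7 (N - 1 - j)))) σ from
    H.mono fun t τ hf h => hQ t τ h.1 hf h.2
  refine WP_for_const (C := 50) (fun k τ =>
    (∀ j < k, τ.wt 3 j = min (σ.wt 3 j) (σ.wt 7 (N - 1 - j))) ∧ ∀ j, k ≤ j → τ.wt 3 j = σ.wt 3 j)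
    (by decide) (by decide)
    (by decide) hp (by omega) (by omega) (by simp) ?_ (fun t τ ht hf hI => ⟨ht, hI.1⟩)
  intro i τ hi' hf hx ⟨hI, hI'⟩
  have e7 : τ.wt 7 = σ.wt 7 := hf.2 7 (by decide)
  have e43 : τ.int 43 0 = N := by rw [hf.1 43 (by decide)]; exact hN
  have e3 := hI' i le_rfl
  refine WP_cond (by simp [hx, e43]; omega) (fun h => ?_) (fun h => ?_)
  · simp [hx, e43, e7, e3] at h
    refine WP_skip ⟨by simp, fun j hj => ?_, fun j hj => by simpa using hI' j (by omega)⟩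
    by_cases e : j = i
    · subst e; simp [e3, h]
    · simpa using hI j (by omega)
  · simp [hx, e43, e7, e3] at h
    refine WP_setWt (by simp [hx]; omega) (by simp [hx, e43]; omega) ⟨by simp, fun j hj => ?_,
      fun j hj => ?_⟩
    · by_cases e : j = i
      · subst e; simp [hx, e7, e43, h.le]
      · simpa [hx, e] using hI j (by omega)
    · have e : j ≠ i := by omega
      simpa [hx, e] using hI' j (by omega)

/-- Sorts the items by their keys `≤ 2 ^ K` and sweeps; the items with the key `2 ^ K`, which is not
a point, are those with empty intervals. -/
def sortAndSweep : Prog :=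
  .seq (assign 23 (.cell 0 (.const 1))) (.seq (assign 24 (.add (scal 43) (.const 1)))
    (.seq buildLists sweep))

theorem WP_sortAndSweep {W : ℕ} {Q : ℕ → State → Prop} {σ : State} {K M : ℕ}
    (hW : 2 ^ (K + 1) + 2 ^ (K + 1) + 8 < W) (hMW : M + 4 < W) (hT : HasTables K σ)
    (hm : σ.int 0 1 = M) (hkey : ∀ j < M, σ.int 20 j ≤ 2 ^ K)
    (hlv : ∀ j < M, σ.int 20 j < 2 ^ K → σ.int 25 j ≤ K)
    (hQ : ∀ t τ, t ≤ 300 * 2 ^ K + 500 * M + 200 → Frame sortAndSweep σ τ →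
      (∀ i < 2 ^ K, IsMinOver M (fun j => σ.int 20 j ≤ i ∧
        i / 2 ^ σ.int 25 j = σ.int 20 j / 2 ^ σ.int 25 j) (σ.wt 6) (τ.wt 7 i)) → Q t τ) :
    WP W sortAndSweep Q σ := by
  suffices H : WP W sortAndSweep (fun t τ => t ≤ 300 * 2 ^ K + 500 * M + 200 ∧
      (∀ i < 2 ^ K, IsMinOver M (fun j => σ.int 20 j ≤ i ∧
        i / 2 ^ σ.int 25 j = σ.int 20 j / 2 ^ σ.int 25 j) (σ.wt 6) (τ.wt 7 i))) σ from
    H.mono fun t τ hf h => hQ t τ h.1 hf h.2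
  have hKK : 2 ^ (K + 1) = 2 * 2 ^ K := by rw [pow_succ]; omega
  refine WP_seq (WP_setInt (by simp; omega) (by simp [hm]; omega) ?_)
  refine WP_seq (WP_setInt (by simp; omega) (by simp [hT.1]; omega) ?_)
  refine WP_seq (WP_buildLists (M := M) (N := 2 ^ K + 1) (by simp [hm]) (by simp [hT.1])
    (by omega) (by omega) (by simpa [Nat.lt_succ_iff] using hkey) ?_)
  intro t τ ht hf h21 h22
  have e20 : τ.int 20 = σ.int 20 := by simpa using hf.1 20 (by decide)
  have e25 : τ.int 25 = σ.int 25 := by simpa using hf.1 25 (by decide)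
  have e40 : τ.int 40 = σ.int 40 := by simpa using hf.1 40 (by decide)
  have e41 : τ.int 41 = σ.int 41 := by simpa using hf.1 41 (by decide)
  have e42 : τ.int 42 = σ.int 42 := by simpa using hf.1 42 (by decide)
  have e43 : τ.int 43 = σ.int 43 := by simpa using hf.1 43 (by decide)
  have e6 : τ.wt 6 = σ.wt 6 := by simpa using hf.2 6 (by decide)
  refine WP_sweep (K := K) (M := M) (by omega) (by omega) (hT.congr e40 e41 e42 e43)
    (fun v hv => ?_) (fun j hj => ?_) (by simpa [e20, e25] using hlv) ?_
  · simpa [e20] using h21 v (by omega)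
  · simpa [e20] using h22 j hj
  · intro u ρ hu hfρ hmin
    refine ⟨by simp; omega, ?_⟩
    simpa only [e20, e25, e6] using hmin

/-- Computes, for all points `i < p`, the minimum of the values (weight array 6) of the items
`j < m` whose interval `[lo, hi)` (integer arrays 26 and 27) contains `i`, in weight array 3. -/
def rowMinima : Prog :=
  .seq powTable (.seq logTable (.seq leftKeys (.seq sortAndSweep (.seq copyLeft
    (.seq rightKeys (.seq sortAndSweep mergeRight))))))

theorem WP_rowMinima {W : ℕ} {Q : ℕ → State → Prop} {σ : State} {p m : ℕ} {lo hi : ℕ → ℕ}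
    (hp : σ.int 0 2 = p) (hp1 : 1 ≤ p) (hm : σ.int 0 1 = m)
    (hlo : σ.int 26 = lo) (hhi : σ.int 27 = hi)
    (hpW : 8 * p + 16 < W) (hmW : m + 8 < W)
    (hloW : ∀ j < m, lo j < W) (hhip : ∀ j < m, hi j ≤ p)
    (hQ : ∀ t τ, t ≤ 3000 * p + 2000 * m + 2000 → Frame rowMinima σ τ →
      (∀ i < p, IsMinOver m (fun j => lo j ≤ i ∧ i < hi j) (σ.wt 6) (τ.wt 3 i)) → Q t τ) :
    WP W rowMinima Q σ := by
  suffices H : WP W rowMinima (fun t τ => t ≤ 3000 * p + 2000 * m + 2000 ∧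
      (∀ i < p, IsMinOver m (fun j => lo j ≤ i ∧ i < hi j) (σ.wt 6) (τ.wt 3 i))) σ from
    H.mono fun t τ hf h => hQ t τ h.1 hf h.2
  refine WP_seq (WP_powTable hp hp1 (by omega) ?_)
  intro K t1 σ1 ht1 hf1 hpK hK2 h43 h40
  have hKK : 2 ^ (K + 1) = 2 * 2 ^ K := by rw [pow_succ]; omega
  refine WP_seq (WP_logTable h43 (by omega) ?_)
  intro t2 σ2 ht2 hf2 htab
  have T2 : HasTables K σ2 := ⟨by rw [hf2.1 43 (by decide), h43],
    by rw [hf2.1 40 (by decide)]; exact h40, by rw [hKK]; exact htab⟩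
  have e02 : σ2.int 0 = σ.int 0 := (hf2.1 0 (by decide)).trans (hf1.1 0 (by decide))
  have e262 : σ2.int 26 = lo := ((hf2.1 26 (by decide)).trans (hf1.1 26 (by decide))).trans hlo
  have e272 : σ2.int 27 = hi := ((hf2.1 27 (by decide)).trans (hf1.1 27 (by decide))).trans hhi
  have e62 : σ2.wt 6 = σ.wt 6 := (hf2.2 6 (by decide)).trans (hf1.2 6 (by decide))
  refine WP_seq (WP_leftKeys (K := K) (m := m) (by rw [e02, hm]) e262 e272 (by omega) (by omega)
    T2 hloW (fun j hj => (hhip j hj).trans hpK) ?_)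
  intro t3 σ3 ht3 hf3 h20 h25
  have T3 : HasTables K σ3 := T2.congr (hf3.1 40 (by decide)) (hf3.1 41 (by decide))
    (hf3.1 42 (by decide)) (hf3.1 43 (by decide))
  have e03 : σ3.int 0 = σ.int 0 := (hf3.1 0 (by decide)).trans e02
  have e63 : σ3.wt 6 = σ.wt 6 := (hf3.2 6 (by decide)).trans e62
  refine WP_seq (WP_sortAndSweep (K := K) (M := m) (by omega) (by omega) T3 (by rw [e03, hm])
    (fun j hj => ?_) (fun j hj hjlt => ?_) ?_)
  · rw [h20 j hj]
    have := hhip j hj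
    split_ifs <;> omega
  · rw [h20 j hj] at hjlt
    split_ifs at hjlt with hc
    · rw [h25 j hj hc]
      exact blockLevel_le hc ((hhip j hj).trans hpK)
    · omega
  intro t4 σ4 ht4 hf4 hmin4
  have T4 : HasTables K σ4 := T3.congr (hf4.1 40 (by decide)) (hf4.1 41 (by decide))
    (hf4.1 42 (by decide)) (hf4.1 43 (by decide))
  have e04 : σ4.int 0 = σ.int 0 := (hf4.1 0 (by decide)).trans e03
  have e204 : σ4.int 20 = σ3.int 20 := hf4.1 20 (by decide)
  have e254 : σ4.int 25 = σ3.int 25 := hf4.1 25 (by decide)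
  have e264 : σ4.int 26 = lo := ((hf4.1 26 (by decide)).trans (hf3.1 26 (by decide))).trans e262
  have e274 : σ4.int 27 = hi := ((hf4.1 27 (by decide)).trans (hf3.1 27 (by decide))).trans e272
  have e64 : σ4.wt 6 = σ.wt 6 := (hf4.2 6 (by decide)).trans e63
  refine WP_seq (WP_copyLeft (p := p) (by rw [e04, hp]) (by omega) ?_)
  intro t5 σ5 ht5 hf5 hcopy
  have e05 : σ5.int 0 = σ.int 0 := (hf5.1 0 (by decide)).trans e04
  have T5 : HasTables K σ5 := T4.congr (hf5.1 40 (by decide)) (hf5.1 41 (by decide))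
    (hf5.1 42 (by decide)) (hf5.1 43 (by decide))
  refine WP_seq (WP_rightKeys (N := 2 ^ K) (m := m) (lo := lo) (hi := hi) (by rw [e05, hm])
    ((hf5.1 26 (by decide)).trans e264) ((hf5.1 27 (by decide)).trans e274) T5.1 (by omega)
    (by omega) hloW (fun j hj => (hhip j hj).trans hpK) (fun j hj hc => ?_) ?_)
  · rw [hf5.1 20 (by decide), e204, h20 j hj, if_neg hc]
  intro t6 σ6 ht6 hf6 h20'
  have e06 : σ6.int 0 = σ.int 0 := (hf6.1 0 (by decide)).trans e05
  have e256 : σ6.int 25 = σ3.int 25 :=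
    ((hf6.1 25 (by decide)).trans (hf5.1 25 (by decide))).trans e254
  have e66 : σ6.wt 6 = σ.wt 6 := ((hf6.2 6 (by decide)).trans (hf5.2 6 (by decide))).trans e64
  have T6 : HasTables K σ6 := T5.congr (hf6.1 40 (by decide)) (hf6.1 41 (by decide))
    (hf6.1 42 (by decide)) (hf6.1 43 (by decide))
  refine WP_seq (WP_sortAndSweep (K := K) (M := m) (by omega) (by omega) T6 (by rw [e06, hm])
    (fun j hj => ?_) (fun j hj hjlt => ?_) ?_)
  · rw [h20' j hj]
    split_ifs <;> omega
  · rw [h20' j hj] at hjlt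
    split_ifs at hjlt with hc
    · rw [e256, h25 j hj hc]
      exact blockLevel_le hc ((hhip j hj).trans hpK)
    · omega
  intro t7 σ7 ht7 hf7 hmin7
  have e07 : σ7.int 0 = σ.int 0 := (hf7.1 0 (by decide)).trans e06
  refine WP_mergeRight (p := p) (N := 2 ^ K) (by rw [e07, hp]) (by omega)
    (by rw [hf7.1 43 (by decide)]; exact T6.1) (by omega) ?_
  intro t8 σ8 ht8 hf8 hres
  refine ⟨by omega, fun i hi' => ?_⟩
  have h3 : σ7.wt 3 i = σ4.wt 7 i := by
    rw [hf7.2 3 (by decide), hf6.2 3 (by decide), hcopy i hi']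
  rw [hres i hi', h3]
  have L := (hmin4 i (by omega)).congr (S' := fun j => lo j < hi j ∧ lo j ≤ i ∧
    i / 2 ^ blockLevel (lo j) (hi j) = lo j / 2 ^ blockLevel (lo j) (hi j)) (f' := σ.wt 6)
    (fun j hj => by
      rw [h20 j hj]
      split_ifs with hc
      · rw [h25 j hj hc]; simp [hc]
      · constructor
        · intro h; omega
        · intro h; exact absurd h.1 hc) (fun j hj => by rw [e63])
  have R := (hmin7 (2 ^ K - 1 - i) (by omega)).congr (S' := fun j => lo j < hi j ∧ i < hi j ∧
    i / 2 ^ blockLevel (lo j) (hi j) = (hi j - 1) / 2 ^ blockLevel (lo j) (hi j)) (f' := σ.wt 6)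
    (fun j hj => by
      rw [h20' j hj]
      have h1 := hhip j hj
      split_ifs with hc
      · rw [e256, h25 j hj hc, show 2 ^ K - hi j = 2 ^ K - 1 - (hi j - 1) by omega,
          reflect_div_eq_iff (blockLevel_le hc ((hhip j hj).trans hpK)) (by omega) (by omega)]
        refine ⟨fun h => ⟨hc, by omega, h.2⟩, fun h => ⟨by omega, h.2.2⟩⟩
      · constructor
        · intro h; omega
        · intro h; exact absurd h.1 hc) (fun j hj => by rw [e66])
  constructor
  · intro j hj hs
    rcases (mem_interval_iff (by omega) i).1 hs with h | h
    · exact (min_le_left _ _).trans (L.1 j hj ⟨by omega, h⟩)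
    · exact (min_le_right _ _).trans (R.1 j hj ⟨by omega, h⟩)
  · rcases min_choice (σ4.wt 7 i) (σ7.wt 7 (2 ^ K - 1 - i)) with e | e
    · rw [e]
      refine L.2.imp id ?_
      rintro ⟨j, hj, hs, e'⟩
      exact ⟨j, hj, (mem_interval_iff hs.1 i).2 (.inl hs.2), e'⟩
    · rw [e]
      refine R.2.imp id ?_
      rintro ⟨j, hj, hs, e'⟩
      exact ⟨j, hj, (mem_interval_iff hs.1 i).2 (.inr hs.2), e'⟩

/-! ### Weights of walks and distances -/

section Walks

variable {V : Type*} {G : SimpleGraph V} {w : Sym2 V → ℝ≥0} {a b c : V}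

@[simp]
theorem walkWeight_nil : walkWeight w (SimpleGraph.Walk.nil : G.Walk a a) = 0 := by
  simp [walkWeight]

@[simp]
theorem walkWeight_cons (h : G.Adj a b) (p : G.Walk b c) :
    walkWeight w (.cons h p) = w s(a, b) + walkWeight w p := by
  simp [walkWeight]

@[simp]
theorem walkWeight_append (p : G.Walk a b) (q : G.Walk b c) :
    walkWeight w (p.append q) = walkWeight w p + walkWeight w q := by
  simp [walkWeight]

@[simp]
theorem walkWeight_reverse (p : G.Walk a b) : walkWeight w p.reverse = walkWeight w p := by
  simp [walkWeight]

theorem wdist_le (p : G.Walk a b) : wdist G w a b ≤ walkWeight w p := by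
  classical
  refine (iInf_le _ p.toPath).trans ?_
  rw [ENNReal.coe_le_coe]
  exact (p.edges_bypass_sublist_edges.map w).sum_le_sum fun _ _ => zero_le

theorem le_wdist {x : ℝ≥0∞} (h : ∀ p : G.Walk a b, x ≤ walkWeight w p) : x ≤ wdist G w a b :=
  le_iInf fun p => h p.1

theorem exists_walkWeight_eq_wdist [Finite V] (h : wdist G w a b ≠ ⊤) :
    ∃ p : G.Walk a b, (walkWeight w p : ℝ≥0∞) = wdist G w a b := by
  classical
  have := Fintype.ofFinite V
  have : Nonempty (G.Path a b) := by
    by_contra hne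
    rw [not_nonempty_iff] at hne
    exact h (by simp [wdist])
  obtain ⟨p, hp⟩ := exists_eq_ciInf_of_finite (f := fun p : G.Path a b =>
    (walkWeight w p.1 : ℝ≥0∞))
  exact ⟨p.1, hp⟩

theorem wdist_self : wdist G w a a = 0 :=
  le_antisymm (by simpa using wdist_le (w := w) (SimpleGraph.Walk.nil : G.Walk a a)) zero_le

theorem wdist_le_add [Finite V] (q : G.Walk b c) :
    wdist G w a c ≤ wdist G w a b + walkWeight w q := by
  by_cases h : wdist G w a b = ⊤
  · simp [h]
  · obtain ⟨p, hp⟩ := exists_walkWeight_eq_wdist h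
    rw [← hp]
    simpa using wdist_le (w := w) (p.append q)

theorem wdist_le_add_adj [Finite V] (h : G.Adj b c) :
    wdist G w a c ≤ wdist G w a b + w s(b, c) := by
  simpa using wdist_le_add (w := w) (a := a) (h.toWalk)

theorem wdist_deleteEdge_le_of_walk {e : Sym2 V} (p : G.Walk a b) (he : e ∉ p.edges) :
    wdist (deleteEdge G e) w a b ≤ walkWeight w p := by
  have : walkWeight w (p.toDeleteEdge e he) = walkWeight w p := by
    simp [walkWeight, SimpleGraph.Walk.toDeleteEdge]
  rw [← this]
  exact wdist_le _

theorem exists_walk_of_deleteEdge {e : Sym2 V} (p : (deleteEdge G e).Walk a b) :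
    ∃ q : G.Walk a b, e ∉ q.edges ∧ walkWeight w q = walkWeight w p := by
  induction p with
  | nil => exact ⟨.nil, by simp, by simp⟩
  | @cons x y z h p ih =>
    obtain ⟨q, hq, hw⟩ := ih
    obtain ⟨h1, h2⟩ := (SimpleGraph.deleteEdges_adj).1 h
    refine ⟨.cons h1 q, ?_, by simp [hw]⟩
    simp only [SimpleGraph.Walk.edges_cons, List.mem_cons, not_or]
    exact ⟨fun e' => h2 (by simp [e']), hq⟩

theorem wdist_deleteNode_le_of_walk {v : V} (p : G.Walk a b) (hp : ∀ z ∈ p.support, z ≠ v)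
    (ha : a ≠ v) (hb : b ≠ v) :
    wdist (deleteNode G v) (deleteNodeWeight w v) ⟨a, ha⟩ ⟨b, hb⟩ ≤ walkWeight w p := by
  suffices H : ∃ q : (deleteNode G v).Walk ⟨a, ha⟩ ⟨b, hb⟩,
      walkWeight (deleteNodeWeight w v) q = walkWeight w p by
    obtain ⟨q, hq⟩ := H
    rw [← hq]
    exact wdist_le q
  induction p with
  | nil => exact ⟨.nil, by simp⟩
  | @cons x y z h p ih =>
    have hy : y ≠ v := hp y (by simp)
    obtain ⟨q, hq⟩ := ih (fun z hz => hp z (by simp [hz])) hy hb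
    have h' : (deleteNode G v).Adj ⟨x, ha⟩ ⟨y, hy⟩ := h
    exact ⟨.cons h' q, by simp [hq, deleteNodeWeight]⟩

theorem exists_walk_of_deleteNode {v : V} {a b : {x : V // x ≠ v}}
    (p : (deleteNode G v).Walk a b) :
    ∃ q : G.Walk a.1 b.1, v ∉ q.support ∧
      walkWeight w q = walkWeight (deleteNodeWeight w v) p := by
  induction p with
  | @nil x => exact ⟨.nil, by simpa using x.2.symm, by simp⟩
  | @cons x y z h p ih =>
    obtain ⟨q, hq, hw⟩ := ih
    have h' : G.Adj x.1 y.1 := h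
    refine ⟨.cons h' q, ?_, by simp [hw, deleteNodeWeight]⟩
    simp only [SimpleGraph.Walk.support_cons, List.mem_cons, not_or]
    exact ⟨x.2.symm, hq⟩

end Walks

/-! ### Levels -/

namespace RPInstance

variable {n m : ℕ} (I : RPInstance n m)

/-- `d_G(r,v)`. -/
noncomputable abbrev dr (v : Fin n) : ℝ≥0∞ := wdist I.graph I.weight I.r v

/-- `d_G(v,s)`. -/
noncomputable abbrev ds (v : Fin n) : ℝ≥0∞ := wdist I.graph I.weight v I.s

/-- The node `x` hangs at the `i`-th node of `P`: a shortest path from `r` to `x` follows `P`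
up to this node and does not meet `P` afterwards. -/
def Hangs (i : ℕ) (x : Fin n) : Prop :=
  ∃ q : I.graph.Walk (I.P.getVert i) x,
    ((walkWeight I.weight (I.P.take i) + walkWeight I.weight q : ℝ≥0) : ℝ≥0∞) ≤ I.dr x ∧
    ∀ z ∈ q.support, z ∈ I.P.support → z = I.P.getVert i

/-- A function that assigns to each node `x` that is reachable from `r` the position of a node of
`P` at which `x` hangs; the other nodes have level `0`. -/
structure IsLevel (lev : Fin n → ℕ) : Prop where
  le : ∀ x, lev x ≤ I.P.length
  getVert : ∀ i ≤ I.P.length, lev (I.P.getVert i) = i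
  hangs : ∀ x, I.dr x ≠ ⊤ → I.Hangs (lev x) x
  reachable : ∀ x, lev x ≠ 0 → I.dr x ≠ ⊤

variable {I}

theorem getVert_injOn {i j : ℕ} (hi : i ≤ I.P.length) (hj : j ≤ I.P.length)
    (h : I.P.getVert i = I.P.getVert j) : i = j :=
  I.P_isPath.getVert_injOn hi hj h

theorem getVert_mem (i : ℕ) : I.P.getVert i ∈ I.P.support := I.P.getVert_mem_support i

theorem weight_take_add_drop (i : ℕ) : walkWeight I.weight (I.P.take i) +
    walkWeight I.weight (I.P.drop i) = walkWeight I.weight I.P := by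
  rw [← walkWeight_append, SimpleGraph.Walk.append_take_drop_eq]

theorem weight_le_of_walk (q : I.graph.Walk I.r I.s) :
    walkWeight I.weight I.P ≤ walkWeight I.weight q := by
  have := wdist_le (w := I.weight) q
  rw [← I.P_shortest] at this
  exact_mod_cast this

/-- The prefixes of `P` are shortest paths. -/
theorem dr_getVert (i : ℕ) : I.dr (I.P.getVert i) = walkWeight I.weight (I.P.take i) := by
  refine le_antisymm (wdist_le _) (le_wdist fun q => ?_)
  have h := weight_le_of_walk (q.append (I.P.drop i))
  rw [← weight_take_add_drop i, walkWeight_append] at h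
  exact_mod_cast le_of_add_le_add_right h

theorem weight_take_mono {i j : ℕ} (h : i ≤ j) :
    walkWeight I.weight (I.P.take i) ≤ walkWeight I.weight (I.P.take j) := by
  simp only [walkWeight, SimpleGraph.Walk.edges_take]
  exact (((List.take_prefix_take_left h).sublist).map _).sum_le_sum fun _ _ => zero_le

/-- A walk from the `k`-th node of `P` to `s` is not shorter than the rest of `P`. -/
theorem weight_drop_le (k : ℕ) (q : I.graph.Walk (I.P.getVert k) I.s) :
    walkWeight I.weight (I.P.drop k) ≤ walkWeight I.weight q := by
  have h := weight_le_of_walk ((I.P.take k).append q)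
  rw [← weight_take_add_drop k, walkWeight_append] at h
  exact le_of_add_le_add_left h

theorem notMem_take {l k : ℕ} (hk : k ≤ I.P.length) (hl : l < k) :
    I.P.getVert k ∉ (I.P.take l).support := by
  intro h
  obtain ⟨j, hj, -⟩ := SimpleGraph.Walk.mem_support_iff_exists_getVert.1 h
  rw [SimpleGraph.Walk.take_getVert] at hj
  have := getVert_injOn (by omega) hk hj
  omega

theorem notMem_drop {l k : ℕ} (hl : l ≤ I.P.length) (hk : k < l) :
    I.P.getVert k ∉ (I.P.drop l).support := by
  intro h
  obtain ⟨j, hj, hj'⟩ := SimpleGraph.Walk.mem_support_iff_exists_getVert.1 h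
  rw [SimpleGraph.Walk.drop_getVert] at hj
  rw [SimpleGraph.Walk.drop_length] at hj'
  have := getVert_injOn (by omega) (by omega) hj
  omega

theorem dr_ne_top_of_adj {x y : Fin n} (hx : I.dr x ≠ ⊤) (h : I.graph.Adj x y) : I.dr y ≠ ⊤ := by
  refine ne_top_of_le_ne_top ?_ (wdist_le_add_adj h)
  simp [hx]

namespace IsLevel

variable {lev : Fin n → ℕ} (hl : I.IsLevel lev)
include hl

theorem lev_r : lev I.r = 0 := by simpa using hl.getVert 0 (by omega)

theorem lev_s : lev I.s = I.P.length := by simpa using hl.getVert I.P.length le_rfl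

theorem mem_support_iff (x : Fin n) : x ∈ I.P.support ↔ I.P.getVert (lev x) = x := by
  constructor
  · intro h
    obtain ⟨j, rfl, hj'⟩ := SimpleGraph.Walk.mem_support_iff_exists_getVert.1 h
    rw [hl.getVert j hj']
  · intro h
    rw [← h]
    exact getVert_mem _

/-- A shortest path from `r` to `x` that avoids the part of `P` beyond the level of `x`. -/
theorem exists_walk_from_r {x : Fin n} (hx : I.dr x ≠ ⊤) :
    ∃ q : I.graph.Walk I.r x, (walkWeight I.weight q : ℝ≥0∞) ≤ I.dr x ∧
      ∀ k ≤ I.P.length, lev x < k → I.P.getVert k ∉ q.support := by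
  obtain ⟨q, hq, hP⟩ := hl.hangs x hx
  refine ⟨(I.P.take (lev x)).append q, by simpa using hq, fun k hk hlk hmem => ?_⟩
  rcases (SimpleGraph.Walk.mem_support_append_iff _ _).1 hmem with h | h
  · exact notMem_take hk hlk h
  · have := getVert_injOn hk (hl.le x) (hP _ h (getVert_mem k))
    omega

/-- A walk from `y` to `s` that avoids the part of `P` before the level of `y`, and that is at least
as short as any walk from `y` to `s` through this part. -/
theorem exists_walk_to_s {y : Fin n} (hy : I.dr y ≠ ⊤) :
    ∃ B : I.graph.Walk y I.s, (∀ k < lev y, I.P.getVert k ∉ B.support) ∧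
      ∀ k < lev y, ∀ Q : I.graph.Walk y I.s, I.P.getVert k ∈ Q.support →
        walkWeight I.weight B ≤ walkWeight I.weight Q := by
  obtain ⟨q, hq, hP⟩ := hl.hangs y hy
  have hly := hl.le y
  refine ⟨q.reverse.append (I.P.drop (lev y)), fun k hk hmem => ?_, fun k hk Q hQ => ?_⟩
  · rcases (SimpleGraph.Walk.mem_support_append_iff _ _).1 hmem with h | h
    · have := getVert_injOn (by omega) hly (hP _ (by simpa using h) (getVert_mem k))
      omega
    · exact notMem_drop hly hk h
  · have e : walkWeight I.weight Q = walkWeight I.weight (Q.takeUntil _ hQ) +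
        walkWeight I.weight (Q.dropUntil _ hQ) := by
      rw [← walkWeight_append, SimpleGraph.Walk.take_spec]
    have h1 := weight_drop_le k (Q.dropUntil _ hQ)
    have h2 := hq.trans (wdist_le ((I.P.take k).append (Q.takeUntil _ hQ).reverse))
    rw [ENNReal.coe_le_coe, walkWeight_append, walkWeight_reverse] at h2
    have h3 := weight_take_mono (I := I) hk.le
    have h4 := weight_take_add_drop (I := I) k
    have h5 := weight_take_add_drop (I := I) (lev y)
    rw [e, walkWeight_append, walkWeight_reverse]
    rw [← NNReal.coe_le_coe] at *
    rw [← NNReal.coe_inj] at h4 h5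
    push_cast at *
    linarith

/-- Any walk to `s` can be replaced by one that is not heavier and avoids an edge of `P` before the
level of the start node. -/
theorem exists_walk_avoiding_edge {y : Fin n} (hy : I.dr y ≠ ⊤) {i : ℕ} (hi : i < lev y)
    (Q : I.graph.Walk y I.s) : ∃ B : I.graph.Walk y I.s,
      s(I.P.getVert i, I.P.getVert (i + 1)) ∉ B.edges ∧
        walkWeight I.weight B ≤ walkWeight I.weight Q := by
  obtain ⟨B, h1, h2⟩ := hl.exists_walk_to_s hy
  by_cases hQ : s(I.P.getVert i, I.P.getVert (i + 1)) ∈ Q.edges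
  · exact ⟨B, fun h => h1 i hi (B.fst_mem_support_of_mem_edges h),
      h2 i hi Q (Q.fst_mem_support_of_mem_edges hQ)⟩
  · exact ⟨Q, hQ, le_rfl⟩

/-- Any walk to `s` can be replaced by one that is not heavier and avoids a node of `P` before the
level of the start node. -/
theorem exists_walk_avoiding_node {y : Fin n} (hy : I.dr y ≠ ⊤) {i : ℕ} (hi : i < lev y)
    (Q : I.graph.Walk y I.s) : ∃ B : I.graph.Walk y I.s,
      I.P.getVert i ∉ B.support ∧ walkWeight I.weight B ≤ walkWeight I.weight Q := by
  obtain ⟨B, h1, h2⟩ := hl.exists_walk_to_s hy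
  by_cases hQ : I.P.getVert i ∈ Q.support
  · exact ⟨B, h1 i hi, h2 i hi Q hQ⟩
  · exact ⟨Q, hQ, le_rfl⟩

/-! ### The edge-avoiding version -/

/-- A shortest path to `x` does not pass the `i`-th edge of `P`, as `lev x ≤ i`, and the rest of the
walk can be made to avoid it, as `i < lev y`. -/
theorem wdist_deleteEdge_le {i : ℕ} (hi : i < I.P.length) {x y : Fin n} (h : I.graph.Adj x y)
    (hne : s(x, y) ≠ s(I.P.getVert i, I.P.getVert (i + 1))) (hx : lev x ≤ i) (hy : i < lev y) :
    wdist (deleteEdge I.graph s(I.P.getVert i, I.P.getVert (i + 1))) I.weight I.r I.s ≤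
      I.dr x + I.weight s(x, y) + I.ds y := by
  by_cases hfin : I.dr x = ⊤
  · simp [hfin]
  have hfin' := dr_ne_top_of_adj hfin h
  obtain ⟨A, hA, hA'⟩ := hl.exists_walk_from_r hfin
  by_cases hds : I.ds y = ⊤
  · simp [hds]
  obtain ⟨Q, hQ⟩ := exists_walkWeight_eq_wdist hds
  obtain ⟨B, hB, hB'⟩ := hl.exists_walk_avoiding_edge hfin' hy Q
  refine (wdist_deleteEdge_le_of_walk ((A.append h.toWalk).append B) ?_).trans ?_
  · simp only [SimpleGraph.Walk.edges_append, List.mem_append, not_or]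
    refine ⟨⟨fun hc => hA' (i + 1) hi (by omega) (A.snd_mem_support_of_mem_edges hc), ?_⟩, hB⟩
    simpa using hne.symm
  · simp only [walkWeight_append, SimpleGraph.Adj.toWalk, walkWeight_cons, walkWeight_nil, add_zero]
    push_cast
    gcongr
    refine le_trans ?_ hQ.le
    exact_mod_cast hB'

/-- A walk from a level `≤ i` to `s` has an edge from a level `≤ i` to a level `> i`. -/
theorem exists_crossing_edge {i : ℕ} (hi : i < I.P.length) {a b : Fin n}
    (hs : b = I.s) (q : I.graph.Walk a b)
    (hq : s(I.P.getVert i, I.P.getVert (i + 1)) ∉ q.edges) (c : ℝ≥0∞) (ha : lev a ≤ i) (hc : I.dr a ≤ c) :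
    ∃ x y, I.graph.Adj x y ∧ s(x, y) ≠ s(I.P.getVert i, I.P.getVert (i + 1)) ∧ lev x ≤ i ∧
      i < lev y ∧ I.dr x + I.weight s(x, y) + I.ds y ≤ c + walkWeight I.weight q := by
  induction q generalizing c with
  | nil => subst hs; rw [hl.lev_s] at ha; omega
  | @cons a y b h q ih =>
    subst hs
    simp only [SimpleGraph.Walk.edges_cons, List.mem_cons, not_or] at hq
    by_cases hy : lev y ≤ i
    · obtain ⟨x', y', h1, h2, h3, h4, h5⟩ := ih rfl hq.2 (c + I.weight s(a, y)) hy
        ((wdist_le_add_adj h).trans (by gcongr))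
      exact ⟨x', y', h1, h2, h3, h4, h5.trans (by simp [add_assoc])⟩
    · refine ⟨a, y, h, fun e => hq.1 e.symm, ha, by omega, ?_⟩
      rw [walkWeight_cons]
      push_cast
      rw [← add_assoc]
      gcongr
      exact wdist_le q

/-- The replacement distance for the `i`-th edge of `P` is the minimum over all edges that lead
from a level `≤ i` to a level `> i`. -/
theorem eq_wdist_deleteEdge {i : ℕ} (hi : i < I.P.length) {X : ℝ≥0∞}
    (hle : ∀ x y, I.graph.Adj x y → s(x, y) ≠ s(I.P.getVert i, I.P.getVert (i + 1)) →
      lev x ≤ i → i < lev y → X ≤ I.dr x + I.weight s(x, y) + I.ds y)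
    (heq : X = ⊤ ∨ ∃ x y, I.graph.Adj x y ∧ s(x, y) ≠ s(I.P.getVert i, I.P.getVert (i + 1)) ∧
      lev x ≤ i ∧ i < lev y ∧ X = I.dr x + I.weight s(x, y) + I.ds y) :
    X = wdist (deleteEdge I.graph s(I.P.getVert i, I.P.getVert (i + 1))) I.weight I.r I.s := by
  apply le_antisymm
  · refine le_wdist fun p => ?_
    obtain ⟨q, hq, hw⟩ := exists_walk_of_deleteEdge (w := I.weight) p
    obtain ⟨x, y, h1, h2, h3, h4, h5⟩ := hl.exists_crossing_edge hi rfl q hq 0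
      (by rw [hl.lev_r]; omega) (by simp [dr, wdist_self])
    rw [← hw]
    simpa using (hle x y h1 h2 h3 h4).trans h5
  · rcases heq with rfl | ⟨x, y, h1, h2, h3, h4, rfl⟩
    · exact le_top
    · exact hl.wdist_deleteEdge_le hi h1 h2 h3 h4

/-! ### The node-avoiding version -/

/-- A walk to `x` that avoids the `i`-th node of `P` continues through the edge `xy` and then along
a walk that can be made to avoid this node, as `i < lev y`. -/
theorem wdist_deleteNode_le {i : ℕ} {x y : Fin n} (h : I.graph.Adj x y) {c : ℝ≥0∞}
    (hc : c ≠ ⊤ → ∃ A : I.graph.Walk I.r x, (walkWeight I.weight A : ℝ≥0∞) ≤ c ∧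
      I.P.getVert i ∉ A.support)
    (hy : i < lev y) (hr : I.r ≠ I.P.getVert i) (hs : I.s ≠ I.P.getVert i) :
    wdist (deleteNode I.graph (I.P.getVert i)) (deleteNodeWeight I.weight (I.P.getVert i))
      ⟨I.r, hr⟩ ⟨I.s, hs⟩ ≤ c + I.weight s(x, y) + I.ds y := by
  by_cases hfin : c = ⊤
  · simp [hfin]
  obtain ⟨A, hA, hA'⟩ := hc hfin
  by_cases hds : I.ds y = ⊤
  · simp [hds]
  obtain ⟨Q, hQ⟩ := exists_walkWeight_eq_wdist hds
  obtain ⟨B, hB, hB'⟩ := hl.exists_walk_avoiding_node (hl.reachable y (by omega)) hy Q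
  refine (wdist_deleteNode_le_of_walk ((A.append h.toWalk).append B) ?_ hr hs).trans ?_
  · intro z hz hzi
    subst hzi
    simp only [SimpleGraph.Walk.mem_support_append_iff, SimpleGraph.Adj.toWalk,
      SimpleGraph.Walk.support_cons, SimpleGraph.Walk.support_nil, List.mem_cons,
      List.not_mem_nil, or_false] at hz
    rcases hz with (hz | hz | hz) | hz
    · exact hA' hz
    · rw [hz] at hA'; exact hA' A.end_mem_support
    · rw [hz] at hB; exact hB B.start_mem_support
    · exact hB hz
  · simp only [walkWeight_append, SimpleGraph.Adj.toWalk, walkWeight_cons, walkWeight_nil, add_zero]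
    push_cast
    gcongr
    refine le_trans ?_ hQ.le
    exact_mod_cast hB'

end IsLevel

/-- The properties of the distances `d₀` in the query graph, for the nodes `z` off `P`: `d₀ z` is at
most the weight of a walk that follows a shortest path to an edge from a lower level to the level of
`z`, and then stays within the nodes of this level off `P`; and there is a walk to `z` of weight at
most `d₀ z` that avoids the node of `P` at the level of `z`. -/
structure IsQueryDist (I : RPInstance n m) (lev : Fin n → ℕ) (d₀ : Fin n → ℝ≥0∞) : Prop where
  attach : ∀ x z, I.graph.Adj x z → lev x < lev z → z ∉ I.P.support →
    d₀ z ≤ I.dr x + I.weight s(x, z)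
  inner : ∀ z z', I.graph.Adj z z' → lev z = lev z' → z ∉ I.P.support → z' ∉ I.P.support →
    d₀ z' ≤ d₀ z + I.weight s(z, z')
  sound : ∀ z, z ∉ I.P.support → d₀ z ≠ ⊤ → ∃ A : I.graph.Walk I.r z,
    (walkWeight I.weight A : ℝ≥0∞) ≤ d₀ z ∧ I.P.getVert (lev z) ∉ A.support

namespace IsLevel

variable {lev : Fin n → ℕ} (hl : I.IsLevel lev)
include hl

/-- A walk to `s` that avoids the `i`-th node of `P` and starts below the level `i`, or at this
level with the weight `c` spent so far being at least `d₀`, enters the levels `> i` directly from a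
lower level or from a node of level `i` off `P`. -/
theorem exists_crossing_node {d₀ : Fin n → ℝ≥0∞} (hd : IsQueryDist I lev d₀) {i : ℕ}
    (hi : i < I.P.length) {a b : Fin n}
    (hs : b = I.s) (q : I.graph.Walk a b) (hq : I.P.getVert i ∉ q.support) (c : ℝ≥0∞)
    (hc : I.dr a ≤ c) (ha : lev a < i ∨ (lev a = i ∧ d₀ a ≤ c)) :
    (∃ x y, I.graph.Adj x y ∧ lev x < i ∧ i < lev y ∧
      I.dr x + I.weight s(x, y) + I.ds y ≤ c + walkWeight I.weight q) ∨
    ∃ x y, I.graph.Adj x y ∧ x ∉ I.P.support ∧ lev x = i ∧ i < lev y ∧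
      d₀ x + I.weight s(x, y) + I.ds y ≤ c + walkWeight I.weight q := by
  induction q generalizing c with
  | nil => subst hs; rw [hl.lev_s] at ha; omega
  | @cons a y b h q ih =>
    subst hs
    simp only [SimpleGraph.Walk.support_cons, List.mem_cons, not_or] at hq
    have hoff : ∀ z, lev z = i → z ≠ I.P.getVert i → z ∉ I.P.support := by
      intro z hz hz' hmem
      rw [hl.mem_support_iff, hz] at hmem
      exact hz' hmem.symm
    have hyi : y ≠ I.P.getVert i := by
      intro e
      rw [← e] at hq
      exact hq.2 q.start_mem_support
    have hcy : I.dr y ≤ c + I.weight s(a, y) := (wdist_le_add_adj h).trans (by gcongr)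
    by_cases hy : i < lev y
    · rcases ha with ha | ⟨ha, hda⟩
      · refine .inl ⟨a, y, h, ha, hy, ?_⟩
        rw [walkWeight_cons]
        push_cast
        rw [← add_assoc]
        gcongr
        exact wdist_le q
      · refine .inr ⟨a, y, h, hoff a ha (Ne.symm hq.1), ha, hy, ?_⟩
        rw [walkWeight_cons]
        push_cast
        rw [← add_assoc]
        gcongr
        exact wdist_le q
    · have := ih rfl hq.2 (c + I.weight s(a, y)) hcy (by
        rcases (not_lt.1 hy).lt_or_eq with hy | hy
        · exact .inl hy
        · refine .inr ⟨hy, ?_⟩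
          rcases ha with ha | ⟨ha, hda⟩
          · exact (hd.attach a y h (by omega) (hoff y hy hyi)).trans (by gcongr)
          · exact (hd.inner a y h (by omega) (hoff a ha (Ne.symm hq.1)) (hoff y hy hyi)).trans
              (by gcongr))
      simpa [add_assoc] using this

/-- The replacement distance for the `i`-th node of `P` is the minimum over all edges from a
level `< i` to a level `> i`, and over all edges from a node off `P` of level `i` to a level
`> i`. -/
theorem eq_wdist_deleteNode {d₀ : Fin n → ℝ≥0∞} (hd : IsQueryDist I lev d₀) {i : ℕ}
    (hi : i < I.P.length) (hr : I.r ≠ I.P.getVert i) (hs : I.s ≠ I.P.getVert i) {X : ℝ≥0∞}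
    (hle : ∀ x y, I.graph.Adj x y → lev x < i → i < lev y →
      X ≤ I.dr x + I.weight s(x, y) + I.ds y)
    (hle' : ∀ x y, I.graph.Adj x y → x ∉ I.P.support → lev x = i → i < lev y →
      X ≤ d₀ x + I.weight s(x, y) + I.ds y)
    (heq : X = ⊤ ∨ (∃ x y, I.graph.Adj x y ∧ lev x < i ∧ i < lev y ∧
        X = I.dr x + I.weight s(x, y) + I.ds y) ∨
      ∃ x y, I.graph.Adj x y ∧ x ∉ I.P.support ∧ lev x = i ∧ i < lev y ∧
        X = d₀ x + I.weight s(x, y) + I.ds y) :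
    X = wdist (deleteNode I.graph (I.P.getVert i)) (deleteNodeWeight I.weight (I.P.getVert i))
      ⟨I.r, hr⟩ ⟨I.s, hs⟩ := by
  apply le_antisymm
  · refine le_wdist fun p => ?_
    obtain ⟨q, hq, hw⟩ := exists_walk_of_deleteNode (w := I.weight) p
    have hi0 : 0 < i := by
      rcases Nat.eq_zero_or_pos i with rfl | h
      · simp at hr
      · exact h
    rw [← hw]
    rcases hl.exists_crossing_node hd hi rfl q hq 0 (by simp [dr, wdist_self])
      (by rw [hl.lev_r]; exact .inl hi0) with ⟨x, y, h1, h2, h3, h4⟩ | ⟨x, y, h1, h2, h3, h4, h5⟩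
    · simpa using (hle x y h1 h2 h3).trans h4
    · simpa using (hle' x y h1 h2 h3 h4).trans h5
  · rcases heq with rfl | ⟨x, y, h1, h2, h3, rfl⟩ | ⟨x, y, h1, h2, h3, h4, rfl⟩
    · exact le_top
    · refine hl.wdist_deleteNode_le h1 (fun hfin => ?_) h3 hr hs
      obtain ⟨A, hA, hA'⟩ := hl.exists_walk_from_r hfin
      exact ⟨A, hA, hA' i hi.le h2⟩
    · refine hl.wdist_deleteNode_le h1 (fun hfin => ?_) h4 hr hs
      subst h3
      exact hd.sound x h2 hfin

/-- The query graph, on the nodes of `G`, with the source `r`: it consists of the edges of `G`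
between nodes off `P` of equal level, and of an edge from `r` to each node `z` off `P` that has an
edge from a lower level. -/
theorem isQueryDist {l : ℕ} (D : ListedGraph n l)
    (hsound : ∀ a b, D.graph.Adj a b →
      (a ∉ I.P.support ∧ b ∉ I.P.support ∧ I.graph.Adj a b ∧ lev a = lev b ∧
        D.weight s(a, b) = I.weight s(a, b)) ∨
      ∃ z, z ∉ I.P.support ∧ s(a, b) = s(I.r, z) ∧ ∃ x, I.graph.Adj x z ∧ lev x < lev z ∧
        (D.weight s(I.r, z) : ℝ≥0∞) = I.dr x + I.weight s(x, z))
    (hinner : ∀ a b, I.graph.Adj a b → lev a = lev b → a ∉ I.P.support → b ∉ I.P.support →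
      D.graph.Adj a b ∧ D.weight s(a, b) = I.weight s(a, b))
    (hattach : ∀ x z, I.graph.Adj x z → lev x < lev z → z ∉ I.P.support →
      D.graph.Adj I.r z ∧ (D.weight s(I.r, z) : ℝ≥0∞) ≤ I.dr x + I.weight s(x, z)) :
    IsQueryDist I lev (wdist D.graph D.weight I.r) where
  attach x z h hlt hz := by
    obtain ⟨h1, h2⟩ := hattach x z h hlt hz
    refine (wdist_le_add_adj h1).trans ?_
    simpa [wdist_self] using h2
  inner z z' h he hz hz' := by
    obtain ⟨h1, h2⟩ := hinner z z' h he hz hz'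
    rw [← h2]
    exact wdist_le_add_adj h1
  sound z hz hfin := by
    have hrP : I.r ∈ I.P.support := I.P.start_mem_support
    -- An edge of the query graph at `r` stands for a walk in `G` of at most the same weight.
    have hat : ∀ z, z ∉ I.P.support → (∃ x, I.graph.Adj x z ∧ lev x < lev z ∧
        (D.weight s(I.r, z) : ℝ≥0∞) = I.dr x + I.weight s(x, z)) →
        ∃ A : I.graph.Walk I.r z, walkWeight I.weight A ≤ D.weight s(I.r, z) ∧
          I.P.getVert (lev z) ∉ A.support := by
      rintro z hz ⟨x, h, hlt, hw⟩
      have hx : I.dr x ≠ ⊤ := by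
        intro e
        rw [e, top_add] at hw
        exact ENNReal.coe_ne_top hw
      obtain ⟨A, hA, hA'⟩ := hl.exists_walk_from_r hx
      refine ⟨A.append h.toWalk, ?_, ?_⟩
      · have : ((walkWeight I.weight A + I.weight s(x, z) : ℝ≥0) : ℝ≥0∞) ≤
            D.weight s(I.r, z) := by
          rw [hw]; push_cast; gcongr
        simpa [SimpleGraph.Adj.toWalk] using ENNReal.coe_le_coe.1 this
      · have h1 := hA' _ (hl.le z) hlt
        intro hmem
        simp only [SimpleGraph.Walk.mem_support_append_iff, SimpleGraph.Adj.toWalk,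
          SimpleGraph.Walk.support_cons, SimpleGraph.Walk.support_nil, List.mem_cons,
          List.not_mem_nil, or_false] at hmem
        rcases hmem with hm | hm | hm
        · exact h1 hm
        · rw [hm] at h1; exact h1 A.end_mem_support
        · exact hz ((hl.mem_support_iff z).2 hm)
    obtain ⟨p, hp⟩ := exists_walkWeight_eq_wdist hfin
    rw [← hp]
    -- The walks are followed from `r` only as far as their last visit to `r`: the suffix after it
    -- consists of one edge at `r` and of edges within one level.
    have key : ∀ (a b : Fin n) (q : D.graph.Walk a b), b = I.r → a ∉ I.P.support →
        ∃ A : I.graph.Walk I.r a, walkWeight I.weight A ≤ walkWeight D.weight q ∧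
          I.P.getVert (lev a) ∉ A.support := by
      intro a b q hr
      induction q with
      | nil => intro h; rw [hr] at h; exact absurd hrP h
      | @cons a y b h q ih =>
        subst hr
        intro ha
        rcases hsound a y h with ⟨h1, h2, h3, h4, h5⟩ | ⟨z, hz, he, hx⟩
        · obtain ⟨A, hA, hA'⟩ := ih rfl h2
          refine ⟨A.append h3.symm.toWalk, ?_, ?_⟩
          · simp only [walkWeight_append, SimpleGraph.Adj.toWalk, walkWeight_cons, walkWeight_nil,
              add_zero, h5]
            rw [add_comm, Sym2.eq_swap]
            gcongr
          · intro hmem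
            simp only [SimpleGraph.Walk.mem_support_append_iff, SimpleGraph.Adj.toWalk,
              SimpleGraph.Walk.support_cons, SimpleGraph.Walk.support_nil, List.mem_cons,
              List.not_mem_nil, or_false] at hmem
            rw [h4] at hmem
            rcases hmem with hm | hm | hm
            · exact hA' hm
            · exact h2 ((hl.mem_support_iff y).2 hm)
            · exact ha ((hl.mem_support_iff a).2 (by rw [h4]; exact hm))
        · have haz : a = z ∧ y = I.r := by
            rcases Sym2.eq_iff.1 he with ⟨rfl, rfl⟩ | ⟨rfl, rfl⟩
            · exact absurd hrP ha
            · exact ⟨rfl, rfl⟩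
          obtain ⟨rfl, rfl⟩ := haz
          obtain ⟨A, hA, hA'⟩ := hat a ha hx
          refine ⟨A, hA.trans ?_, hA'⟩
          rw [walkWeight_cons, Sym2.eq_swap]
          exact le_self_add
    obtain ⟨A, hA, hA'⟩ := key z _ p.reverse rfl hz
    exact ⟨A, by simpa using hA, hA'⟩

end IsLevel
end RPInstance

/-! ### Computing the levels -/

section

namespace RPInstance

variable {n m : ℕ} {I : RPInstance n m}

/-- The level passes on along an edge `uv` that extends a shortest path, if `v` is not on `P`. -/
theorem Hangs.step {l : ℕ} {u v : Fin n} (h : I.Hangs l u) (hadj : I.graph.Adj u v)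
    (ht : I.dr u + I.weight s(u, v) ≤ I.dr v) (hv : v ∉ I.P.support) : I.Hangs l v := by
  obtain ⟨q, hq, hP⟩ := h
  refine ⟨q.append hadj.toWalk, le_trans ?_ ht, fun z hz hzP => ?_⟩
  · rw [walkWeight_append, ← add_assoc, ENNReal.coe_add]
    simp only [SimpleGraph.Adj.toWalk, walkWeight_cons, walkWeight_nil, add_zero]
    gcongr
  · simp only [SimpleGraph.Walk.mem_support_append_iff, SimpleGraph.Adj.toWalk,
      SimpleGraph.Walk.support_cons, SimpleGraph.Walk.support_nil, List.mem_cons,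
      List.not_mem_nil, or_false] at hz
    rcases hz with hz | rfl | rfl
    · exact hP z hz hzP
    · exact hP _ q.end_mem_support hzP
    · exact absurd hzP hv

theorem hangs_getVert (i : ℕ) : I.Hangs i (I.P.getVert i) :=
  ⟨.nil, by simp [dr_getVert], by simp⟩

theorem dr_getVert_ne_top (i : ℕ) : I.dr (I.P.getVert i) ≠ ⊤ := by
  rw [dr_getVert]; exact ENNReal.coe_ne_top

/-- A set of nodes that contains `r` and is closed under the edges that extend shortest paths
contains all nodes that are reachable from `r`. -/
theorem mem_of_closed {F : Fin n → Prop} (hr : F I.r)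
    (hF : ∀ u v, F u → I.graph.Adj u v → I.dr u + I.weight s(u, v) ≤ I.dr v → F v)
    {x : Fin n} (hx : I.dr x ≠ ⊤) : F x := by
  have key : ∀ (a b : Fin n) (q : I.graph.Walk a b), F a →
      I.dr a + walkWeight I.weight q ≤ I.dr b → I.dr b ≠ ⊤ → F b := by
    intro a b q
    induction q with
    | nil => intro h _ _; exact h
    | @cons a y b h q ih =>
      intro ha hle hb
      rw [walkWeight_cons, ENNReal.coe_add, ← add_assoc] at hle
      refine ih (hF a y ha h ?_) ((add_le_add_left (wdist_le_add_adj h) _).trans hle) hb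
      have h1 : I.dr b ≤ I.dr y + walkWeight I.weight q := wdist_le_add q
      exact (ENNReal.add_le_add_iff_right ENNReal.coe_ne_top).1 (hle.trans h1)
  obtain ⟨q, hq⟩ := exists_walkWeight_eq_wdist hx
  exact key I.r x q hr (by rw [hq]; simp [dr, wdist_self]) hx

theorem length_lt (I : RPInstance n m) : I.P.length < n := by
  simpa using I.P_isPath.length_lt

theorem length_pos (I : RPInstance n m) : 0 < I.P.length := by
  rcases Nat.eq_zero_or_pos I.P.length with h | h
  · exact absurd (SimpleGraph.Walk.eq_of_length_eq_zero h) I.r_ne_s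
  · exact h

/-- The input arrays are intact. -/
structure HasInput (I : RPInstance n m) (σ : State) : Prop where
  n_eq : σ.int 0 0 = n
  m_eq : σ.int 0 1 = m
  p_eq : σ.int 0 2 = I.P.length
  fst_eq : ∀ j : Fin m, σ.int 1 j = I.fst j
  snd_eq : ∀ j : Fin m, σ.int 2 j = I.snd j
  path_eq : ∀ i ≤ I.P.length, σ.int 3 i = I.P.getVert i
  weight_eq : ∀ j : Fin m, σ.wt 0 j = I.weight s(I.fst j, I.snd j)
  dr_eq : ∀ v : Fin n, σ.wt 1 v = I.dr v
  ds_eq : ∀ v : Fin n, σ.wt 2 v = I.ds v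

theorem hasInput_input (I : RPInstance n m) : HasInput I I.input where
  n_eq := by simp [input, toArray]
  m_eq := by simp [input, toArray]
  p_eq := by simp [input, toArray]
  fst_eq j := by simp [input, toArray]
  snd_eq j := by simp [input, toArray]
  path_eq i hi := by simp [input, toArray]; omega
  weight_eq j := by simp [input, toArray]
  dr_eq v := by simp [input, toArray]
  ds_eq v := by simp [input, toArray]

theorem HasInput.congr {σ τ : State} (h : HasInput I σ) (h0 : τ.int 0 = σ.int 0)
    (h1 : τ.int 1 = σ.int 1) (h2 : τ.int 2 = σ.int 2) (h3 : τ.int 3 = σ.int 3)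
    (w0 : τ.wt 0 = σ.wt 0) (w1 : τ.wt 1 = σ.wt 1) (w2 : τ.wt 2 = σ.wt 2) : HasInput I τ where
  n_eq := h0 ▸ h.n_eq
  m_eq := h0 ▸ h.m_eq
  p_eq := h0 ▸ h.p_eq
  fst_eq := h1 ▸ h.fst_eq
  snd_eq := h2 ▸ h.snd_eq
  path_eq := h3 ▸ h.path_eq
  weight_eq := w0 ▸ h.weight_eq
  dr_eq := w1 ▸ h.dr_eq
  ds_eq := w2 ▸ h.ds_eq

theorem adj_fst_snd (I : RPInstance n m) (j : Fin m) : I.graph.Adj (I.fst j) (I.snd j) := by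
  rw [← SimpleGraph.mem_edgeSet, ← I.edge_range]
  exact ⟨j, rfl⟩

theorem exists_edge {u v : Fin n} (h : I.graph.Adj u v) :
    ∃ j, s(I.fst j, I.snd j) = s(u, v) := by
  rw [← SimpleGraph.mem_edgeSet, ← I.edge_range] at h
  exact h

/-- The arcs `a < 2 m`, two for each edge: tails in array 20, heads in array 10, weights in weight
array 11. -/
structure HasArcs (I : RPInstance n m) (σ : State) : Prop where
  sound : ∀ a < m + m, ∃ u v : Fin n, I.graph.Adj u v ∧ σ.int 20 a = u ∧ σ.int 10 a = v ∧
    σ.wt 11 a = I.weight s(u, v)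
  complete : ∀ u v : Fin n, I.graph.Adj u v → ∃ a < m + m, σ.int 20 a = u ∧ σ.int 10 a = v

theorem HasArcs.congr {σ τ : State} (h : HasArcs I σ) (h20 : τ.int 20 = σ.int 20)
    (h10 : τ.int 10 = σ.int 10) (w11 : τ.wt 11 = σ.wt 11) : HasArcs I τ where
  sound := by rw [h20, h10, w11]; exact h.sound
  complete := by rw [h20, h10]; exact h.complete

end RPInstance

open RPInstance

variable {n m W : ℕ} {I : RPInstance n m} {Q : ℕ → State → Prop} {σ : State}

/-- Lists the two arcs of each edge. -/
def setupArcs : Prog :=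
  forLoop 34 0 1
    (.seq (.setInt 20 (scal 34) (.cell 1 (scal 34)))
      (.seq (.setInt 20 (.add (.cell 0 (.const 1)) (scal 34)) (.cell 2 (scal 34)))
        (.seq (.setInt 10 (scal 34) (.cell 2 (scal 34)))
          (.seq (.setInt 10 (.add (.cell 0 (.const 1)) (scal 34)) (.cell 1 (scal 34)))
            (.seq (.setWt 11 (scal 34) (.cell 0 (scal 34)))
              (.setWt 11 (.add (.cell 0 (.const 1)) (scal 34)) (.cell 0 (scal 34))))))))

theorem WP_setupArcs (hI : HasInput I σ) (hW : 4 * (n + m) + 16 < W)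
    (hQ : ∀ t τ, t ≤ 100 * m + 10 → Frame setupArcs σ τ → HasArcs I τ → Q t τ) :
    WP W setupArcs Q σ := by
  refine WP_for_const (C := 100) (fun k τ => ∀ j : Fin m, j.1 < k →
    τ.int 20 j = I.fst j ∧ τ.int 20 (m + j) = I.snd j ∧ τ.int 10 j = I.snd j ∧
    τ.int 10 (m + j) = I.fst j ∧ τ.wt 11 j = I.weight s(I.fst j, I.snd j) ∧
    τ.wt 11 (m + j) = I.weight s(I.fst j, I.snd j)) (by decide) (by decide)
    (by decide) hI.m_eq (by omega) (by omega) (by simp) ?_ ?_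
  · intro i τ hi hf hx hInv
    have J := hI.congr (hf.1 0 (by decide)) (hf.1 1 (by decide)) (hf.1 2 (by decide))
      (hf.1 3 (by decide)) (hf.2 0 (by decide)) (hf.2 1 (by decide)) (hf.2 2 (by decide))
    have h1 := J.fst_eq ⟨i, hi⟩
    have h2 := J.snd_eq ⟨i, hi⟩
    have h3 := J.weight_eq ⟨i, hi⟩
    have hm := J.m_eq
    have l1 := (I.fst ⟨i, hi⟩).2
    have l2 := (I.snd ⟨i, hi⟩).2
    simp only at h1 h2 h3
    refine WP_seq (WP_setInt (by simp [hx]; omega) (by simp [hx, h1]; omega) ?_)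
    refine WP_seq (WP_setInt (by simp [hx, hm]; omega) (by simp [hx, h2]; omega) ?_)
    refine WP_seq (WP_setInt (by simp [hx]; omega) (by simp [hx, h2]; omega) ?_)
    refine WP_seq (WP_setInt (by simp [hx, hm]; omega) (by simp [hx, h1]; omega) ?_)
    refine WP_seq (WP_setWt (by simp [hx]; omega) (by simp [hx]; omega) ?_)
    refine WP_setWt (by simp [hx, hm]; omega) (by simp [hx]; omega) ?_
    refine ⟨by simp, fun j hj => ?_⟩
    by_cases e : j.1 = i
    · obtain rfl : j = ⟨i, hi⟩ := Fin.ext e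
      have : m ≠ 0 := by omega
      simp [hx, hm, h1, h2, h3, this]
    · have e1 : ¬ j.1 = m + i := by omega
      have e2 : ¬ m + j.1 = i := by omega
      simpa [hx, hm, e, e1, e2, Function.update_apply] using hInv j (by omega)
  · intro t τ ht hf hInv
    refine hQ t τ ht hf ⟨fun a ha => ?_, fun u v huv => ?_⟩
    · by_cases h : a < m
      · have := hInv ⟨a, h⟩ h
        exact ⟨_, _, I.adj_fst_snd ⟨a, h⟩, this.1, this.2.2.1, this.2.2.2.2.1⟩
      · obtain ⟨b, rfl⟩ := Nat.exists_eq_add_of_le (not_lt.1 h)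
        have := hInv ⟨b, by omega⟩ (by simp; omega)
        refine ⟨_, _, (I.adj_fst_snd ⟨b, by omega⟩).symm, this.2.1, this.2.2.2.1, ?_⟩
        rw [Sym2.eq_swap]
        exact this.2.2.2.2.2
    · obtain ⟨j, hj⟩ := exists_edge huv
      have := hInv j j.2
      rcases Sym2.eq_iff.1 hj with ⟨rfl, rfl⟩ | ⟨rfl, rfl⟩
      · exact ⟨j, by omega, this.1, this.2.2.1⟩
      · exact ⟨m + j, by omega, this.2.1, this.2.2.2.1⟩

/-- The state of the search: the first `qt` cells of array 9 are the nodes found so far, array 8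
marks them, and array 7 holds their levels. -/
structure SearchState (I : RPInstance n m) (qt : ℕ) (σ : State) : Prop where
  queue_lt : ∀ i < qt, σ.int 9 i < n
  queue_inj : ∀ i < qt, ∀ j < qt, σ.int 9 i = σ.int 9 j → i = j
  mark_le : ∀ v : Fin n, σ.int 8 v ≤ 1
  mark_iff : ∀ v : Fin n, σ.int 8 v ≠ 0 ↔ ∃ i < qt, σ.int 9 i = v
  hangs : ∀ v : Fin n, σ.int 8 v ≠ 0 →
    σ.int 7 v ≤ I.P.length ∧ I.Hangs (σ.int 7 v) v ∧ I.dr v ≠ ⊤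
  unmarked : ∀ v : Fin n, σ.int 8 v = 0 → σ.int 7 v = 0
  path : ∀ i ≤ I.P.length, σ.int 7 (I.P.getVert i) = i ∧ σ.int 8 (I.P.getVert i) ≠ 0

theorem SearchState.le {qt : ℕ} (h : SearchState I qt σ) : qt ≤ n := by
  have := Finset.card_le_card_of_injOn (s := Finset.range qt) (t := Finset.range n) (σ.int 9)
    (fun i hi => by simpa using h.queue_lt i (by simpa using hi))
    (fun i hi j hj e => h.queue_inj i (by simpa using hi) j (by simpa using hj) e)
  simpa using this

theorem SearchState.congr {qt : ℕ} {τ : State} (h : SearchState I qt σ)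
    (h7 : τ.int 7 = σ.int 7) (h8 : τ.int 8 = σ.int 8) (h9 : τ.int 9 = σ.int 9) :
    SearchState I qt τ := by
  constructor <;> simp only [h7, h8, h9]
  exacts [h.queue_lt, h.queue_inj, h.mark_le, h.mark_iff, h.hangs, h.unmarked, h.path]

/-- Marks the nodes of `P` and puts them into the queue. -/
def seedSearch : Prog :=
  .seq (assign 46 (.add (.cell 0 (.const 2)) (.const 1)))
    (forLoop 35 46 0
      (.seq (.setInt 7 (.cell 3 (scal 35)) (scal 35))
        (.seq (.setInt 8 (.cell 3 (scal 35)) (.const 1))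
          (.setInt 9 (scal 35) (.cell 3 (scal 35))))))

theorem WP_seedSearch (hI : HasInput I σ) (hW : 4 * (n + m) + 16 < W)
    (h7 : σ.int 7 = 0) (h8 : σ.int 8 = 0)
    (hQ : ∀ t τ, t ≤ 100 * n + 20 → Frame seedSearch σ τ → τ.int 46 0 = I.P.length + 1 →
      SearchState I (I.P.length + 1) τ → Q t τ) :
    WP W seedSearch Q σ := by
  have hp := I.length_lt
  have hp' := hI.p_eq
  suffices H : WP W seedSearch (fun t τ => t ≤ 100 * n + 20 ∧ τ.int 46 0 = I.P.length + 1 ∧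
      SearchState I (I.P.length + 1) τ) σ from
    H.mono fun t τ hf h => hQ t τ h.1 hf h.2.1 h.2.2
  refine WP_seq (WP_setInt (by simp; omega) (by simp [hp']; omega) ?_)
  refine WP_for_const (C := 100) (N := I.P.length + 1) (fun k τ =>
    (∀ i < k, τ.int 7 (I.P.getVert i) = i ∧ τ.int 8 (I.P.getVert i) = 1 ∧
      τ.int 9 i = I.P.getVert i) ∧
    ∀ v : Fin n, (∀ i < k, I.P.getVert i ≠ v) → τ.int 7 v = 0 ∧ τ.int 8 v = 0) (by decide)
    (by decide) (by decide) (by simp [hp']) (by omega) (by omega) (by simp [h7, h8]) ?_ ?_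
  · intro i τ hi hf hx ⟨hInv, hInv'⟩
    have e3 : τ.int 3 i = I.P.getVert i := by
      have := hf.1 3 (by decide)
      simp at this
      rw [this, hI.path_eq i (by omega)]
    have l1 := (I.P.getVert i).2
    refine WP_seq (WP_setInt (by simp [hx, e3]; omega) (by simp [hx]; omega) ?_)
    refine WP_seq (WP_setInt (by simp [hx, e3]; omega) (by simp; omega) ?_)
    refine WP_setInt (by simp [hx]; omega) (by simp [hx, e3]; omega) ?_
    refine ⟨by simp, fun j hj => ?_, fun v hv => ?_⟩
    · by_cases e : j = i
      · subst e; simp [hx, e3]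
      · have e' : (I.P.getVert j : ℕ) ≠ I.P.getVert i := fun h =>
          e (getVert_injOn (by omega) (by omega) (Fin.ext h))
        simpa [hx, e3, e, e'] using hInv j (by omega)
    · have e' : (v : ℕ) ≠ I.P.getVert i := fun h => hv i (by omega) (Fin.ext h.symm)
      simpa [hx, e3, e'] using hInv' v fun j hj => hv j (by omega)
  · intro t τ ht hf ⟨hInv, hInv'⟩
    have hmark : ∀ v : Fin n, τ.int 8 v ≠ 0 → ∃ i < I.P.length + 1, I.P.getVert i = v := by
      intro v hv
      by_contra hc
      push Not at hc
      exact hv (hInv' v hc).2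
    refine ⟨by simp; omega, by rw [hf.1 46 (by decide)]; simp [hp'], fun i hi => ?_,
      fun i hi j hj e => ?_, fun v => ?_, fun v => ?_, fun v hv => ?_, fun v hv => ?_, fun i hi => ?_⟩
    · rw [(hInv i hi).2.2]; exact (I.P.getVert i).2
    · rw [(hInv i hi).2.2, (hInv j hj).2.2] at e
      exact getVert_injOn (by omega) (by omega) (Fin.ext e)
    · by_cases h : τ.int 8 v = 0
      · omega
      · obtain ⟨i, hi, rfl⟩ := hmark v h
        rw [(hInv i hi).2.1]
    · constructor
      · intro h
        obtain ⟨i, hi, rfl⟩ := hmark v h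
        exact ⟨i, hi, (hInv i hi).2.2⟩
      · rintro ⟨i, hi, h⟩
        rw [(hInv i hi).2.2] at h
        rw [← h, (hInv i hi).2.1]
        omega
    · obtain ⟨i, hi, rfl⟩ := hmark v hv
      rw [(hInv i hi).1]
      exact ⟨by omega, hangs_getVert i, dr_getVert_ne_top i⟩
    · refine (hInv' v fun i hi e => ?_).1
      subst e
      rw [(hInv i hi).2.1] at hv
      omega
    · rw [(hInv i (by omega)).1, (hInv i (by omega)).2.1]
      omega

/-- Scans the arc in the scalar 51 from the node `u` in the scalar 49: if it extends a shortest path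
to a new node, then this node is marked, inherits the level of `u`, and is put into the queue. -/
def scanArc : Prog :=
  .seq (assign 58 (.cell 10 (.sub (scal 51) (.const 1))))
    (.cond (.and (.ile (.cell 8 (scal 58)) (.const 0))
        (.wle (.add (.cell 1 (scal 49)) (.cell 11 (.sub (scal 51) (.const 1))))
          (.cell 1 (scal 58))))
      (.seq (.setInt 8 (scal 58) (.const 1))
        (.seq (.setInt 7 (scal 58) (.cell 7 (scal 49)))
          (.seq (.setInt 9 (scal 48) (scal 58))
            (assign 48 (.add (scal 48) (.const 1))))))
      .skip)

/-- The level of `u` is passed on correctly by `Hangs.step`, as all nodes of `P` are marked from the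
beginning. -/
theorem WP_scanArc {qt a : ℕ} {u v : Fin n} (hI : HasInput I σ) (hW : 4 * (n + m) + 16 < W)
    (hS : SearchState I qt σ) (hqt : σ.int 48 0 = qt) (hu : σ.int 49 0 = u) (ha : a < m + m)
    (h51 : σ.int 51 0 = a + 1) (hv : σ.int 10 a = v) (hadj : I.graph.Adj u v)
    (hw : σ.wt 11 a = I.weight s(u, v)) (hmu : σ.int 8 u ≠ 0)
    (hQ : ∀ t τ qt', t ≤ 60 → Frame scanArc σ τ → τ.int 48 0 = qt' → qt ≤ qt' →
      SearchState I qt' τ → (∀ i < qt, τ.int 9 i = σ.int 9 i) →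
      (∀ x : Fin n, σ.int 8 x ≠ 0 → τ.int 8 x ≠ 0) →
      (I.dr u + I.weight s(u, v) ≤ I.dr v → τ.int 8 v ≠ 0) → Q t τ) :
    WP W scanArc Q σ := by
  suffices H : WP W scanArc (fun t τ => t ≤ 60 ∧ qt ≤ τ.int 48 0 ∧
      SearchState I (τ.int 48 0) τ ∧ (∀ i < qt, τ.int 9 i = σ.int 9 i) ∧
      (∀ x : Fin n, σ.int 8 x ≠ 0 → τ.int 8 x ≠ 0) ∧
      (I.dr u + I.weight s(u, v) ≤ I.dr v → τ.int 8 v ≠ 0)) σ from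
    H.mono fun t τ hf h => hQ t τ _ h.1 hf rfl h.2.1 h.2.2.1 h.2.2.2.1 h.2.2.2.2.1 h.2.2.2.2.2
  have hle := hS.le
  have lu := u.2
  have lv := v.2
  have hmark := hS.mark_le v
  have hp := I.length_lt
  have h7 := (hS.hangs u hmu).1
  have d1 := hI.dr_eq u
  have d2 := hI.dr_eq v
  refine WP_seq (WP_setInt (by simp; omega) (by simp [h51, hv]; omega) ?_)
  refine WP_cond (by simp [h51, hv, hu]; omega) (fun h => ?_) (fun h => ?_)
  · simp [h51, hv, hu, d1, d2, hw] at h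
    obtain ⟨h8, htight⟩ := h
    have hvP : v ∉ I.P.support := by
      intro hmem
      obtain ⟨i, hi, hi'⟩ := SimpleGraph.Walk.mem_support_iff_exists_getVert.1 hmem
      have := (hS.path i hi').2
      rw [hi] at this
      exact this h8
    refine WP_seq (WP_setInt (by simp [hv, h51]; omega) (by simp; omega) ?_)
    refine WP_seq (WP_setInt (by simp [hv, h51]; omega) (by simp [hu]; omega) ?_)
    refine WP_seq (WP_setInt (by simp [hqt]; omega) (by simp [hv, h51]; omega) ?_)
    refine WP_setInt (by simp; omega) (by simp [hqt]; omega) ?_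
    have hne : ∀ i < qt, i ≠ qt := fun i hi => by omega
    have hnew : ∀ i < qt, σ.int 9 i ≠ v := fun i hi e =>
      (hS.mark_iff v).2 ⟨i, hi, e⟩ h8
    refine ⟨by simp, by simp [hqt], ?_, ?_, ?_, ?_⟩
    · simp only [State.setInt_int, IExp.val]
      norm_num [hqt, h51, hv, hu]
      constructor
      · intro i hi
        by_cases e : i = qt
        · simp [e]
        · simpa [e] using hS.queue_lt i (by omega)
      · intro i hi j hj e
        by_cases ei : i = qt <;> by_cases ej : j = qt
        · omega
        · simp [ei, ej] at e
          exact absurd e.symm (hnew j (by omega))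
        · simp [ei, ej] at e
          exact absurd e (hnew i (by omega))
        · simp [ei, ej] at e
          exact hS.queue_inj i (by omega) j (by omega) e
      · intro x
        by_cases e : (x : ℕ) = v
        · simp [e]
        · simpa [e] using hS.mark_le x
      · intro x
        by_cases e : (x : ℕ) = v
        · simp [e]
          exact ⟨qt, by omega, by simp⟩
        · simp [e]
          rw [← ne_eq, hS.mark_iff]
          constructor
          · rintro ⟨i, hi, h⟩
            exact ⟨i, by omega, by simpa [hne i hi] using h⟩
          · rintro ⟨i, hi, h⟩
            by_cases ei : i = qt
            · simp [ei] at h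
              exact absurd h.symm e
            · exact ⟨i, by omega, by simpa [ei] using h⟩
      · intro x hx
        by_cases e : (x : ℕ) = v
        · obtain rfl := Fin.ext e
          simp
          refine ⟨h7, (hS.hangs u hmu).2.1.step hadj htight hvP, ?_⟩
          exact dr_ne_top_of_adj (hS.hangs u hmu).2.2 hadj
        · simp [e] at hx ⊢
          simpa using hS.hangs x hx
      · intro x hx
        by_cases e : (x : ℕ) = v
        · simp [e] at hx
        · simp [e] at hx ⊢
          exact hS.unmarked x hx
      · intro i hi
        have e : (I.P.getVert i : ℕ) ≠ v := fun h => hvP (Fin.ext h ▸ getVert_mem i)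
        simpa [e] using hS.path i hi
    · intro i hi
      simp [hqt, hne i hi]
    · intro x hx
      by_cases e : (x : ℕ) = v
      · simp [h51, hv, e]
      · simpa [h51, hv, e] using hx
    · intro _
      simp [h51, hv]
  · simp [h51, hv, hu, d1, d2, hw] at h
    refine WP_skip ⟨by simp, by simp [hqt], ?_, by simp, by simp, ?_⟩
    · simpa [hqt, h51] using
        hS.congr (τ := σ.setInt 58 0 (σ.int 10 a)) (by simp) (by simp) (by simp)
    · intro ht
      simp
      intro h8
      exact absurd ht (not_le.2 (h h8))

/-- The search along the edges that extend shortest paths. -/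
def search : Prog :=
  .seq (assign 47 (.const 0)) (.seq (assign 48 (scal 46))
    (.loop (.not (.ile (scal 48) (scal 47)))
      (.seq (assign 49 (.cell 9 (scal 47)))
        (.seq (assign 51 (.cell 21 (scal 49)))
          (.seq (listLoop 51 scanArc) (assign 47 (.add (scal 47) (.const 1))))))))

theorem WP_search (hI : HasInput I σ) (hA : HasArcs I σ) (hW : 4 * (n + m) + 16 < W)
    (hhead : ∀ v < n, σ.int 21 v = prevKey (σ.int 20) v (m + m))
    (hnext : ∀ j < m + m, σ.int 22 j = prevKey (σ.int 20) (σ.int 20 j) j)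
    (h46 : σ.int 46 0 = I.P.length + 1) (hS : SearchState I (I.P.length + 1) σ)
    (hQ : ∀ t τ lev, t ≤ 100 * n + 200 * m + 30 → Frame search σ τ → I.IsLevel lev →
      (∀ v : Fin n, τ.int 7 v = lev v) → Q t τ) :
    WP W search Q σ := by
  suffices H : WP W search (fun t τ => t ≤ 100 * n + 200 * m + 30 ∧
      I.IsLevel (fun v => τ.int 7 v)) σ from
    H.mono fun t τ hf h => hQ t τ _ h.1 hf h.2 fun _ => rfl
  have hp := I.length_lt
  refine WP_seq (WP_setInt (by simp; omega) (by simp; omega) ?_)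
  refine WP_seq (WP_setInt (by simp; omega) (by simp [h46]; omega) ?_)
  -- `D` is the set of the nodes that have been taken from the queue.
  refine WP_loop (fun t τ => ∃ (qh qt : ℕ) (D : Finset ℕ), τ.int 47 0 = qh ∧ τ.int 48 0 = qt ∧
      qh ≤ qt ∧ SearchState I qt τ ∧ (∀ v ∈ D, ∃ i < qh, τ.int 9 i = v) ∧
      t ≤ 100 * qh + 100 * ∑ v ∈ D, countKey (σ.int 20) (m + m) v 0 ∧
      ∀ i < qh, ∀ u v : Fin n, τ.int 9 i = u → I.graph.Adj u v →
        I.dr u + I.weight s(u, v) ≤ I.dr v → τ.int 8 v ≠ 0)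
    (fun τ => n - τ.int 47 0) ?_ ?_ ?_ ?_
  · refine ⟨0, I.P.length + 1, ∅, by simp, by simp [h46], by omega,
      hS.congr (by simp) (by simp) (by simp), by simp, by simp, by simp⟩
  · rintro t τ hf ⟨qh, qt, D, h47, h48, hle, hS', -⟩
    have := hS'.le
    simp [h47, h48]
    omega
  · rintro t τ hf ⟨qh, qt, D, h47, h48, hle, hS', hD, ht, hcl⟩ hh
    have hqn := hS'.le
    simp [h47, h48] at hh
    have e20 : τ.int 20 = σ.int 20 := by simpa using hf.1 20 (by decide)
    have e10 : τ.int 10 = σ.int 10 := by simpa using hf.1 10 (by decide)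
    have e21 : τ.int 21 = σ.int 21 := by simpa using hf.1 21 (by decide)
    have e22 : τ.int 22 = σ.int 22 := by simpa using hf.1 22 (by decide)
    have e11 : τ.wt 11 = σ.wt 11 := by simpa using hf.2 11 (by decide)
    have hIτ : HasInput I τ := hI.congr (by simpa using hf.1 0 (by decide))
      (by simpa using hf.1 1 (by decide)) (by simpa using hf.1 2 (by decide))
      (by simpa using hf.1 3 (by decide)) (by simpa using hf.2 0 (by decide))
      (by simpa using hf.2 1 (by decide)) (by simpa using hf.2 2 (by decide))
    have hun := hS'.queue_lt qh hh
    obtain ⟨u, hu⟩ : ∃ u : Fin n, τ.int 9 qh = u := ⟨⟨_, hun⟩, rfl⟩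
    have hmu : τ.int 8 u ≠ 0 := (hS'.mark_iff u).2 ⟨qh, hh, hu⟩
    have hhu := hhead u u.2
    have hprev := prevKey_le (σ.int 20) u (m + m)
    have lu := u.2
    refine WP_seq (WP_setInt (by simp; omega) (by simp [h47, hu]; omega) ?_)
    refine WP_seq (WP_setInt (by simp; omega) (by simp [h47, hu, e21, hhu]; omega) ?_)
    refine WP_seq (WP_list (v := u) (M := m + m) (key := σ.int 20) (fun c t' ρ => ∃ qt',
      ρ.int 48 0 = qt' ∧ qt ≤ qt' ∧ SearchState I qt' ρ ∧ (∀ i < qt, ρ.int 9 i = τ.int 9 i) ∧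
      (∀ x : Fin n, τ.int 8 x ≠ 0 → ρ.int 8 x ≠ 0) ∧
      t' ≤ 100 * countKey (σ.int 20) (m + m) u c ∧
      ∀ a < m + m, c ≤ a → σ.int 20 a = u → ∀ v : Fin n, σ.int 10 a = v →
        I.dr u + I.weight s(u, v) ≤ I.dr v → ρ.int 8 v ≠ 0)
      (by decide) (by decide) (by decide)
      (by simp [h47, hu, e21, hhu]) (by simpa [e22] using hnext) (by omega) ?_ ?_ ?_ ?_)
    · refine ⟨qt, by simp [h48], le_rfl, hS'.congr (by simp) (by simp) (by simp), by simp,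
        by simp, by simp, fun a ha hca => by omega⟩
    · rintro j t' ρ hj hne ⟨qt', g1, g2, g3, g4, g5, g6, g7⟩
      refine ⟨qt', g1, g2, g3, g4, g5, by rw [countKey_ne hne]; exact g6, fun a ha hca hk => ?_⟩
      have : a ≠ j := by rintro rfl; exact hne hk
      exact g7 a ha (by omega) hk
    · rintro a t' ρ ha hk hfρ h51 ⟨qt', g1, g2, g3, g4, g5, g6, g7⟩
      obtain ⟨u', v, hadj, hu', hv, hw⟩ := hA.sound a ha
      obtain rfl : u' = u := Fin.ext (hu'.symm.trans hk)
      have hIρ : HasInput I ρ := hIτ.congr (by simpa using hfρ.1 0 (by decide))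
        (by simpa using hfρ.1 1 (by decide)) (by simpa using hfρ.1 2 (by decide))
        (by simpa using hfρ.1 3 (by decide)) (by simpa using hfρ.2 0 (by decide))
        (by simpa using hfρ.2 1 (by decide)) (by simpa using hfρ.2 2 (by decide))
      have E10 : ρ.int 10 = σ.int 10 := by simpa [e10] using hfρ.1 10 (by decide)
      have E11 : ρ.wt 11 = σ.wt 11 := by simpa [e11] using hfρ.2 11 (by decide)
      have E49 : ρ.int 49 0 = u' := by
        rw [hfρ.1 49 (by decide)]; simp [h47, hu]
      refine WP_scanArc (qt := qt') (a := a) (u := u') (v := v) hIρ hW g3 g1 E49 ha h51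
        (by rw [E10, hv]) hadj (by rw [E11, hw]) (g5 u' hmu) ?_
      intro t'' ρ' qt'' k1 hfρ' k2 k3 k4 k5 k6 k7
      refine ⟨qt'', by simpa using k2, by omega, k4.congr (by simp) (by simp) (by simp),
        fun i hi => ?_, fun x hx => ?_, ?_, fun b hb hab hkb y hy hty => ?_⟩
      · simp [k5 i (by omega), g4 i hi]
      · simpa using k6 x (g5 x hx)
      · rw [countKey_eq ha hk]; omega
      · simp
        by_cases e : b = a
        · subst e
          obtain rfl : y = v := Fin.ext (hy.symm.trans hv)
          exact k7 hty
        · exact k6 y (g7 b hb (by omega) hkb y hy hty)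
    · rintro t' ρ hfρ ⟨qt', g1, g2, g3, g4, g5, g6, g7⟩
      have E47 : ρ.int 47 0 = qh := by rw [hfρ.1 47 (by decide)]; simp [h47]
      have hnotin : (u : ℕ) ∉ D := by
        intro hmem
        obtain ⟨i, hi, e⟩ := hD u hmem
        have := hS'.queue_inj i (by omega) qh hh (e.trans hu.symm)
        omega
      refine WP_setInt (by simp; omega) (by simp [E47]; omega) ⟨⟨qh + 1, qt', insert (u : ℕ) D,
        by simp [E47], by simp [g1], by omega, g3.congr (by simp) (by simp) (by simp),
        fun v hv => ?_, ?_, fun i hi u' v hu' hadj ht' => ?_⟩, by simp [E47, h47]; omega⟩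
      · rcases Finset.mem_insert.1 hv with rfl | hv
        · exact ⟨qh, by omega, by simp [g4 qh hh, hu]⟩
        · obtain ⟨i, hi, e⟩ := hD v hv
          exact ⟨i, by omega, by simp [g4 i (by omega), e]⟩
      · rw [Finset.sum_insert hnotin]
        simp
        omega
      · simp at hu' ⊢
        by_cases e : i = qh
        · subst e
          rw [g4 i hh, hu] at hu'
          obtain rfl := Fin.ext hu'
          obtain ⟨a, ha, h1, h2⟩ := hA.complete _ v hadj
          exact g7 a ha (by omega) h1 v h2 ht'
        · rw [g4 i (by omega)] at hu'
          exact g5 v (hcl i (by omega) u' v hu' hadj ht')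
  · rintro t τ hf ⟨qh, qt, D, h47, h48, hle, hS', hD, ht, hcl⟩ hh
    have hqn := hS'.le
    simp [h47, h48] at hh
    have := sum_countKey_le (σ.int 20) (m + m) D
    have hall : ∀ x, I.dr x ≠ ⊤ → τ.int 8 x ≠ 0 := fun x hx =>
      mem_of_closed (F := fun x => τ.int 8 x ≠ 0) (by simpa using (hS'.path 0 (by omega)).2)
        (fun u v hu hadj ht => by
          obtain ⟨i, hi, e⟩ := (hS'.mark_iff u).1 hu
          exact hcl i (by omega) u v e hadj ht) hx
    refine ⟨by simp; omega, fun x => ?_, fun i hi => (hS'.path i hi).1,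
      fun x hx => (hS'.hangs x (hall x hx)).2.1, fun x hx => ?_⟩
    · by_cases h : τ.int 8 x = 0
      · simp [hS'.unmarked x h]
      · exact (hS'.hangs x h).1
    · by_cases h : τ.int 8 x = 0
      · exact absurd (hS'.unmarked x h) hx
      · exact (hS'.hangs x h).2.2

/-- Computes the levels of all nodes in array 7. -/
def computeLevels : Prog :=
  .seq setupArcs (.seq (assign 23 (.add (.cell 0 (.const 1)) (.cell 0 (.const 1))))
    (.seq (assign 24 (.cell 0 (.const 0))) (.seq buildLists (.seq seedSearch search))))

theorem WP_computeLevels (hI : HasInput I σ) (hW : 4 * (n + m) + 16 < W)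
    (h7 : σ.int 7 = 0) (h8 : σ.int 8 = 0)
    (hQ : ∀ t τ lev, t ≤ 300 * n + 400 * m + 200 → Frame computeLevels σ τ → I.IsLevel lev →
      (∀ v : Fin n, τ.int 7 v = lev v) → Q t τ) :
    WP W computeLevels Q σ := by
  suffices H : WP W computeLevels (fun t τ => t ≤ 300 * n + 400 * m + 200 ∧
      ∃ lev, I.IsLevel lev ∧ ∀ v : Fin n, τ.int 7 v = lev v) σ from
    H.mono fun t τ hf ⟨h1, lev, h2, h3⟩ => hQ t τ lev h1 hf h2 h3
  refine WP_seq (WP_setupArcs hI hW fun t1 σ1 ht1 hf1 hA1 => ?_)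
  have hI1 : HasInput I σ1 := hI.congr (hf1.1 0 (by decide)) (hf1.1 1 (by decide))
    (hf1.1 2 (by decide)) (hf1.1 3 (by decide)) (hf1.2 0 (by decide)) (hf1.2 1 (by decide))
    (hf1.2 2 (by decide))
  refine WP_seq (WP_setInt (by simp; omega) (by simp [hI1.m_eq]; omega) ?_)
  refine WP_seq (WP_setInt (by simp; omega) (by simp [hI1.n_eq]; omega) ?_)
  refine WP_seq (WP_buildLists (M := m + m) (N := n) (by simp [hI1.m_eq]) (by simp [hI1.n_eq])
    (by omega) (by omega) (fun j hj => ?_) ?_)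
  · obtain ⟨u, v, -, hu, -⟩ := hA1.sound j hj
    simp [hu]
  intro t2 σ2 ht2 hf2 h21 h22
  have e20 : σ2.int 20 = σ1.int 20 := by simpa using hf2.1 20 (by decide)
  have hI2 : HasInput I σ2 := hI1.congr (by simpa using hf2.1 0 (by decide))
    (by simpa using hf2.1 1 (by decide)) (by simpa using hf2.1 2 (by decide))
    (by simpa using hf2.1 3 (by decide)) (by simpa using hf2.2 0 (by decide))
    (by simpa using hf2.2 1 (by decide)) (by simpa using hf2.2 2 (by decide))
  have hA2 : HasArcs I σ2 := hA1.congr e20 (by simpa using hf2.1 10 (by decide))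
    (by simpa using hf2.2 11 (by decide))
  have e7 : σ2.int 7 = 0 := by
    have := hf2.1 7 (by decide)
    simp at this
    rw [this, hf1.1 7 (by decide), h7]
  have e8 : σ2.int 8 = 0 := by
    have := hf2.1 8 (by decide)
    simp at this
    rw [this, hf1.1 8 (by decide), h8]
  refine WP_seq (WP_seedSearch hI2 hW e7 e8 ?_)
  · intro t3 σ3 ht3 hf3 h46 hS
    have hI3 : HasInput I σ3 := hI2.congr (hf3.1 0 (by decide)) (hf3.1 1 (by decide))
      (hf3.1 2 (by decide)) (hf3.1 3 (by decide)) (hf3.2 0 (by decide)) (hf3.2 1 (by decide))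
      (hf3.2 2 (by decide))
    have e20' : σ3.int 20 = σ2.int 20 := hf3.1 20 (by decide)
    have hA3 : HasArcs I σ3 := hA2.congr e20' (hf3.1 10 (by decide)) (hf3.2 11 (by decide))
    refine WP_search hI3 hA3 hW (fun v hv => ?_) (fun j hj => ?_) h46 hS ?_
    · rw [hf3.1 21 (by decide), e20', e20]
      simpa using h21 v hv
    · rw [hf3.1 22 (by decide), e20', e20]
      simpa using h22 j hj
    · intro t4 σ4 lev ht4 hf4 hlev h7'
      exact ⟨by simp; omega, lev, hlev, h7'⟩

end

/-! ### The program for the edge-avoiding version -/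

section

open RPInstance

variable {n m W : ℕ} {I : RPInstance n m} {Q : ℕ → State → Prop} {σ : State}

/-- The `j`-th listed edge joins `x` and `y`, and `x` is not of higher level than `y`. -/
def Oriented (I : RPInstance n m) (lev : Fin n → ℕ) (j : Fin m) (x y : Fin n) : Prop :=
  s(I.fst j, I.snd j) = s(x, y) ∧ lev x ≤ lev y

theorem Oriented.adj {lev : Fin n → ℕ} {j : Fin m} {x y : Fin n} (h : Oriented I lev j x y) :
    I.graph.Adj x y := by
  have := I.adj_fst_snd j
  rw [← SimpleGraph.mem_edgeSet, h.1] at this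
  exact this

theorem Oriented.eq_of_lt {lev : Fin n → ℕ} {j : Fin m} {x y a b : Fin n}
    (h : Oriented I lev j x y) (hab : s(I.fst j, I.snd j) = s(a, b)) (hlt : lev a < lev b) :
    x = a ∧ y = b := by
  rcases Sym2.eq_iff.1 (h.1.symm.trans hab) with h' | ⟨rfl, rfl⟩
  · exact h'
  · exact absurd h.2 (not_le.2 hlt)

/-- Puts the end nodes of the edge whose index is in the scalar 36 into the scalars 60 and 61, the
one of lower level first. -/
def orientEdge : Prog :=
  .cond (.ile (.cell 7 (.cell 1 (scal 36))) (.cell 7 (.cell 2 (scal 36))))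
    (.seq (assign 60 (.cell 1 (scal 36))) (assign 61 (.cell 2 (scal 36))))
    (.seq (assign 60 (.cell 2 (scal 36))) (assign 61 (.cell 1 (scal 36))))

theorem WP_orientEdge {lev : Fin n → ℕ} (hI : HasInput I σ) (hW : 4 * (n + m) + 16 < W)
    (hl : I.IsLevel lev) (hlev : ∀ v : Fin n, σ.int 7 v = lev v) (j : Fin m)
    (hj : σ.int 36 0 = j)
    (hQ : ∀ t τ x y, t ≤ 30 → Frame orientEdge σ τ → Oriented I lev j x y →
      τ.int 60 0 = x → τ.int 61 0 = y → Q t τ) :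
    WP W orientEdge Q σ := by
  suffices H : WP W orientEdge (fun t τ => t ≤ 30 ∧ ∃ x y, Oriented I lev j x y ∧
      τ.int 60 0 = x ∧ τ.int 61 0 = y) σ from
    H.mono fun t τ hf ⟨h1, x, y, h2, h3, h4⟩ => hQ t τ x y h1 hf h2 h3 h4
  have h1 := hI.fst_eq j
  have h2 := hI.snd_eq j
  have l1 := hlev (I.fst j)
  have l2 := hlev (I.snd j)
  have b1 := hl.le (I.fst j)
  have b2 := hl.le (I.snd j)
  have hp := I.length_lt
  have hjm := j.2
  have c1 := (I.fst j).2
  have c2 := (I.snd j).2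
  refine WP_cond (by simp [hj, h1, h2, l1, l2]; omega) (fun h => ?_) (fun h => ?_)
  · simp [hj, h1, h2, l1, l2] at h
    refine WP_seq (WP_setInt (by simp; omega) (by simp [hj, h1]; omega) ?_)
    refine WP_setInt (by simp; omega) (by simp [hj, h2]; omega) ?_
    exact ⟨by simp, I.fst j, I.snd j, ⟨rfl, h⟩, by simp [hj, h1], by simp [hj, h2]⟩
  · simp [hj, h1, h2, l1, l2] at h
    refine WP_seq (WP_setInt (by simp; omega) (by simp [hj, h2]; omega) ?_)
    refine WP_setInt (by simp; omega) (by simp [hj, h1]; omega) ?_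
    exact ⟨by simp, I.snd j, I.fst j, ⟨Sym2.eq_swap, h.le⟩, by simp [hj, h2], by simp [hj, h1]⟩

/-- Equality of words. -/
def Test.eq (x y : IExp) : Test := .and (.ile x y) (.ile y x)

@[simp]
theorem Test.holds_eq (σ : State) (x y : IExp) :
    (Test.eq x y).Holds σ ↔ x.val σ = y.val σ := by
  simp [Test.eq]; omega

@[simp]
theorem Test.fits_eq (W : ℕ) (σ : State) (x y : IExp) :
    (Test.eq x y).Fits W σ ↔ x.Fits W σ ∧ y.Fits W σ := by
  simp [Test.eq]; tauto

@[simp]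
theorem Test.size_eq (x y : IExp) :
    (Test.eq x y).size = (x.size + y.size + 1) + (y.size + x.size + 1) + 1 := by
  simp [Test.eq]

/-- For each edge `xy` with `lev x ≤ lev y`, the interval `[lev x, lev y)` of the edges of `P` that
it bypasses, and the least weight of a walk from `r` to `s` through `xy`; the edges of `P`
themselves receive empty intervals. -/
def edgeIntervals : Prog :=
  forLoop 36 0 1
    (.seq orientEdge
      (.seq (.setWt 6 (scal 36) (.add (.add (.cell 1 (scal 60)) (.cell 0 (scal 36)))
          (.cell 2 (scal 61))))
        (.seq (.setInt 26 (scal 36) (.cell 7 (scal 60)))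
          (.cond (.and (.eq (.cell 3 (.cell 7 (scal 60))) (scal 60))
              (.and (.eq (.cell 3 (.cell 7 (scal 61))) (scal 61))
                (.eq (.add (.cell 7 (scal 60)) (.const 1)) (.cell 7 (scal 61)))))
            (.setInt 27 (scal 36) (.cell 7 (scal 60)))
            (.setInt 27 (scal 36) (.cell 7 (scal 61)))))))

theorem WP_edgeIntervals {lev : Fin n → ℕ} (hI : HasInput I σ) (hW : 4 * (n + m) + 16 < W)
    (hl : I.IsLevel lev) (hlev : ∀ v : Fin n, σ.int 7 v = lev v)
    (hQ : ∀ t τ, t ≤ 200 * m + 10 → Frame edgeIntervals σ τ →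
      (∀ j : Fin m, ∃ x y, Oriented I lev j x y ∧
        τ.wt 6 j = I.dr x + I.weight s(x, y) + I.ds y ∧ τ.int 26 j = lev x ∧
        τ.int 27 j ≤ I.P.length ∧
        ∀ i, (lev x ≤ i ∧ i < τ.int 27 j) ↔
          (lev x ≤ i ∧ i < lev y ∧ s(x, y) ≠ s(I.P.getVert i, I.P.getVert (i + 1)))) → Q t τ) :
    WP W edgeIntervals Q σ := by
  refine WP_for_const (C := 200) (fun k τ => ∀ j : Fin m, j.1 < k → ∃ x y, Oriented I lev j x y ∧
      τ.wt 6 j = I.dr x + I.weight s(x, y) + I.ds y ∧ τ.int 26 j = lev x ∧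
      τ.int 27 j ≤ I.P.length ∧
      ∀ i, (lev x ≤ i ∧ i < τ.int 27 j) ↔
        (lev x ≤ i ∧ i < lev y ∧ s(x, y) ≠ s(I.P.getVert i, I.P.getVert (i + 1))))
    (by decide) (by decide) (by decide) hI.m_eq (by omega) (by omega) (by simp) ?_
    fun t τ ht hf hInv => hQ t τ ht hf fun j => hInv j j.2
  intro k τ hk hf hx hInv
  have J := hI.congr (hf.1 0 (by decide)) (hf.1 1 (by decide)) (hf.1 2 (by decide))
    (hf.1 3 (by decide)) (hf.2 0 (by decide)) (hf.2 1 (by decide)) (hf.2 2 (by decide))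
  have e7 : ∀ v : Fin n, τ.int 7 v = lev v := by rw [hf.1 7 (by decide)]; exact hlev
  refine WP_seq (WP_orientEdge J hW hl e7 ⟨k, hk⟩ hx ?_)
  intro t ρ x y ht hfρ hxy h60 h61
  have Jρ := J.congr (hfρ.1 0 (by decide)) (hfρ.1 1 (by decide)) (hfρ.1 2 (by decide))
    (hfρ.1 3 (by decide)) (hfρ.2 0 (by decide)) (hfρ.2 1 (by decide)) (hfρ.2 2 (by decide))
  have E36 : ρ.int 36 0 = k := by rw [hfρ.1 36 (by decide)]; exact hx
  have E26 : ρ.int 26 = τ.int 26 := hfρ.1 26 (by decide)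
  have E27 : ρ.int 27 = τ.int 27 := hfρ.1 27 (by decide)
  have E6 : ρ.wt 6 = τ.wt 6 := hfρ.2 6 (by decide)
  have lx : ρ.int 7 x = lev x := by rw [hfρ.1 7 (by decide)]; exact e7 x
  have ly : ρ.int 7 y = lev y := by rw [hfρ.1 7 (by decide)]; exact e7 y
  have bx := hl.le x
  have bY := hl.le y
  have hp := I.length_lt
  have cx := x.2
  have cy := y.2
  have px := Jρ.path_eq _ bx
  have py := Jρ.path_eq _ bY
  have cpx := (I.P.getVert (lev x)).2
  have cpy := (I.P.getVert (lev y)).2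
  have d1 := Jρ.dr_eq x
  have d2 := Jρ.ds_eq y
  have d3 : ρ.wt 0 k = I.weight s(x, y) := by rw [← hxy.1]; exact Jρ.weight_eq ⟨k, hk⟩
  refine WP_seq (WP_setWt (by simp [E36]; omega) (by simp [E36, h60, h61]; omega) ?_)
  refine WP_seq (WP_setInt (by simp [E36]; omega) (by simp [h60, lx]; omega) ?_)
  have fin : ∀ (c : ℕ) (ρ' : State), ρ'.wt 6 = Function.update (ρ.wt 6) k
      (I.dr x + I.weight s(x, y) + I.ds y) → ρ'.int 26 = Function.update (ρ.int 26) k (lev x) →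
      ρ'.int 27 = Function.update (ρ.int 27) k c → c ≤ I.P.length →
      (∀ i, (lev x ≤ i ∧ i < c) ↔ (lev x ≤ i ∧ i < lev y ∧
        s(x, y) ≠ s(I.P.getVert i, I.P.getVert (i + 1)))) →
      ∀ j : Fin m, j.1 < k + 1 → ∃ x y, Oriented I lev j x y ∧
        (ρ'.setInt 36 0 (k + 1)).wt 6 j = I.dr x + I.weight s(x, y) + I.ds y ∧
        (ρ'.setInt 36 0 (k + 1)).int 26 j = lev x ∧
        (ρ'.setInt 36 0 (k + 1)).int 27 j ≤ I.P.length ∧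
        ∀ i, (lev x ≤ i ∧ i < (ρ'.setInt 36 0 (k + 1)).int 27 j) ↔
          (lev x ≤ i ∧ i < lev y ∧ s(x, y) ≠ s(I.P.getVert i, I.P.getVert (i + 1))) := by
    intro c ρ' h6 h26 h27 hc hiff j hj
    by_cases e : j.1 = k
    · obtain rfl : j = ⟨k, hk⟩ := Fin.ext e
      exact ⟨x, y, hxy, by simp [h6], by simp [h26], by simpa [h27] using hc,
        by simpa [h27] using hiff⟩
    · simpa [h6, h26, h27, e, E6, E26, E27] using hInv j (by omega)
  have hpx : (I.P.getVert (lev x) : ℕ) = x ↔ I.P.getVert (lev x) = x := Fin.ext_iff.symm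
  have hpy : (I.P.getVert (lev y) : ℕ) = y ↔ I.P.getVert (lev y) = y := Fin.ext_iff.symm
  refine WP_cond (by simp [h60, h61, lx, ly, px, py]; omega) (fun h => ?_) (fun h => ?_)
  · simp [h60, h61, lx, ly, px, py, hpx, hpy] at h
    obtain ⟨g1, g2, g3⟩ := h
    refine WP_setInt (by simp [E36]; omega) (by simp [h60, lx]; omega) ?_
    refine ⟨by simp; omega, fin (lev x) _ (by simp [E36, h60, h61, d1, d2, d3])
      (by simp [E36, h60, lx]) (by simp [E36, h60, lx]) bx fun i => ?_⟩
    · constructor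
      · intro h; omega
      · rintro ⟨h1, h2, h3⟩
        obtain rfl : i = lev x := by omega
        rw [g3, g1, g2] at h3
        exact absurd rfl h3
  · simp [h60, h61, lx, ly, px, py, hpx, hpy] at h
    refine WP_setInt (by simp [E36]; omega) (by simp [h61, ly]; omega) ?_
    refine ⟨by simp; omega, fin (lev y) _ (by simp [E36, h60, h61, d1, d2, d3])
      (by simp [E36, h60, lx]) (by simp [E36, h61, ly]) bY fun i => ?_⟩
    · refine ⟨fun ⟨h1, h2⟩ => ⟨h1, h2, fun e => ?_⟩, fun h => ⟨h.1, h.2.1⟩⟩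
      have li := hl.getVert i (by omega)
      have li' := hl.getVert (i + 1) (by omega)
      rcases Sym2.eq_iff.1 e with ⟨rfl, rfl⟩ | ⟨rfl, rfl⟩
      · exact h (by rw [li]) (by rw [li']) (by omega)
      · omega

/-- The program for the edge-avoiding version. -/
def edgeAvoiding : Prog := .seq computeLevels (.seq edgeIntervals rowMinima)

theorem solvesEdgeAvoiding : SolvesEdgeAvoiding edgeAvoiding 10000 := by
  intro n m I
  have hp := I.length_lt
  have hp0 := I.length_pos
  have hI := I.hasInput_input
  suffices H : WP (10000 * (n + m)) edgeAvoiding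
      (fun t τ => t ≤ 10000 * (n + m) ∧ I.EdgeSolved τ) I.input from H
  refine WP_seq (WP_computeLevels hI (by omega) rfl rfl ?_)
  intro t1 σ1 lev ht1 hf1 hl hlev
  have hI1 : HasInput I σ1 := hI.congr (hf1.1 0 (by decide)) (hf1.1 1 (by decide))
    (hf1.1 2 (by decide)) (hf1.1 3 (by decide)) (hf1.2 0 (by decide)) (hf1.2 1 (by decide))
    (hf1.2 2 (by decide))
  refine WP_seq (WP_edgeIntervals hI1 (by omega) hl hlev ?_)
  intro t2 σ2 ht2 hf2 hint
  have hI2 : HasInput I σ2 := hI1.congr (hf2.1 0 (by decide)) (hf2.1 1 (by decide))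
    (hf2.1 2 (by decide)) (hf2.1 3 (by decide)) (hf2.2 0 (by decide)) (hf2.2 1 (by decide))
    (hf2.2 2 (by decide))
  refine WP_rowMinima (p := I.P.length) (m := m) hI2.p_eq hp0 hI2.m_eq rfl rfl (by omega)
    (by omega) (fun j hj => ?_) (fun j hj => ?_) ?_
  · obtain ⟨x, y, -, -, h26, -⟩ := hint ⟨j, hj⟩
    have := hl.le x
    simp only at h26
    omega
  · obtain ⟨x, y, -, -, -, h27, -⟩ := hint ⟨j, hj⟩
    exact h27
  intro t3 σ3 ht3 hf3 hmin
  refine ⟨by omega, fun i hi => ?_⟩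
  obtain ⟨hle, heq⟩ := hmin i hi
  refine hl.eq_wdist_deleteEdge hi (fun x y hadj hne hx hy => ?_) (heq.imp id ?_)
  · obtain ⟨j, hj⟩ := exists_edge hadj
    obtain ⟨x', y', hor, hval, h26, -, hiff⟩ := hint j
    obtain ⟨rfl, rfl⟩ := hor.eq_of_lt hj (by omega)
    rw [← hval]
    refine hle j j.2 ?_
    change σ2.int 26 j ≤ i ∧ i < σ2.int 27 j
    rw [h26]
    exact (hiff i).2 ⟨hx, hy, hne⟩
  · rintro ⟨j, hj, hs, e⟩
    obtain ⟨x, y, hor, hval, h26, -, hiff⟩ := hint ⟨j, hj⟩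
    simp only at h26 hval hiff
    change σ2.int 26 j ≤ i ∧ i < σ2.int 27 j at hs
    rw [h26] at hs
    obtain ⟨h1, h2, h3⟩ := (hiff i).1 hs
    exact ⟨x, y, hor.adj, h3, h1, h2, e.trans hval⟩

end

/-! ### The query graph as a list of edges -/

section

open RPInstance

/-- A duplicate-free list of non-loops with weights is a listed graph. -/
theorem exists_listedGraph {n l : ℕ} (F G : Fin l → Fin n) (ω : Fin l → ℝ≥0)
    (hne : ∀ e, F e ≠ G e) (hinj : Function.Injective fun e => s(F e, G e)) :
    ∃ D : ListedGraph n l, D.fst = F ∧ D.snd = G ∧ ∀ e, D.weight s(F e, G e) = ω e := by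
  classical
  refine ⟨⟨SimpleGraph.fromEdgeSet (Set.range fun e => s(F e, G e)),
    fun p => if h : ∃ e, s(F e, G e) = p then ω h.choose else 0, F, G, hinj, ?_⟩, rfl, rfl, ?_⟩
  · rw [SimpleGraph.edgeSet_fromEdgeSet, eq_comm, sdiff_eq_left, Set.disjoint_right]
    rintro p hp ⟨e, rfl⟩
    exact hne e (by simpa using hp)
  · intro e
    have h : ∃ e', s(F e', G e') = s(F e, G e) := ⟨e, rfl⟩
    simp only [h, dite_true]
    rw [hinj h.choose_spec]

variable {n m : ℕ} {I : RPInstance n m}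

/-- The state of the construction of the query graph after `k` edges of `G`: the `e`-th of the `l`
listed edges joins `f e` and `g e` and has weight `ω e`, and if there is an edge from `r` to the
node `z`, then it is listed at the position `slot z - 1`; otherwise `slot z = 0`. -/
structure QueryList (I : RPInstance n m) (lev : Fin n → ℕ) (k l : ℕ) (f g : ℕ → ℕ)
    (ω : ℕ → ℝ≥0∞) (slot : ℕ → ℕ) : Prop where
  le : l ≤ k
  sound : ∀ e < l, ∃ a b : Fin n, f e = a ∧ g e = b ∧ b ∉ I.P.support ∧
    ((a ∉ I.P.support ∧ lev a = lev b ∧ ω e = I.weight s(a, b) ∧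
        ∃ j : Fin m, j.1 < k ∧ s(I.fst j, I.snd j) = s(a, b)) ∨
      (a = I.r ∧ slot b = e + 1 ∧
        ∃ x, I.graph.Adj x b ∧ lev x < lev b ∧ ω e = I.dr x + I.weight s(x, b)))
  inj : ∀ e < l, ∀ e' < l, s(f e, g e) = s(f e', g e') → e = e'
  slot_le : ∀ z : Fin n, slot z ≤ l
  slot_eq : ∀ z : Fin n, slot z ≠ 0 → f (slot z - 1) = I.r ∧ g (slot z - 1) = z
  inner : ∀ j : Fin m, j.1 < k → ∀ a b, s(I.fst j, I.snd j) = s(a, b) → lev a = lev b →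
    a ∉ I.P.support → b ∉ I.P.support → ∃ e < l, s(f e, g e) = s(a.1, b.1)
  attach : ∀ j : Fin m, j.1 < k → ∀ x z, s(I.fst j, I.snd j) = s(x, z) → lev x < lev z →
    z ∉ I.P.support → slot z ≠ 0 ∧ ω (slot z - 1) ≤ I.dr x + I.weight s(x, z)

namespace QueryList

variable {lev : Fin n → ℕ} {k l : ℕ} {f g : ℕ → ℕ} {ω : ℕ → ℝ≥0∞} {slot : ℕ → ℕ}

theorem zero (f g : ℕ → ℕ) (ω : ℕ → ℝ≥0∞) : QueryList I lev 0 0 f g ω 0 where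
  le := le_rfl
  sound := by simp
  inj := by simp
  slot_le := by simp
  slot_eq := by simp
  inner := by simp
  attach := by simp

/-- An edge that ends on `P` at its upper end, or lies within a level and touches `P`, contributes
nothing. -/
theorem skip (h : QueryList I lev k l f g ω slot) (hk : k < m) {x y : Fin n}
    (hxy : Oriented I lev ⟨k, hk⟩ x y)
    (hP : y ∈ I.P.support ∨ (lev x = lev y ∧ x ∈ I.P.support)) :
    QueryList I lev (k + 1) l f g ω slot where
  le := h.le.trans (Nat.le_succ k)
  sound e he := by
    obtain ⟨a, b, h1, h2, h3, h4⟩ := h.sound e he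
    refine ⟨a, b, h1, h2, h3, h4.imp (fun ⟨c1, c2, c3, j, c4, c5⟩ => ⟨c1, c2, c3, j, ?_, c5⟩) id⟩
    omega
  inj := h.inj
  slot_le := h.slot_le
  slot_eq := h.slot_eq
  inner j hj a b hab he ha hb := by
    by_cases e : j.1 = k
    · obtain rfl : j = ⟨k, hk⟩ := Fin.ext e
      rcases Sym2.eq_iff.1 (hxy.1.symm.trans hab) with ⟨rfl, rfl⟩ | ⟨rfl, rfl⟩ <;> tauto
    · exact h.inner j (by omega) a b hab he ha hb
  attach j hj a b hab hlt hb := by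
    by_cases e : j.1 = k
    · obtain rfl : j = ⟨k, hk⟩ := Fin.ext e
      obtain ⟨rfl, rfl⟩ := hxy.eq_of_lt hab hlt
      rcases hP with hP | hP
      · exact absurd hP hb
      · omega
    · exact h.attach j (by omega) a b hab hlt hb

theorem slot_sub_one_lt (h : QueryList I lev k l f g ω slot) {z : Fin n} (hz : slot z ≠ 0) :
    slot z - 1 < l := by
  have := h.slot_le z
  omega

/-- An edge within a level and off `P` is listed. -/
theorem add_inner (h : QueryList I lev k l f g ω slot) (hk : k < m) {x y : Fin n}
    (hxy : Oriented I lev ⟨k, hk⟩ x y) (he : lev x = lev y) (hx : x ∉ I.P.support)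
    (hy : y ∉ I.P.support) :
    QueryList I lev (k + 1) (l + 1) (Function.update f l x) (Function.update g l y)
      (Function.update ω l (I.weight s(x, y))) slot := by
  have hnew : ∀ e < l, s(f e, g e) ≠ s(x.1, y.1) := by
    intro e hel heq
    obtain ⟨a, b, h1, h2, h3, ⟨h4, h5, h6, j, h7, h8⟩ | ⟨rfl, -⟩⟩ := h.sound e hel
    · have : s(a, b) = s(x, y) := by
        rw [h1, h2] at heq
        exact Sym2.map.injective Fin.val_injective heq
      have := I.edge_injective ((h8.trans this).trans hxy.1.symm)
      subst this
      simp at h7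
    · rw [h1, h2] at heq
      rcases Sym2.eq_iff.1 heq with ⟨h, -⟩ | ⟨h, -⟩
      · exact hx (Fin.ext h ▸ I.P.start_mem_support)
      · exact hy (Fin.ext h ▸ I.P.start_mem_support)
  have hs : ∀ z : Fin n, slot z ≠ 0 → slot z - 1 ≠ l := fun z hz => (h.slot_sub_one_lt hz).ne
  refine ⟨by have := h.le; omega, fun e hel => ?_, fun e hel e' hel' heq => ?_,
    fun z => (h.slot_le z).trans (Nat.le_succ l), fun z hz => ?_, fun j hj a b hab hlev ha hb => ?_,
    fun j hj a b hab hlt hb => ?_⟩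
  · by_cases e0 : e = l
    · subst e0
      exact ⟨x, y, by simp, by simp, hy, .inl ⟨hx, he, by simp, ⟨k, hk⟩, by simp, hxy.1⟩⟩
    · obtain ⟨a, b, h1, h2, h3, h4⟩ := h.sound e (by omega)
      refine ⟨a, b, by simpa [e0] using h1, by simpa [e0] using h2, h3,
        h4.imp (fun ⟨c1, c2, c3, j, c4, c5⟩ => ⟨c1, c2, by simpa [e0] using c3, j, by omega, c5⟩)
        (by simp [e0])⟩
  · by_cases e0 : e = l <;> by_cases e1 : e' = l
    · omega
    · subst e0
      simp only [Function.update_self, ne_eq, e1, not_false_eq_true, Function.update_of_ne] at heq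
      exact absurd heq.symm (hnew e' (by omega))
    · subst e1
      simp only [Function.update_self, ne_eq, e0, not_false_eq_true, Function.update_of_ne] at heq
      exact absurd heq (hnew e (by omega))
    · simp only [ne_eq, e0, e1, not_false_eq_true, Function.update_of_ne] at heq
      exact h.inj e (by omega) e' (by omega) heq
  · rw [Function.update_of_ne (hs z hz), Function.update_of_ne (hs z hz)]
    exact h.slot_eq z hz
  · by_cases e : j.1 = k
    · obtain rfl : j = ⟨k, hk⟩ := Fin.ext e
      refine ⟨l, by omega, ?_⟩
      simpa using congrArg (Sym2.map Fin.val) (hxy.1.symm.trans hab)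
    · obtain ⟨e, h1, h2⟩ := h.inner j (by omega) a b hab hlev ha hb
      exact ⟨e, by omega, by simpa [h1.ne] using h2⟩
  · by_cases e : j.1 = k
    · obtain rfl : j = ⟨k, hk⟩ := Fin.ext e
      obtain ⟨rfl, rfl⟩ := hxy.eq_of_lt hab hlt
      omega
    · obtain ⟨h1, h2⟩ := h.attach j (by omega) a b hab hlt hb
      exact ⟨h1, by rwa [Function.update_of_ne (hs b h1)]⟩

/-- The first edge from a lower level to `y` gives rise to an edge from `r` to `y`. -/
theorem add_attach (h : QueryList I lev k l f g ω slot) (hk : k < m) {x y : Fin n}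
    (hxy : Oriented I lev ⟨k, hk⟩ x y) (hlt : lev x < lev y) (hy : y ∉ I.P.support)
    (hsy : slot y = 0) :
    QueryList I lev (k + 1) (l + 1) (Function.update f l I.r) (Function.update g l y)
      (Function.update ω l (I.dr x + I.weight s(x, y))) (Function.update slot y (l + 1)) := by
  have hnew : ∀ e < l, s(f e, g e) ≠ s(I.r.1, y.1) := by
    intro e hel heq
    obtain ⟨a, b, h1, h2, h3, ⟨h4, -⟩ | ⟨h4, h5, -⟩⟩ := h.sound e hel
    all_goals
      rw [h1, h2] at heq
      rcases Sym2.eq_iff.1 heq with ⟨e1, e2⟩ | ⟨e1, e2⟩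
    · exact h4 (Fin.ext e1 ▸ I.P.start_mem_support)
    · exact h3 (Fin.ext e2 ▸ I.P.start_mem_support)
    · rw [e2] at h5; omega
    · exact h3 (Fin.ext e2 ▸ I.P.start_mem_support)
  have hs : ∀ z : Fin n, slot z ≠ 0 → slot z - 1 ≠ l := fun z hz => (h.slot_sub_one_lt hz).ne
  refine ⟨by have := h.le; omega, fun e hel => ?_, fun e hel e' hel' heq => ?_,
    fun z => ?_, fun z hz => ?_, fun j hj a b hab hlev ha hb => ?_,
    fun j hj a b hab hlt' hb => ?_⟩
  · by_cases e0 : e = l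
    · subst e0
      exact ⟨I.r, y, by simp, by simp, hy, .inr ⟨rfl, by simp, x, hxy.adj, hlt, by simp⟩⟩
    · obtain ⟨a, b, h1, h2, h3, h4⟩ := h.sound e (by omega)
      refine ⟨a, b, by simpa [e0] using h1, by simpa [e0] using h2, h3,
        h4.imp (fun ⟨c1, c2, c3, j, c4, c5⟩ => ⟨c1, c2, by simpa [e0] using c3, j, by omega, c5⟩)
        fun ⟨c1, c2, c3⟩ => ⟨c1, ?_, by simpa [e0] using c3⟩⟩
      have : b.1 ≠ y := fun e => by rw [e] at c2; omega
      rwa [Function.update_of_ne this]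
  · by_cases e0 : e = l <;> by_cases e1 : e' = l
    · omega
    · subst e0
      simp only [Function.update_self, ne_eq, e1, not_false_eq_true, Function.update_of_ne] at heq
      exact absurd heq.symm (hnew e' (by omega))
    · subst e1
      simp only [Function.update_self, ne_eq, e0, not_false_eq_true, Function.update_of_ne] at heq
      exact absurd heq (hnew e (by omega))
    · simp only [ne_eq, e0, e1, not_false_eq_true, Function.update_of_ne] at heq
      exact h.inj e (by omega) e' (by omega) heq
  · by_cases e : z.1 = y
    · simp [e]
    · rw [Function.update_of_ne e]
      exact (h.slot_le z).trans (Nat.le_succ l)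
  · by_cases e : z.1 = y
    · simp [e]
    · rw [Function.update_of_ne e] at hz ⊢
      rw [Function.update_of_ne (hs z hz), Function.update_of_ne (hs z hz)]
      exact h.slot_eq z hz
  · by_cases e : j.1 = k
    · obtain rfl : j = ⟨k, hk⟩ := Fin.ext e
      rcases Sym2.eq_iff.1 (hxy.1.symm.trans hab) with ⟨rfl, rfl⟩ | ⟨rfl, rfl⟩ <;> omega
    · obtain ⟨e, h1, h2⟩ := h.inner j (by omega) a b hab hlev ha hb
      exact ⟨e, by omega, by simpa [h1.ne] using h2⟩
  · by_cases e : j.1 = k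
    · obtain rfl : j = ⟨k, hk⟩ := Fin.ext e
      obtain ⟨rfl, rfl⟩ := hxy.eq_of_lt hab hlt'
      simp
    · obtain ⟨h1, h2⟩ := h.attach j (by omega) a b hab hlt' hb
      have : b.1 ≠ y := fun e => h1 (by rw [e, hsy])
      rw [Function.update_of_ne this]
      exact ⟨h1, by rwa [Function.update_of_ne (hs b h1)]⟩

/-- A further edge from a lower level to `y` may decrease the weight of the edge from `r` to `y`. -/
theorem update_attach (h : QueryList I lev k l f g ω slot) (hk : k < m) {x y : Fin n}
    (hxy : Oriented I lev ⟨k, hk⟩ x y) (hlt : lev x < lev y)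
    (hsy : slot y ≠ 0) {c : ℝ≥0∞}
    (hc : c = min (ω (slot y - 1)) (I.dr x + I.weight s(x, y))) :
    QueryList I lev (k + 1) l f g (Function.update ω (slot y - 1) c) slot := by
  obtain ⟨q1, q2⟩ := h.slot_eq y hsy
  refine ⟨h.le.trans (Nat.le_succ k), fun e hel => ?_, h.inj, h.slot_le, h.slot_eq,
    fun j hj a b hab hlev ha hb => ?_, fun j hj a b hab hlt' hb => ?_⟩
  · obtain ⟨a, b, h1, h2, h3, h4⟩ := h.sound e hel
    refine ⟨a, b, h1, h2, h3, ?_⟩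
    by_cases e0 : e = slot y - 1
    · subst e0
      obtain rfl : a = I.r := Fin.ext (h1.symm.trans q1)
      obtain rfl : b = y := Fin.ext (h2.symm.trans q2)
      rcases h4 with ⟨h4, -⟩ | ⟨-, h5, x', h6, h7, h8⟩
      · exact absurd I.P.start_mem_support h4
      · refine .inr ⟨rfl, h5, ?_⟩
        rcases min_choice (ω (slot b - 1)) (I.dr x + I.weight s(x, b)) with hm | hm
        · exact ⟨x', h6, h7, by rw [Function.update_self, hc, hm, h8]⟩
        · exact ⟨x, hxy.adj, hlt, by rw [Function.update_self, hc, hm]⟩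
    · rw [Function.update_of_ne e0]
      refine h4.imp (fun ⟨c1, c2, c3, j, c4, c5⟩ => ⟨c1, c2, c3, j, by omega, c5⟩) id
  · by_cases e : j.1 = k
    · obtain rfl : j = ⟨k, hk⟩ := Fin.ext e
      rcases Sym2.eq_iff.1 (hxy.1.symm.trans hab) with ⟨rfl, rfl⟩ | ⟨rfl, rfl⟩ <;> omega
    · exact h.inner j (by omega) a b hab hlev ha hb
  · by_cases e : j.1 = k
    · obtain rfl : j = ⟨k, hk⟩ := Fin.ext e
      obtain ⟨rfl, rfl⟩ := hxy.eq_of_lt hab hlt'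
      exact ⟨hsy, by simp [hc]⟩
    · obtain ⟨h1, h2⟩ := h.attach j (by omega) a b hab hlt' hb
      refine ⟨h1, ?_⟩
      by_cases e0 : slot b - 1 = slot y - 1
      · rw [e0, Function.update_self, hc]
        exact (min_le_left _ _).trans (e0 ▸ h2)
      · rwa [Function.update_of_ne e0]

/-- A complete list is a graph with the distances required of the query graph. -/
theorem exists_graph (h : QueryList I lev m l f g ω slot) (hl : I.IsLevel lev) :
    ∃ D : ListedGraph n l, (∀ e : Fin l, f e = D.fst e ∧ g e = D.snd e ∧
      ω e = D.weight s(D.fst e, D.snd e)) ∧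
      IsQueryDist I lev (wdist D.graph D.weight I.r) := by
  choose F G hF hG hoff hsd using fun e : Fin l => h.sound e e.2
  have hr : I.r ∈ I.P.support := I.P.start_mem_support
  have hfin : ∀ e : Fin l, ω e ≠ ⊤ := by
    intro e
    rcases hsd e with ⟨-, -, h3, -⟩ | ⟨-, -, x, h3, h4, h5⟩
    · rw [h3]; exact ENNReal.coe_ne_top
    · rw [h5]
      exact ENNReal.add_ne_top.2
        ⟨dr_ne_top_of_adj (hl.reachable _ (by omega)) h3.symm, ENNReal.coe_ne_top⟩
  obtain ⟨D, rfl, rfl, hD⟩ := exists_listedGraph F G (fun e => (ω e).toNNReal)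
    (fun e heq => by
      rcases hsd e with ⟨-, -, -, j, -, h4⟩ | ⟨h3, -⟩
      · have := I.adj_fst_snd j
        rw [← SimpleGraph.mem_edgeSet, h4, heq] at this
        exact this.ne rfl
      · exact hoff e (by rw [← heq, h3]; exact hr))
    (fun e e' heq => Fin.ext (h.inj e e.2 e' e'.2 (by
      rw [hF, hG, hF, hG]
      exact congrArg (Sym2.map Fin.val) heq)))
  have hD' : ∀ e : Fin l, (D.weight s(D.fst e, D.snd e) : ℝ≥0∞) = ω e := fun e => by
    rw [hD, ENNReal.coe_toNNReal (hfin e)]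
  have hadj : ∀ e : Fin l, D.graph.Adj (D.fst e) (D.snd e) := fun e => by
    rw [← SimpleGraph.mem_edgeSet, ← D.edge_range]; exact ⟨e, rfl⟩
  refine ⟨D, fun e => ⟨hF e, hG e, (hD' e).symm⟩, hl.isQueryDist D ?_ ?_ ?_⟩
  · intro a b hab
    rw [← SimpleGraph.mem_edgeSet, ← D.edge_range] at hab
    obtain ⟨e, he⟩ := hab
    simp only at he
    have hw := hD' e
    rcases hsd e with ⟨h1, h2, h3, j, -, h4⟩ | ⟨h1, -, x, h2, h3, h4⟩
    · left
      have hG' := I.adj_fst_snd j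
      rw [← SimpleGraph.mem_edgeSet, h4, SimpleGraph.mem_edgeSet] at hG'
      rw [h3, ENNReal.coe_inj] at hw
      have hoffe := hoff e
      rcases Sym2.eq_iff.1 he with ⟨rfl, rfl⟩ | ⟨rfl, rfl⟩
      · exact ⟨h1, hoffe, hG', h2, hw⟩
      · rw [Sym2.eq_swap]
        exact ⟨hoffe, h1, hG'.symm, h2.symm, hw⟩
    · right
      rw [h1] at he hw
      exact ⟨_, hoff e, he.symm, x, h2, h3, hw.trans h4⟩
  · intro a b hab hlev ha hb
    obtain ⟨j, hj⟩ := exists_edge hab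
    obtain ⟨e, he, heq⟩ := h.inner j j.2 a b hj hlev ha hb
    have hw := hD' ⟨e, he⟩
    have hA := hadj ⟨e, he⟩
    have heq' : s(D.fst ⟨e, he⟩, D.snd ⟨e, he⟩) = s(a, b) := by
      have h1 := hF ⟨e, he⟩
      have h2 := hG ⟨e, he⟩
      simp only at h1 h2
      rw [h1, h2] at heq
      exact Sym2.map.injective Fin.val_injective heq
    rw [← SimpleGraph.mem_edgeSet, heq'] at hA
    refine ⟨hA, ?_⟩
    rw [heq'] at hw
    rcases hsd ⟨e, he⟩ with ⟨-, -, h3, -⟩ | ⟨h1, -⟩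
    · rw [h3, heq', ENNReal.coe_inj] at hw
      exact hw
    · rw [h1] at heq'
      rcases Sym2.eq_iff.1 heq' with ⟨rfl, -⟩ | ⟨rfl, -⟩
      · exact absurd hr ha
      · exact absurd hr hb
  · intro x z hxz hlt hz
    obtain ⟨j, hj⟩ := exists_edge hxz
    obtain ⟨h1, h2⟩ := h.attach j j.2 x z hj hlt hz
    obtain ⟨h3, h4⟩ := h.slot_eq z h1
    have he := h.slot_sub_one_lt h1
    have e1 : D.fst ⟨_, he⟩ = I.r := Fin.ext ((hF ⟨_, he⟩).symm.trans h3)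
    have e2 : D.snd ⟨_, he⟩ = z := Fin.ext ((hG ⟨_, he⟩).symm.trans h4)
    have hw := hD' ⟨_, he⟩
    have hA := hadj ⟨_, he⟩
    rw [e1, e2] at hw hA
    exact ⟨hA, hw.trans_le h2⟩

end QueryList

end

/-! ### The programs for the node-avoiding version -/

section

open RPInstance

variable {n m W : ℕ} {I : RPInstance n m} {Q : ℕ → State → Prop} {σ : State}

/-- For each edge `xy` with `lev x ≤ lev y`, the interval `(lev x, lev y)` of the inner nodes of
`P` that it bypasses, and the least weight of a walk from `r` to `s` through `xy`. -/
def nodeIntervals : Prog :=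
  forLoop 36 0 1
    (.seq orientEdge
      (.seq (.setWt 6 (scal 36) (.add (.add (.cell 1 (scal 60)) (.cell 0 (scal 36)))
          (.cell 2 (scal 61))))
        (.seq (.setInt 26 (scal 36) (.add (.cell 7 (scal 60)) (.const 1)))
          (.setInt 27 (scal 36) (.cell 7 (scal 61))))))

theorem WP_nodeIntervals {lev : Fin n → ℕ} (hI : HasInput I σ) (hW : 4 * (n + m) + 16 < W)
    (hl : I.IsLevel lev) (hlev : ∀ v : Fin n, σ.int 7 v = lev v)
    (hQ : ∀ t τ, t ≤ 150 * m + 10 → Frame nodeIntervals σ τ →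
      (∀ j : Fin m, ∃ x y, Oriented I lev j x y ∧
        τ.wt 6 j = I.dr x + I.weight s(x, y) + I.ds y ∧ τ.int 26 j = lev x + 1 ∧
        τ.int 27 j = lev y) → Q t τ) :
    WP W nodeIntervals Q σ := by
  refine WP_for_const (C := 150) (fun k τ => ∀ j : Fin m, j.1 < k → ∃ x y, Oriented I lev j x y ∧
      τ.wt 6 j = I.dr x + I.weight s(x, y) + I.ds y ∧ τ.int 26 j = lev x + 1 ∧
      τ.int 27 j = lev y)
    (by decide) (by decide) (by decide) hI.m_eq (by omega) (by omega) (by simp) ?_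
    fun t τ ht hf hInv => hQ t τ ht hf fun j => hInv j j.2
  intro k τ hk hf hx hInv
  have J := hI.congr (hf.1 0 (by decide)) (hf.1 1 (by decide)) (hf.1 2 (by decide))
    (hf.1 3 (by decide)) (hf.2 0 (by decide)) (hf.2 1 (by decide)) (hf.2 2 (by decide))
  have e7 : ∀ v : Fin n, τ.int 7 v = lev v := by rw [hf.1 7 (by decide)]; exact hlev
  refine WP_seq (WP_orientEdge J hW hl e7 ⟨k, hk⟩ hx ?_)
  intro t ρ x y ht hfρ hxy h60 h61
  have Jρ := J.congr (hfρ.1 0 (by decide)) (hfρ.1 1 (by decide)) (hfρ.1 2 (by decide))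
    (hfρ.1 3 (by decide)) (hfρ.2 0 (by decide)) (hfρ.2 1 (by decide)) (hfρ.2 2 (by decide))
  have E36 : ρ.int 36 0 = k := by rw [hfρ.1 36 (by decide)]; exact hx
  have E26 : ρ.int 26 = τ.int 26 := hfρ.1 26 (by decide)
  have E27 : ρ.int 27 = τ.int 27 := hfρ.1 27 (by decide)
  have E6 : ρ.wt 6 = τ.wt 6 := hfρ.2 6 (by decide)
  have lx : ρ.int 7 x = lev x := by rw [hfρ.1 7 (by decide)]; exact e7 x
  have ly : ρ.int 7 y = lev y := by rw [hfρ.1 7 (by decide)]; exact e7 y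
  have bx := hl.le x
  have bY := hl.le y
  have hp := I.length_lt
  have cx := x.2
  have cy := y.2
  have d1 := Jρ.dr_eq x
  have d2 := Jρ.ds_eq y
  have d3 : ρ.wt 0 k = I.weight s(x, y) := by rw [← hxy.1]; exact Jρ.weight_eq ⟨k, hk⟩
  refine WP_seq (WP_setWt (by simp [E36]; omega) (by simp [E36, h60, h61]; omega) ?_)
  refine WP_seq (WP_setInt (by simp [E36]; omega) (by simp [h60, lx]; omega) ?_)
  refine WP_setInt (by simp [E36]; omega) (by simp [h61, ly]; omega) ⟨by simp; omega, fun j hj => ?_⟩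
  by_cases e : j.1 = k
  · obtain rfl : j = ⟨k, hk⟩ := Fin.ext e
    exact ⟨x, y, hxy, by simp [E36, h60, h61, d1, d2, d3], by simp [E36, h60, lx],
      by simp [E36, h61, ly]⟩
  · simpa [E36, e, E6, E26, E27] using hInv j (by omega)

/-- Appends an edge to the list of the edges of the query graph. -/
def addEdge (x y : IExp) (w : WExp) : Prog :=
  .seq (.setInt 5 (.cell 4 (.const 1)) x)
    (.seq (.setInt 6 (.cell 4 (.const 1)) y)
      (.seq (.setWt 4 (.cell 4 (.const 1)) w)
        (.setInt 4 (.const 1) (.add (.cell 4 (.const 1)) (.const 1)))))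

/-- Lists the edges of the query graph.  The position of the edge from `r` to `z`, increased by
one, is kept in cell `z` of array 12. -/
def buildQuery : Prog :=
  .seq (.setInt 4 (.const 0) (.cell 0 (.const 0)))
    (.seq (.setInt 4 (.const 1) (.const 0))
      (.seq (.setInt 4 (.const 2) (.cell 3 (.const 0)))
        (forLoop 36 0 1
          (.seq orientEdge
            (.cond (.eq (.cell 3 (.cell 7 (scal 61))) (scal 61))
              .skip
              (.cond (.ile (.cell 7 (scal 61)) (.cell 7 (scal 60)))
                (.cond (.eq (.cell 3 (.cell 7 (scal 60))) (scal 60))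
                  .skip
                  (addEdge (scal 60) (scal 61) (.cell 0 (scal 36))))
                (.cond (.ile (.cell 12 (scal 61)) (.const 0))
                  (.seq (.setInt 12 (scal 61) (.add (.cell 4 (.const 1)) (.const 1)))
                    (addEdge (.cell 3 (.const 0)) (scal 61)
                      (.add (.cell 1 (scal 60)) (.cell 0 (scal 36)))))
                  (.cond (.wle (.cell 4 (.sub (.cell 12 (scal 61)) (.const 1)))
                      (.add (.cell 1 (scal 60)) (.cell 0 (scal 36))))
                    .skip
                    (.setWt 4 (.sub (.cell 12 (scal 61)) (.const 1))
                      (.add (.cell 1 (scal 60)) (.cell 0 (scal 36))))))))))))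

theorem WP_buildQuery {lev : Fin n → ℕ} (hI : HasInput I σ) (hW : 4 * (n + m) + 16 < W)
    (hl : I.IsLevel lev) (hlev : ∀ v : Fin n, σ.int 7 v = lev v) (h12 : σ.int 12 = 0)
    (hQ : ∀ t τ l, t ≤ 200 * m + 50 → Frame buildQuery σ τ → τ.int 4 0 = n → τ.int 4 1 = l →
      τ.int 4 2 = I.r → QueryList I lev m l (τ.int 5) (τ.int 6) (τ.wt 4) (τ.int 12) → Q t τ) :
    WP W buildQuery Q σ := by
  suffices H : WP W buildQuery (fun t τ => t ≤ 200 * m + 50 ∧ ∃ l, τ.int 4 0 = n ∧ τ.int 4 1 = l ∧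
      τ.int 4 2 = I.r ∧ QueryList I lev m l (τ.int 5) (τ.int 6) (τ.wt 4) (τ.int 12)) σ from
    H.mono fun t τ hf ⟨h1, l, h2, h3, h4, h5⟩ => hQ t τ l h1 hf h2 h3 h4 h5
  have hp := I.length_lt
  have hr : σ.int 3 0 = I.r := by simpa using hI.path_eq 0 (by omega)
  have cr := I.r.2
  refine WP_seq (WP_setInt (by simp; omega) (by simp [hI.n_eq]; omega) ?_)
  refine WP_seq (WP_setInt (by simp; omega) (by simp; omega) ?_)
  refine WP_seq (WP_setInt (by simp; omega) (by simp [hr]; omega) ?_)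
  refine WP_for_const (C := 200) (fun k τ => ∃ l, τ.int 4 0 = n ∧ τ.int 4 1 = l ∧
      τ.int 4 2 = I.r ∧ QueryList I lev k l (τ.int 5) (τ.int 6) (τ.wt 4) (τ.int 12))
    (by decide) (by decide) (by decide) (by simpa using hI.m_eq) (by omega) (by omega)
    ⟨0, by simp [hI.n_eq], by simp, by simp [hr], by simpa [h12] using .zero _ _ _⟩ ?_
    fun t τ ht hf hInv => ⟨by simp; omega, hInv⟩
  rintro k τ hk hf hx ⟨l, g0, g1, g2, hL⟩
  have J := hI.congr (by simpa using hf.1 0 (by decide)) (by simpa using hf.1 1 (by decide))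
    (by simpa using hf.1 2 (by decide)) (by simpa using hf.1 3 (by decide))
    (by simpa using hf.2 0 (by decide)) (by simpa using hf.2 1 (by decide))
    (by simpa using hf.2 2 (by decide))
  have e7 : ∀ v : Fin n, τ.int 7 v = lev v := by rw [hf.1 7 (by decide)]; simpa using hlev
  refine WP_seq (WP_orientEdge J hW hl e7 ⟨k, hk⟩ hx ?_)
  intro t ρ x y ht hfρ hxy h60 h61
  have Jρ := J.congr (hfρ.1 0 (by decide)) (hfρ.1 1 (by decide)) (hfρ.1 2 (by decide))
    (hfρ.1 3 (by decide)) (hfρ.2 0 (by decide)) (hfρ.2 1 (by decide)) (hfρ.2 2 (by decide))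
  have E36 : ρ.int 36 0 = k := by rw [hfρ.1 36 (by decide)]; exact hx
  rw [← hfρ.1 4 (by decide)] at g0 g1 g2
  rw [← hfρ.1 5 (by decide), ← hfρ.1 6 (by decide), ← hfρ.1 12 (by decide),
    ← hfρ.2 4 (by decide)] at hL
  have lx : ρ.int 7 x = lev x := by rw [hfρ.1 7 (by decide)]; exact e7 x
  have ly : ρ.int 7 y = lev y := by rw [hfρ.1 7 (by decide)]; exact e7 y
  have bx := hl.le x
  have bY := hl.le y
  have cx := x.2
  have cy := y.2
  have hle := hL.le
  have px := Jρ.path_eq _ bx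
  have py := Jρ.path_eq _ bY
  have pr : ρ.int 3 0 = I.r := by simpa using Jρ.path_eq 0 (by omega)
  have cpx := (I.P.getVert (lev x)).2
  have cpy := (I.P.getVert (lev y)).2
  have d1 := Jρ.dr_eq x
  have d3 : ρ.wt 0 k = I.weight s(x, y) := by rw [← hxy.1]; exact Jρ.weight_eq ⟨k, hk⟩
  have hpx : (I.P.getVert (lev x) : ℕ) = x ↔ x ∈ I.P.support :=
    Fin.ext_iff.symm.trans (hl.mem_support_iff x).symm
  have hpy : (I.P.getVert (lev y) : ℕ) = y ↔ y ∈ I.P.support :=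
    Fin.ext_iff.symm.trans (hl.mem_support_iff y).symm
  have hsl := hL.slot_le y
  have hlo := hxy.2
  refine WP_cond (by simp [h61, ly, py]; omega) (fun h => ?_) (fun hy => ?_)
  · simp [h61, ly, py, hpy] at h
    exact WP_skip ⟨by simp; omega, l, by simpa using g0, by simpa using g1, by simpa using g2,
      by simpa using hL.skip hk hxy (.inl h)⟩
  simp [h61, ly, py, hpy] at hy
  refine WP_cond (by simp [h60, h61, lx, ly]; omega) (fun he => ?_) (fun hlt => ?_)
  · simp [h60, h61, lx, ly] at he
    have he' : lev x = lev y := le_antisymm hlo he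
    refine WP_cond (by simp [h60, lx, px]; omega) (fun h => ?_) (fun h => ?_)
    · simp [h60, lx, px, hpx] at h
      exact WP_skip ⟨by simp; omega, l, by simpa using g0, by simpa using g1, by simpa using g2,
        by simpa using hL.skip hk hxy (.inr ⟨he', h⟩)⟩
    · simp [h60, lx, px, hpx] at h
      refine WP_seq (WP_setInt (by simp [g1]; omega) (by simp [h60]; omega) ?_)
      refine WP_seq (WP_setInt (by simp [g1]; omega) (by simp [h61]; omega) ?_)
      refine WP_seq (WP_setWt (by simp [g1]; omega) (by simp [E36]; omega) ?_)
      refine WP_setInt (by simp; omega) (by simp [g1]; omega) ⟨by simp; omega, l + 1,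
        by simpa using g0, by simp [g1], by simpa using g2, ?_⟩
      simpa [g1, h60, h61, E36, d3] using hL.add_inner hk hxy he' h hy
  · simp [h60, h61, lx, ly] at hlt
    refine WP_cond (by simp [h61]; omega) (fun h => ?_) (fun h => ?_)
    · simp [h61] at h
      refine WP_seq (WP_setInt (by simp [h61]; omega) (by simp [g1]; omega) ?_)
      refine WP_seq (WP_setInt (by simp [g1]; omega) (by simp [pr]; omega) ?_)
      refine WP_seq (WP_setInt (by simp [g1]; omega) (by simp [h61]; omega) ?_)
      refine WP_seq (WP_setWt (by simp [g1]; omega) (by simp [E36, h60]; omega) ?_)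
      refine WP_setInt (by simp; omega) (by simp [g1]; omega) ⟨by simp; omega, l + 1,
        by simpa using g0, by simp [g1], by simpa using g2, ?_⟩
      simpa [g1, h60, h61, E36, d3, d1, pr] using hL.add_attach hk hxy hlt hy h
    · simp [h61] at h
      refine WP_cond (by simp [h60, h61, E36]; omega) (fun hc => ?_) (fun hc => ?_)
      · simp [h60, h61, E36, d1, d3] at hc
        have := hL.update_attach hk hxy hlt h (min_eq_left hc).symm
        rw [Function.update_eq_self] at this
        exact WP_skip ⟨by simp; omega, l, by simpa using g0, by simpa using g1, by simpa using g2,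
          by simpa using this⟩
      · simp [h60, h61, E36, d1, d3] at hc
        refine WP_setWt (by simp [h61]; omega) (by simp [h60, E36]; omega) ⟨by simp; omega, l,
          by simpa using g0, by simpa using g1, by simpa using g2, ?_⟩
        simpa [h60, h61, E36, d1, d3] using
          hL.update_attach hk hxy hlt h (min_eq_right hc.le).symm

/-- Takes the walks into account that leave the level of the deleted node through an edge `xy`
with `lev x < lev y`, where `x` is not on `P`, using the distances in the query graph. -/
def includeQuery : Prog :=
  forLoop 36 0 1
    (.seq orientEdge
      (.cond (.and (.not (.eq (.cell 3 (.cell 7 (scal 60))) (scal 60)))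
          (.not (.ile (.cell 7 (scal 61)) (.cell 7 (scal 60)))))
        (.cond (.wle (.cell 3 (.cell 7 (scal 60)))
            (.add (.add (.cell 5 (scal 60)) (.cell 0 (scal 36))) (.cell 2 (scal 61))))
          .skip
          (.setWt 3 (.cell 7 (scal 60))
            (.add (.add (.cell 5 (scal 60)) (.cell 0 (scal 36))) (.cell 2 (scal 61)))))
        .skip))

theorem WP_includeQuery {lev : Fin n → ℕ} {d₀ : Fin n → ℝ≥0∞} (hI : HasInput I σ)
    (hW : 4 * (n + m) + 16 < W) (hl : I.IsLevel lev) (hlev : ∀ v : Fin n, σ.int 7 v = lev v)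
    (hd : ∀ v : Fin n, σ.wt 5 v = d₀ v)
    (hQ : ∀ t τ, t ≤ 150 * m + 10 →
      (∀ i, τ.wt 3 i ≤ σ.wt 3 i) →
      (∀ x y, I.graph.Adj x y → x ∉ I.P.support → lev x < lev y →
        τ.wt 3 (lev x) ≤ d₀ x + I.weight s(x, y) + I.ds y) →
      (∀ i, τ.wt 3 i = σ.wt 3 i ∨ ∃ x y, I.graph.Adj x y ∧ x ∉ I.P.support ∧ lev x = i ∧
        i < lev y ∧ τ.wt 3 i = d₀ x + I.weight s(x, y) + I.ds y) → Q t τ) :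
    WP W includeQuery Q σ := by
  refine WP_for_const (C := 150) (fun k τ => (∀ i, τ.wt 3 i ≤ σ.wt 3 i) ∧
      (∀ j : Fin m, j.1 < k → ∀ x y, s(I.fst j, I.snd j) = s(x, y) → x ∉ I.P.support →
        lev x < lev y → τ.wt 3 (lev x) ≤ d₀ x + I.weight s(x, y) + I.ds y) ∧
      (∀ i, τ.wt 3 i = σ.wt 3 i ∨ ∃ x y, I.graph.Adj x y ∧ x ∉ I.P.support ∧ lev x = i ∧
        i < lev y ∧ τ.wt 3 i = d₀ x + I.weight s(x, y) + I.ds y))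
    (by decide) (by decide) (by decide) hI.m_eq (by omega) (by omega) (by simp) ?_ ?_
  swap
  · rintro t τ ht - ⟨h1, h2, h3⟩
    refine hQ t τ ht h1 (fun x y hxy => ?_) h3
    obtain ⟨j, hj⟩ := exists_edge hxy
    exact h2 j j.2 x y hj
  rintro k τ hk hf hx ⟨i1, i2, i3⟩
  have J := hI.congr (hf.1 0 (by decide)) (hf.1 1 (by decide)) (hf.1 2 (by decide))
    (hf.1 3 (by decide)) (hf.2 0 (by decide)) (hf.2 1 (by decide)) (hf.2 2 (by decide))
  have e7 : ∀ v : Fin n, τ.int 7 v = lev v := by rw [hf.1 7 (by decide)]; exact hlev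
  refine WP_seq (WP_orientEdge J hW hl e7 ⟨k, hk⟩ hx ?_)
  intro t ρ x y ht hfρ hxy h60 h61
  have Jρ := J.congr (hfρ.1 0 (by decide)) (hfρ.1 1 (by decide)) (hfρ.1 2 (by decide))
    (hfρ.1 3 (by decide)) (hfρ.2 0 (by decide)) (hfρ.2 1 (by decide)) (hfρ.2 2 (by decide))
  have E36 : ρ.int 36 0 = k := by rw [hfρ.1 36 (by decide)]; exact hx
  rw [← hfρ.2 3 (by decide)] at i1 i2 i3
  have lx : ρ.int 7 x = lev x := by rw [hfρ.1 7 (by decide)]; exact e7 x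
  have ly : ρ.int 7 y = lev y := by rw [hfρ.1 7 (by decide)]; exact e7 y
  have bx := hl.le x
  have bY := hl.le y
  have hp := I.length_lt
  have cx := x.2
  have cy := y.2
  have px := Jρ.path_eq _ bx
  have cpx := (I.P.getVert (lev x)).2
  have d2 := Jρ.ds_eq y
  have d3 : ρ.wt 0 k = I.weight s(x, y) := by rw [← hxy.1]; exact Jρ.weight_eq ⟨k, hk⟩
  have d5 : ρ.wt 5 x = d₀ x := by rw [hfρ.2 5 (by decide), hf.2 5 (by decide)]; exact hd x
  have hpx : (I.P.getVert (lev x) : ℕ) = x ↔ x ∈ I.P.support :=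
    Fin.ext_iff.symm.trans (hl.mem_support_iff x).symm
  refine WP_cond (by simp [h60, h61, lx, ly, px]; omega) (fun h => ?_) (fun h => ?_)
  · simp [h60, h61, lx, ly, px, hpx] at h
    obtain ⟨hoff, hlt⟩ := h
    refine WP_cond (by simp [h60, h61, lx, E36]; omega) (fun hc => ?_) (fun hc => ?_)
    · simp [h60, h61, lx, E36, d2, d3, d5] at hc
      refine WP_skip ⟨by simp; omega, by simpa using i1, fun j hj a b hab ha hlt' => ?_,
        by simpa using i3⟩
      by_cases e : j.1 = k
      · obtain rfl : j = ⟨k, hk⟩ := Fin.ext e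
        obtain ⟨rfl, rfl⟩ := hxy.eq_of_lt hab hlt'
        simpa using hc
      · simpa using i2 j (by omega) a b hab ha hlt'
    · simp [h60, h61, lx, E36, d2, d3, d5] at hc
      have hmono : ∀ i, Function.update (ρ.wt 3) (lev x) (d₀ x + I.weight s(x, y) + I.ds y) i ≤
          ρ.wt 3 i := fun i => by
        by_cases e : i = lev x
        · subst e; simpa using hc.le
        · simp [e]
      refine WP_setWt (by simp [h60, lx]; omega) (by simp [h60, h61, E36]; omega)
        ⟨by simp; omega, fun i => ?_, fun j hj a b hab ha hlt' => ?_, fun i => ?_⟩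
      · simpa [h60, h61, lx, E36, d2, d3, d5] using (hmono i).trans (i1 i)
      · by_cases e : j.1 = k
        · obtain rfl : j = ⟨k, hk⟩ := Fin.ext e
          obtain ⟨rfl, rfl⟩ := hxy.eq_of_lt hab hlt'
          simp [h60, h61, lx, E36, d2, d3, d5]
        · simpa [h60, h61, lx, E36, d2, d3, d5] using
            (hmono _).trans (i2 j (by omega) a b hab ha hlt')
      · by_cases e : i = lev x
        · subst e
          exact .inr ⟨x, y, hxy.adj, hoff, rfl, hlt, by simp [h60, h61, lx, E36, d2, d3, d5]⟩
        · simpa [h60, h61, lx, E36, d2, d3, d5, e] using i3 i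
  · simp [h60, h61, lx, ly, px, hpx] at h
    refine WP_skip ⟨by simp; omega, by simpa using i1, fun j hj a b hab ha hlt' => ?_,
        by simpa using i3⟩
    by_cases e : j.1 = k
    · obtain rfl : j = ⟨k, hk⟩ := Fin.ext e
      obtain ⟨rfl, rfl⟩ := hxy.eq_of_lt hab hlt'
      have := h ha
      omega
    · simpa using i2 j (by omega) a b hab ha hlt'

/-- The first part of the reduction: the construction of the query graph, and the minima over the
edges that bypass the deleted node. -/
def prepareQuery : Prog := .seq computeLevels (.seq buildQuery (.seq nodeIntervals rowMinima))

theorem reducesNodeAvoiding : ReducesNodeAvoiding prepareQuery includeQuery 10000 := by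
  intro n m I
  have hp := I.length_lt
  have hp0 := I.length_pos
  have hI := I.hasInput_input
  suffices H : WP (10000 * (n + m)) prepareQuery
      (fun t σ => t ≤ 9000 * (n + m) ∧ ∃ (l : ℕ) (D : ListedGraph n l) (lev : Fin n → ℕ),
        l ≤ m ∧ StoresQuery σ D I.r ∧ HasInput I σ ∧ I.IsLevel lev ∧
        (∀ v : Fin n, σ.int 7 v = lev v) ∧ IsQueryDist I lev (wdist D.graph D.weight I.r) ∧
        ∀ i < I.P.length,
          (∀ x y, I.graph.Adj x y → lev x < i → i < lev y →
            σ.wt 3 i ≤ I.dr x + I.weight s(x, y) + I.ds y) ∧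
          (σ.wt 3 i = ⊤ ∨ ∃ x y, I.graph.Adj x y ∧ lev x < i ∧ i < lev y ∧
            σ.wt 3 i = I.dr x + I.weight s(x, y) + I.ds y)) I.input by
    obtain ⟨t, σ, hA, ht, l, D, lev, hlm, hst, hIσ, hl, hlev, hd, hrow⟩ := H
    have hans : HasInput I (σ.answer D I.r) := hIσ.congr rfl rfl rfl rfl
      (by simp [State.answer]) (by simp [State.answer]) (by simp [State.answer])
    have h3 : (σ.answer D I.r).wt 3 = σ.wt 3 := by simp [State.answer]
    obtain ⟨u, τ, hB, hu, hsol⟩ : WP (10000 * (n + m)) includeQuery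
        (fun u τ => u ≤ 150 * m + 10 ∧ I.NodeSolved τ) (σ.answer D I.r) := by
      refine WP_includeQuery (d₀ := wdist D.graph D.weight I.r) hans (by omega) hl hlev
        (fun v => by simp [State.answer, toArray]) fun u τ hu h1 h2 h4 => ⟨hu, ?_⟩
      intro i hi hr hs
      have hip : i < I.P.length := by
        refine lt_of_le_of_ne hi fun e => hs ?_
        rw [e, SimpleGraph.Walk.getVert_length]
      rw [h3] at h1 h4
      obtain ⟨r1, r2⟩ := hrow i hip
      refine hl.eq_wdist_deleteNode hd hip hr hs (fun x y ha hx hy => (h1 i).trans (r1 x y ha hx hy))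
        (fun x y ha hP hx hy => ?_) ?_
      · subst hx
        exact h2 x y ha hP hy
      · rcases h4 i with h | h
        · rw [h]
          exact r2.imp id .inl
        · exact .inr (.inr h)
    exact ⟨t, σ, n, l, D, I.r, u, τ, hA, hst, by omega, by omega, hB, by omega, hsol⟩
  refine WP_seq (WP_computeLevels hI (by omega) rfl rfl ?_)
  intro t1 σ1 lev ht1 hf1 hl hlev
  have hI1 : HasInput I σ1 := hI.congr (hf1.1 0 (by decide)) (hf1.1 1 (by decide))
    (hf1.1 2 (by decide)) (hf1.1 3 (by decide)) (hf1.2 0 (by decide)) (hf1.2 1 (by decide))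
    (hf1.2 2 (by decide))
  refine WP_seq (WP_buildQuery hI1 (by omega) hl hlev (hf1.1 12 (by decide)) ?_)
  intro t2 σ2 l ht2 hf2 h40 h41 h42 hL
  have hI2 : HasInput I σ2 := hI1.congr (hf2.1 0 (by decide)) (hf2.1 1 (by decide))
    (hf2.1 2 (by decide)) (hf2.1 3 (by decide)) (hf2.2 0 (by decide)) (hf2.2 1 (by decide))
    (hf2.2 2 (by decide))
  have hlev2 : ∀ v : Fin n, σ2.int 7 v = lev v := by rw [hf2.1 7 (by decide)]; exact hlev
  obtain ⟨D, hD, hd⟩ := hL.exists_graph hl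
  refine WP_seq (WP_nodeIntervals hI2 (by omega) hl hlev2 ?_)
  intro t3 σ3 ht3 hf3 hint
  have hI3 : HasInput I σ3 := hI2.congr (hf3.1 0 (by decide)) (hf3.1 1 (by decide))
    (hf3.1 2 (by decide)) (hf3.1 3 (by decide)) (hf3.2 0 (by decide)) (hf3.2 1 (by decide))
    (hf3.2 2 (by decide))
  refine WP_rowMinima (p := I.P.length) (m := m) hI3.p_eq hp0 hI3.m_eq rfl rfl (by omega)
    (by omega) (fun j hj => ?_) (fun j hj => ?_) ?_
  · obtain ⟨x, y, -, -, h26, -⟩ := hint ⟨j, hj⟩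
    have := hl.le x
    simp only at h26
    omega
  · obtain ⟨x, y, -, -, -, h27⟩ := hint ⟨j, hj⟩
    exact h27.trans_le (hl.le y)
  intro t4 σ4 ht4 hf4 hmin
  have hI4 : HasInput I σ4 := hI3.congr (hf4.1 0 (by decide)) (hf4.1 1 (by decide))
    (hf4.1 2 (by decide)) (hf4.1 3 (by decide)) (hf4.2 0 (by decide)) (hf4.2 1 (by decide))
    (hf4.2 2 (by decide))
  have e4 : σ4.int 4 = σ2.int 4 := (hf4.1 4 (by decide)).trans (hf3.1 4 (by decide))
  have e5 : σ4.int 5 = σ2.int 5 := (hf4.1 5 (by decide)).trans (hf3.1 5 (by decide))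
  have e6 : σ4.int 6 = σ2.int 6 := (hf4.1 6 (by decide)).trans (hf3.1 6 (by decide))
  have e7 : σ4.int 7 = σ2.int 7 := (hf4.1 7 (by decide)).trans (hf3.1 7 (by decide))
  have w4 : σ4.wt 4 = σ2.wt 4 := (hf4.2 4 (by decide)).trans (hf3.2 4 (by decide))
  refine ⟨by omega, l, D, lev, hL.le, ?_, hI4, hl, by rw [e7]; exact hlev2, hd, fun i hi => ?_⟩
  · rw [StoresQuery, e4, e5, e6, w4]
    exact ⟨h40, h41, h42, hD⟩
  obtain ⟨hle, heq⟩ := hmin i hi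
  refine ⟨fun x y hadj hx hy => ?_, heq.imp id ?_⟩
  · obtain ⟨j, hj⟩ := exists_edge hadj
    obtain ⟨x', y', hor, hval, h26, h27⟩ := hint j
    obtain ⟨rfl, rfl⟩ := hor.eq_of_lt hj (by omega)
    rw [← hval]
    refine hle j j.2 ?_
    change σ3.int 26 j ≤ i ∧ i < σ3.int 27 j
    omega
  · rintro ⟨j, hj, hs, e⟩
    obtain ⟨x, y, hor, hval, h26, h27⟩ := hint ⟨j, hj⟩
    simp only at h26 h27 hval
    change σ3.int 26 j ≤ i ∧ i < σ3.int 27 j at hs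
    exact ⟨x, y, hor.adj, by omega, by omega, e.trans hval⟩

end

end ReplacementPaths

theorem theorem1 :
    (∃ (A : ReplacementPaths.Prog) (c : ℕ), ReplacementPaths.SolvesEdgeAvoiding A c) ∧
    (∃ (A B : ReplacementPaths.Prog) (c : ℕ), ReplacementPaths.ReducesNodeAvoiding A B c) :=
  ⟨⟨_, _, ReplacementPaths.solvesEdgeAvoiding⟩, ⟨_, _, _, ReplacementPaths.reducesNodeAvoiding⟩⟩
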